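/- **Setting.** Let $S\subset\mathbb R^n$ be unbounded and locally compact with $0\in S$, let $E=S\cup\{\infty\}$ be its one-point compactification with the Borel $\sigma$-field, and put $E^\circ:=\mathring S\setminus\{0\}$, where $\mathring S$ is the interior of $S$ in $\mathbb R^n$. For a right continuous process $X$ and a Borel set $D$ let $\tau_D=\inf\{s>0: X_s\notin D\}$. Let $X=((X_t)_{t\ge 0},(\mathbb P_x)_{x\in E})$ be a standard Markov process on $E$: a strong Markov process with respect to a right continuous filtration, with $\mathbb P_x(X_0=x)=1$, with right continuous paths that have left limits, absorbed outside $E^\circ$, and quasi-left continuous on $[0,\zeta)$, where $\zeta=\tau_{E^\circ}$ is its lifetime. A Borel function $f:D\to[0,\infty]$ is *excessive for $X$ killed on exiting $D$* if $\mathbb E_x(f(X_t);t<\tau_D)\le f(x)$ for all $t\ge 0$, $x\in D$, and $\lim_{t\to0+}\mathbb E_x(f(X_t);t<\tau_D)=f(x)$ for all $x\in D$. For such an $f$ put $D_f=\{x\in D:0<f(x)<\infty\}$. The *Doob $f$-transform* $X^f$ of $X$ killed on exiting $D$ is the (sub-)Markov process with transition semigroup $$P^f_t(x,dy)=\frac{f(y)}{f(x)}\,\mathbb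 P_x(X_t\in dy,\ t<\tau_{D_f})\ \ (x\in D_f),\qquad P^f_t(x,dy)=0\ \ (x\notin D_f),$$ so that its state space is $D_f$. **Inversion property (IP).** Let $Z$ be a right continuous process with values in $E$, regarded as killed at its exit time $\zeta^Z$ from a Borel set $U\subset E^\circ$, with laws $(\mathbb P^Z_x)_{x\in U}$. We say that $Z$ (with state space $U$) has the IP with characteristics $(I,h,v)$ if $I\ne\mathrm{Id}$ is an involution of $E$ with $I(U)=U$, $h$ is excessive for $Z$ killed on exiting $U$ with $0<h<\infty$ on $U$, $v$ is a positive continuous function on $U$, and, for every $x\in U$, the process $$\big(I(Z_{\gamma_t}),\ 0\le t<A_{\infty}\big)\ \text{ under }\mathbb P^Z_x$$ has the same finite-dimensional distributions (killed at time $A_\infty$) as the Doob transform $Z^h$ of $Z$ killed on exiting $U$, started from $I(x)$; here $A_t=\int_0^{t\wedge\zeta^Z}v(Z_s)^{-1}\,ds$ and $\gamma_t=\inf\{s:A_s>t\}$. For $Z=X$ one takes $U=E^\circ$. The characteristics are *continuous* if $I$ and $h$ are continuous on $U$. **Proposition 2.7 (conditioning).** Suppose that $X$ has the inversion property with continuous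 characteristics $(I,h,v)$. Let $F\subseteq E$ be a Borel set with $I(F)=F$, put $D=F\cap E^\circ$, and let $H:D\to[0,\infty)$ be continuous and excessive for $X$ killed on exiting $D$. Assume that $H(I(x))>0$ for all $x\in D$ with $H(x)>0$ (for instance, that $H>0$ on $D$). Let $Y=X^H$ be the Doob $H$-transform of $X$ killed on exiting $D$, in any right continuous realization; its state space is $\{x\in D:H(x)>0\}$. Then $Y$ has the inversion property with characteristics $(I,\tilde h,v)$, where $$\tilde h=\frac{\mathcal K H}{H},\qquad \mathcal K H(x)=h(x)\,H(I(x)).$$ In particular $\tilde h$ is excessive for $Y$, with $0<\tilde h<\infty$ on $\{x\in D:H(x)>0\}$. -/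

import Mathlib

open MeasureTheory Filter Topology Set
open scoped NNReal ENNReal

noncomputable section

/-! ### The state space -/

/-- The state space `E = S ∪ {∞}` carries its Borel `σ`-algebra. -/
instance OnePoint.instMeasurableSpaceSubset {n : ℕ} (S : Set (EuclideanSpace ℝ (Fin n))) :
    MeasurableSpace (OnePoint S) := borel _

instance OnePoint.instBorelSpaceSubset {n : ℕ} (S : Set (EuclideanSpace ℝ (Fin n))) :
    BorelSpace (OnePoint S) := ⟨rfl⟩

/-- The interior `E° = S° \ {0}` of the state space `E = S ∪ {∞}`, where `S°` is the interior of
`S` in `ℝⁿ`; the boundary of `E` is `∂S ∪ {0, ∞}`. -/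
def stateInterior {n : ℕ} (S : Set (EuclideanSpace ℝ (Fin n))) : Set (OnePoint S) :=
  (fun x : S => (x : OnePoint S)) ''
    {x : S | (x : EuclideanSpace ℝ (Fin n)) ∈ interior S ∧ (x : EuclideanSpace ℝ (Fin n)) ≠ 0}

/-! ### Processes, exit times, standard processes

A process with values in `E` is a family `X t : Ω → E`, `t ≥ 0`, of maps on a measurable space `Ω`
which carries a family `P x`, `x ∈ E`, of measures. -/

section StochasticProcesses

variable {E Ω : Type*} [MeasurableSpace E] [MeasurableSpace Ω]

/-- The exit time `inf {s > 0 : X_s ∉ D}`, which is `∞` if `X` never leaves `D`. -/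
def exitTime (X : ℝ≥0 → Ω → E) (D : Set E) (ω : Ω) : ℝ≥0∞ :=
  sInf {r : ℝ≥0∞ | ∃ s : ℝ≥0, 0 < s ∧ X s ω ∉ D ∧ r = (s : ℝ≥0∞)}

/-- `((X_t), (P_x))` is a standard Markov process on `E` with lifetime `ζ = exitTime X U`, absorbed
outside `U`, with respect to the filtration `ℱ`. -/
structure IsStandardProcess [TopologicalSpace E] (P : E → Measure Ω) (X : ℝ≥0 → Ω → E)
    (ℱ : Filtration ℝ≥0 ‹MeasurableSpace Ω›) (U : Set E) : Prop where
  isProbabilityMeasure : ∀ x, IsProbabilityMeasure (P x)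
  rightContinuous_filtration : ℱ.IsRightContinuous
  adapted : ∀ t, Measurable[ℱ t] (X t)
  measurable_transition : ∀ (t : ℝ≥0) (B : Set E), MeasurableSet B →
    Measurable fun x => P x {ω | X t ω ∈ B}
  normal : ∀ x, ∀ᵐ ω ∂P x, X 0 ω = x
  right_continuous : ∀ ω t, ContinuousWithinAt (fun s => X s ω) (Ici t) t
  left_limits : ∀ ω t, 0 < t → ∃ l, Tendsto (fun s => X s ω) (𝓝[<] t) (𝓝 l)
  absorbed : ∀ ω s t, s ≤ t → X s ω ∉ U → X t ω = X s ω
  strong_markov : ∀ (x : E) (T : Ω → WithTop ℝ≥0) (hT : IsStoppingTime ℱ T) (t : ℝ≥0)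
    (A : Set Ω) (B : Set E), MeasurableSet[hT.measurableSpace] A → MeasurableSet B →
      P x {ω | ω ∈ A ∧ T ω ≠ ⊤ ∧ X ((T ω).untopA + t) ω ∈ B}
        = ∫⁻ ω in {ω | ω ∈ A ∧ T ω ≠ ⊤}, P (X (T ω).untopA ω) {ω' | X t ω' ∈ B} ∂P x
  quasi_left_continuous : ∀ (x : E) (T : ℕ → Ω → WithTop ℝ≥0) (T' : Ω → WithTop ℝ≥0),
    (∀ k, IsStoppingTime ℱ (T k)) → IsStoppingTime ℱ T' →
    (∀ ω, Monotone fun k => T k ω) → (∀ ω, IsLUB (range fun k => T k ω) (T' ω)) →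
      ∀ᵐ ω ∂P x, ∀ t : ℝ≥0, T' ω = WithTop.some t → (t : ℝ≥0∞) < exitTime X U ω →
        Tendsto (fun k => X (T k ω).untopA ω) atTop (𝓝 (X t ω))

/-! ### Killing, excessive functions, Doob transforms -/

/-- The semigroup of `X` killed on exiting `D`: `E_x (f(X_t); t < τ_D)`. -/
def killedSemigroup (P : E → Measure Ω) (X : ℝ≥0 → Ω → E) (D : Set E) (t : ℝ≥0) (f : E → ℝ≥0∞)
    (x : E) : ℝ≥0∞ :=
  ∫⁻ ω in {ω | (t : ℝ≥0∞) < exitTime X D ω}, f (X t ω) ∂P x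

/-- `f` (only its values on `D` matter) is excessive for `X` killed on exiting `D`. -/
structure IsExcessiveOn (P : E → Measure Ω) (X : ℝ≥0 → Ω → E) (D : Set E) (f : E → ℝ≥0∞) :
    Prop where
  measurable : Measurable fun x : D => f x
  le : ∀ x ∈ D, ∀ t, killedSemigroup P X D t f x ≤ f x
  tendsto : ∀ x ∈ D, Tendsto (fun t => killedSemigroup P X D t f x) (𝓝[>] 0) (𝓝 (f x))

/-- The set `D_h = {x ∈ D : 0 < h(x) < ∞}`, on which the Doob `h`-transform lives. -/
def doobSet (D : Set E) (h : E → ℝ≥0∞) : Set E := {x | x ∈ D ∧ 0 < h x ∧ h x < ⊤}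

open Classical in
/-- The transition semigroup of the Doob `h`-transform of `X` killed on exiting `D`:
`P_t^h(x, dy) = h(y) / h(x) Q_t(x, dy)` for `x ∈ D_h` and `0` for other `x`, where `Q_t` is the
semigroup of `X` killed on exiting `D_h`. -/
def doobSemigroup (P : E → Measure Ω) (X : ℝ≥0 → Ω → E) (D : Set E) (h : E → ℝ≥0∞) (t : ℝ≥0)
    (x : E) : Measure E :=
  if x ∈ doobSet D h then
    (h x)⁻¹ • ((((P x).restrict {ω | (t : ℝ≥0∞) < exitTime X (doobSet D h) ω}).map
      (X t)).withDensity h)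
  else 0

/-! ### Finite-dimensional distributions of processes with a cemetery

A process with a cemetery is a family `W t : Ω → Option E`; the cemetery is `none`. Times
`t₁ ≤ t₂ ≤ …` are given through the increments `tᵢ - tᵢ₋₁ ≥ 0` (with `t₀ = 0`), each paired with a
set `Bᵢ`. -/

/-- The event `W_{t₁} ∈ B₁, …, W_{tₖ} ∈ Bₖ`, with times counted from `t`. -/
def cylinderEvent (W : ℝ≥0 → Ω → Option E) : ℝ≥0 → List (ℝ≥0 × Set E) → Set Ω
  | _, [] => univ
  | t, (s, B) :: l => {ω | ∃ y ∈ B, W (t + s) ω = some y} ∩ cylinderEvent W (t + s) l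

/-- The probability `∫_{B₁} p_{t₁}(x, dy₁) ∫_{B₂} p_{t₂ - t₁}(y₁, dy₂) ⋯` that a Markov process
with (sub-Markovian) transition semigroup `p`, started from `x`, is in `Bᵢ` at time `tᵢ`. -/
def semigroupFdd (p : ℝ≥0 → E → Measure E) : List (ℝ≥0 × Set E) → E → ℝ≥0∞
  | [], _ => 1
  | (s, B) :: l, x => ∫⁻ y in B, semigroupFdd p l y ∂(p s x)

/-- Under `Q`, the process `W` has the law of the Markov process with transition semigroup `p`
started from `x`. -/
def HasMarkovLaw (Q : Measure Ω) (W : ℝ≥0 → Ω → Option E) (p : ℝ≥0 → E → Measure E) (x : E) :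
    Prop :=
  ∀ l : List (ℝ≥0 × Set E), (∀ b ∈ l, MeasurableSet b.2) →
    Q (cylinderEvent W 0 l) = semigroupFdd p l x

open Classical in
/-- The process `X` killed on exiting `D`. -/
def killedProcess (X : ℝ≥0 → Ω → E) (D : Set E) (t : ℝ≥0) (ω : Ω) : Option E :=
  if (t : ℝ≥0∞) < exitTime X D ω then some (X t ω) else none

/-- `((Y_t), (P'_x))` is a right continuous realization of the Doob `h`-transform `X^h` of `X`
killed on exiting `D`: up to its exit from `D_h` it is the Markov process with the transition
semigroup of the `h`-transform. -/
structure IsDoobTransform [TopologicalSpace E] {Ω' : Type*} [MeasurableSpace Ω']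
    (P : E → Measure Ω) (X : ℝ≥0 → Ω → E) (D : Set E) (h : E → ℝ≥0∞)
    (P' : E → Measure Ω') (Y : ℝ≥0 → Ω' → E) : Prop where
  measurable : ∀ t, Measurable (Y t)
  right_continuous : ∀ ω t, ContinuousWithinAt (fun s => Y s ω) (Ici t) t
  law : ∀ x ∈ doobSet D h,
    HasMarkovLaw (P' x) (killedProcess Y (doobSet D h)) (doobSemigroup P X D h) x

/-! ### Time change and the inversion property -/

/-- The additive functional `A_t = ∫_0^t v(X_s)⁻¹ ds` of `X` killed on exiting `U` (it stays
constant after the exit). -/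
def clock (X : ℝ≥0 → Ω → E) (U : Set E) (v : E → ℝ) (t : ℝ≥0) (ω : Ω) : ℝ≥0∞ :=
  ∫⁻ s in {s : ℝ | 0 ≤ s ∧ s ≤ t ∧ (s.toNNReal : ℝ≥0∞) < exitTime X U ω},
    ENNReal.ofReal (v (X s.toNNReal ω))⁻¹

/-- The right inverse `γ_t = inf {s : A_s > t}` of the additive functional `A`. -/
def inverseClock (X : ℝ≥0 → Ω → E) (U : Set E) (v : E → ℝ) (t : ℝ≥0) (ω : Ω) : ℝ≥0 :=
  sInf {s : ℝ≥0 | (t : ℝ≥0∞) < clock X U v s ω}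

open Classical in
/-- The process `I(X_{γ_t})`, killed at time `A_∞`. -/
def invertedProcess (X : ℝ≥0 → Ω → E) (U : Set E) (I : E → E) (v : E → ℝ) (t : ℝ≥0) (ω : Ω) :
    Option E :=
  if ∃ s, (t : ℝ≥0∞) < clock X U v s ω then some (I (X (inverseClock X U v t ω) ω)) else none

/-- The process `X` (killed on exiting `U`, the interior of its state space) has the inversion
property with characteristics `(I, h, v)`: under `P_x` the process `I(X_{γ_t})` has the law of the
Doob transform `X^h` (killed on exiting `U`) started from `I(x)`. -/
structure HasInversionProperty [TopologicalSpace E] (P : E → Measure Ω) (X : ℝ≥0 → Ω → E)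
    (U : Set E) (I : E → E) (h : E → ℝ≥0∞) (v : E → ℝ) : Prop where
  involutive : Function.Involutive I
  ne_id : I ≠ id
  mapsTo : MapsTo I U U
  excessive : IsExcessiveOn P X U h
  pos_finite : ∀ x ∈ U, 0 < h x ∧ h x < ⊤
  continuousOn_v : ContinuousOn v U
  v_pos : ∀ x ∈ U, 0 < v x
  law : ∀ x ∈ U, HasMarkovLaw (P x) (invertedProcess X U I v) (doobSemigroup P X U h) (I x)

end StochasticProcesses

end

/-! Write V for the set of x in D with H(x) > 0, τ for the exit time from V, and K = h · (H ∘ I).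
Doob transforms and inversion are both absolute continuity statements. Up to a time r at which it is
alive, Y from x has the law of X killed at τ, with density H(X_r)/H(x). Likewise the inversion of X
from x has the law of X from I(x), killed on leaving E°, with density h(X_r)/h(I(x)).

The theorem composes these two facts. The first density, evaluated at the random time γ_t, shows
that I(Y_γ) is I(X_γ) weighted by H(X_{γ_t})/H(x). The second fact, localized to V (which I
preserves by the positivity assumption), replaces X_{γ_t} by I(X_t) under P_{I(x)}. The total weight
is h(X_t) H(I(X_t)) / (h(I(x)) H(x)) = K(X_t)/K(I(x)). Hence the inversion of Y is the Doob
K-transform of X from I(x). Since H · (K/H) = K, this is the K/H-transform of Y.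

Excessivity of K/H then follows from the law identity. Read from I(x), that identity says that the
killed semigroup of Y maps K/H at x to (K/H)(x) · P'_{I(x)}(A_∞ > t). This is at most (K/H)(x). As t
decreases to 0 the factor tends to P'_{I(x)}(A_∞ > 0) = P_x(τ > 0), which is 0 or 1 by Blumenthal's
law; the value 0 would make the killed semigroup annihilate H at x, contradicting H(x) > 0.

Two technical points shape the proof. First, densities are needed at random times and on events that
look slightly ahead. Both are reached as limits from the right along deterministic times, where no
uniform integrability is at hand. The identities are therefore tested against min(1, N/g), which
turns the density g into the bounded min(g, N); the mesh tends to 0 by dominated convergence, then N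
to infinity by monotone convergence. `measure_eq_lintegral_of_truncated` carries this, and it is
used both in `HasMarkovLaw.measure_aliveCylinder` (time change) and in
`HasInversionProperty.measure_aliveCylinder` (localization to V).

Second, exit events involve uncountably many times. A right continuous path is a Borel function of
its values on a countable set of times, and exit events become countable unions of complements of
analytic sets in that skeleton. They are thus null-measurable for every finite measure, which
suffices for all integrals here. -/

noncomputable section

/-! ### Universally measurable sets and capacitability -/

/-- A set is universally measurable if it is null-measurable for every finite measure. -/
def UniversallyMeasurable {N : Type*} [MeasurableSpace N] (C : Set N) : Prop :=
  ∀ μ : Measure N, IsFiniteMeasure μ → NullMeasurableSet C μ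

/-- Choquet capacitability: an analytic set contains compact sets of almost the same measure. -/
theorem MeasureTheory.AnalyticSet.exists_isCompact_lt {N : Type*} [TopologicalSpace N] [T2Space N]
    [MeasurableSpace N] [OpensMeasurableSpace N] [TopologicalSpace.PseudoMetrizableSpace N] {A : Set N}
    (hA : AnalyticSet A) (μ : Measure N)
    [IsFiniteMeasure μ] {a : ℝ≥0∞} (ha : a < μ A) : ∃ K ⊆ A, IsCompact K ∧ a ≤ μ K := by
  rw [AnalyticSet] at hA
  rcases hA with rfl | ⟨f, hf, rfl⟩
  · simp at ha
  let C : ∀ k : ℕ, (ℕ → ℕ) → Set (ℕ → ℕ) := fun k b => {x | ∀ i < k, x i ≤ b i}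
  -- `C k b` bounds only the first k coordinates. Bounding one more coordinate by n exhausts it
  -- increasingly as n grows, so some n keeps the measure above a.
  have step : ∀ (k : ℕ) (b : ℕ → ℕ), a < μ (f '' C k b) →
      ∃ n, a < μ (f '' C (k + 1) (Function.update b k n)) := by
    intro k b hb
    have hU : f '' C k b = ⋃ n, f '' C (k + 1) (Function.update b k n) := by
      rw [← image_iUnion]
      congr 1
      ext x
      simp only [C, mem_ofPred_eq, mem_iUnion]
      constructor
      · intro hx
        refine ⟨x k, fun i hi => ?_⟩
        rcases Nat.lt_succ_iff_lt_or_eq.1 hi with h | rfl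
        · rw [Function.update_of_ne h.ne]; exact hx i h
        · simp
      · rintro ⟨n, hx⟩ i hi
        have := hx i (by omega)
        rwa [Function.update_of_ne hi.ne] at this
    have hmono : Monotone fun n => f '' C (k + 1) (Function.update b k n) := by
      intro n m hnm
      refine image_mono fun x hx i hi => ?_
      have := hx i hi
      rcases Nat.lt_succ_iff_lt_or_eq.1 hi with h | rfl
      · rwa [Function.update_of_ne h.ne] at this ⊢
      · simp only [Function.update_self] at this ⊢; omega
    rw [hU, hmono.measure_iUnion] at hb
    exact lt_iSup_iff.1 hb
  choose! g hg using step
  let B : ℕ → ℕ → ℕ := fun k => Nat.rec (fun _ => 0) (fun k b => Function.update b k (g k b)) k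
  have hB : ∀ k, a < μ (f '' C k (B k)) := by
    intro k
    induction k with
    | zero => simpa [C] using ha
    | succ k ih => exact hg k (B k) ih
  have hstab : ∀ i k, i < k → B k i = B (i + 1) i := by
    intro i k hik
    induction k, hik using Nat.le_induction with
    | base => rfl
    | succ k hk ih =>
      rw [← ih]
      exact Function.update_of_ne (by omega) _ _
  let b : ℕ → ℕ := fun i => B (i + 1) i
  have hC : ∀ k, C k (B k) = C k b := by
    intro k
    ext x
    exact forall₂_congr fun i hi => by rw [hstab i k hi]
  have hKc : IsCompact (Set.pi univ fun i => Iic (b i)) :=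
    isCompact_univ_pi fun i => (finite_Iic (b i)).isCompact
  refine ⟨f '' Set.pi univ fun i => Iic (b i), image_subset_range _ _, hKc.image hf, ?_⟩
  -- The closures of the images of the partially bounded sets shrink into the image of the fully
  -- bounded, compact box, so continuity from above gives that image measure at least a.
  have hsub : ⋂ k, closure (f '' C k b) ⊆ f '' Set.pi univ fun i => Iic (b i) := by
    intro y hy
    by_contra hyK
    obtain ⟨u, w, hu, hw, hKu, hyw, huw⟩ := SeparatedNhds.of_isCompact_isCompact
      (hKc.image hf) (isCompact_singleton (x := y)) (disjoint_singleton_right.2 hyK)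
    obtain ⟨k, hk⟩ : ∃ k, C k b ⊆ f ⁻¹' u := by
      have hopen : IsOpen (f ⁻¹' u) := hu.preimage hf
      -- Truncation moves the points `x k` into the compact box. In each fixed coordinate it is idle
      -- for large k, so a limit of the truncated subsequence is a limit of the subsequence itself.
      let r : (ℕ → ℕ) → (ℕ → ℕ) := fun x i => min (x i) (b i)
      by_contra! hcon
      have : ∀ k, ∃ x, x ∈ C k b ∧ x ∉ f ⁻¹' u := fun k => not_subset.1 (hcon k)
      choose x hxC hxu using this
      have hr : ∀ k, r (x k) ∈ Set.pi univ fun i => Iic (b i) := fun k i _ => mem_Iic.2 (min_le_right _ _)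
      obtain ⟨z, hz, φ, hφ, hlim⟩ := hKc.tendsto_subseq hr
      have hlim' : Tendsto (fun k => x (φ k)) atTop (𝓝 z) := by
        rw [tendsto_pi_nhds] at hlim ⊢
        intro i
        refine (hlim i).congr' ?_
        filter_upwards [eventually_gt_atTop i] with k hk
        exact min_eq_left (hxC (φ k) i (hk.trans_le (hφ.id_le k)))
      have hzu : z ∈ f ⁻¹' u := hKu (mem_image_of_mem f hz)
      obtain ⟨k, hk⟩ := (hlim'.eventually (hopen.mem_nhds hzu)).exists
      exact hxu _ hk
    have h1 : f '' C k b ⊆ wᶜ := by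
      rintro _ ⟨x, hx, rfl⟩ hxw
      exact disjoint_left.1 huw (hk hx) hxw
    exact closure_minimal h1 hw.isClosed_compl (mem_iInter.1 hy k) (hyw rfl)
  have hanti : Antitone fun k => closure (f '' C k b) := fun k l hkl =>
    closure_mono (image_mono fun x hx i hi => hx i (hi.trans_le hkl))
  refine le_trans ?_ (measure_mono hsub)
  rw [hanti.measure_iInter (fun k => isClosed_closure.nullMeasurableSet) ⟨0, measure_ne_top _ _⟩]
  refine le_iInf fun k => ((hB k).le.trans ?_)
  rw [hC]
  exact measure_mono subset_closure

/-- Compact subsets of nearly full measure have a countable union that agrees with the set up to a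
null set. -/
theorem MeasureTheory.AnalyticSet.universallyMeasurable {N : Type*} [TopologicalSpace N] [T2Space N]
    [MeasurableSpace N] [OpensMeasurableSpace N] [TopologicalSpace.PseudoMetrizableSpace N] {A : Set N}
    (hA : AnalyticSet A) : UniversallyMeasurable A := by
  intro μ _
  by_cases h0 : μ A = 0
  · exact NullMeasurableSet.of_null h0
  obtain ⟨u, -, hu, hlim⟩ := exists_seq_strictMono_tendsto' (pos_iff_ne_zero.2 h0)
  have : ∀ n, ∃ K ⊆ A, IsCompact K ∧ u n ≤ μ K := fun n => hA.exists_isCompact_lt μ (hu n).2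
  choose K hKA hKc hK using this
  have hm : MeasurableSet (⋃ n, K n) := MeasurableSet.iUnion fun n => (hKc n).measurableSet
  have hle : μ A ≤ μ (⋃ n, K n) :=
    le_of_tendsto' hlim fun n => (hK n).trans (measure_mono (subset_iUnion K n))
  have hae : (⋃ n, K n) =ᵐ[μ] A :=
    ae_eq_of_subset_of_measure_ge (iUnion_subset hKA) hle hm.nullMeasurableSet (measure_ne_top _ _)
  exact hm.nullMeasurableSet.congr hae

theorem UniversallyMeasurable.compl {N : Type*} [MeasurableSpace N] {C : Set N}
    (hC : UniversallyMeasurable C) : UniversallyMeasurable Cᶜ := fun μ hμ => (hC μ hμ).compl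

theorem UniversallyMeasurable.iUnion {N ι : Type*} [Countable ι] [MeasurableSpace N] {C : ι → Set N}
    (hC : ∀ i, UniversallyMeasurable (C i)) : UniversallyMeasurable (⋃ i, C i) :=
  fun μ hμ => NullMeasurableSet.iUnion fun i => hC i μ hμ

theorem UniversallyMeasurable.inter {N : Type*} [MeasurableSpace N] {C C' : Set N}
    (hC : UniversallyMeasurable C) (hC' : UniversallyMeasurable C') :
    UniversallyMeasurable (C ∩ C') := fun μ hμ => (hC μ hμ).inter (hC' μ hμ)

theorem MeasurableSet.universallyMeasurable {N : Type*} [MeasurableSpace N] {C : Set N}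
    (hC : MeasurableSet C) : UniversallyMeasurable C := fun _ _ => hC.nullMeasurableSet

theorem UniversallyMeasurable.preimage {N Ω : Type*} [MeasurableSpace N] [MeasurableSpace Ω]
    {C : Set N} (hC : UniversallyMeasurable C) {f : Ω → N} (hf : Measurable f) :
    UniversallyMeasurable (f ⁻¹' C) := fun μ _ =>
  (hC (μ.map f) inferInstance).preimage (hf.quasiMeasurePreserving μ)

/-! ### The one-point compactification is Polish -/

theorem OnePoint.secondCountableTopology (X : Type*) [TopologicalSpace X]
    [SecondCountableTopology X] [LocallyCompactSpace X] [T2Space X] :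
    SecondCountableTopology (OnePoint X) := by
  let b := TopologicalSpace.countableBasis X
  have hb := TopologicalSpace.isBasis_countableBasis X
  let K : CompactExhaustion X := default
  refine TopologicalSpace.IsTopologicalBasis.secondCountableTopology
    (b := ((fun s : Set X => ((↑) '' s : Set (OnePoint X))) '' b) ∪
      range fun n => ((↑) '' (K n) : Set (OnePoint X))ᶜ) ?_
    (((TopologicalSpace.countable_countableBasis X).image _).union (countable_range _))
  refine TopologicalSpace.isTopologicalBasis_of_isOpen_of_nhds ?_ ?_
  · rintro _ (⟨s, hs, rfl⟩ | ⟨n, rfl⟩)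
    · exact OnePoint.isOpen_image_coe.2 (hb.isOpen hs)
    · exact OnePoint.isOpen_compl_image_coe.2 ⟨(K.isCompact n).isClosed, K.isCompact n⟩
  · intro a u ha hu
    induction a with
    | infty =>
      obtain ⟨h1, h2⟩ := (OnePoint.isOpen_iff_of_mem' ha).1 hu
      obtain ⟨n, hn⟩ := K.exists_superset_of_isCompact h1
      refine ⟨_, Or.inr ⟨n, rfl⟩, OnePoint.infty_notMem_image_coe, ?_⟩
      intro y hy
      induction y with
      | infty => exact ha
      | coe y =>
        by_contra hyu
        exact hy ⟨y, hn hyu, rfl⟩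
    | coe x =>
      have hpre : IsOpen ((↑) ⁻¹' u : Set X) := hu.preimage OnePoint.continuous_coe
      obtain ⟨s, hs, hxs, hsu⟩ := hb.exists_subset_of_mem_open (a := x) ha hpre
      exact ⟨_, Or.inl ⟨s, hs, rfl⟩, ⟨x, hxs, rfl⟩, image_subset_iff.2 hsu⟩

theorem OnePoint.polishSpace (X : Type*) [TopologicalSpace X]
    [SecondCountableTopology X] [LocallyCompactSpace X] [T2Space X] :
    PolishSpace (OnePoint X) := by
  have := OnePoint.secondCountableTopology X
  let := TopologicalSpace.metrizableSpaceMetric (OnePoint X)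
  infer_instance

/-! ### Countable skeletons of right continuous paths -/

section Skeleton

/-- The grid point following `s` in the grid of mesh `1 / (m + 1)`. -/
def gridTime (m : ℕ) (s : ℝ≥0) : ℝ≥0 := ((⌊s * (m + 1)⌋₊ : ℝ≥0) + 1) / (m + 1)

/-- Strictness matters: the next grid time after γ_t lies strictly later, so by then the clock has
passed the level t. -/
theorem lt_gridTime (m : ℕ) (s : ℝ≥0) : s < gridTime m s := by
  rw [gridTime, lt_div_iff₀ (by positivity)]
  exact Nat.lt_floor_add_one _

theorem gridTime_le (m : ℕ) (s : ℝ≥0) : gridTime m s ≤ s + 1 / (m + 1) := by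
  rw [gridTime, add_div]
  gcongr
  rw [div_le_iff₀ (by positivity)]
  exact Nat.floor_le (by positivity)

theorem tendsto_add_one_div (s : ℝ≥0) :
    Tendsto (fun m : ℕ => s + 1 / ((m : ℝ≥0) + 1)) atTop (𝓝[≥] s) := by
  refine tendsto_nhdsWithin_iff.2 ⟨?_, Eventually.of_forall fun m => mem_Ici.2 le_self_add⟩
  have := (tendsto_one_div_add_atTop_nhds_zero_nat (𝕜 := ℝ≥0)).const_add s
  rwa [add_zero] at this

theorem tendsto_gridTime (s : ℝ≥0) : Tendsto (fun m => gridTime m s) atTop (𝓝[≥] s) := by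
  refine tendsto_nhdsWithin_iff.2 ⟨?_, Eventually.of_forall fun m => (lt_gridTime m s).le⟩
  exact tendsto_of_tendsto_of_tendsto_of_le_of_le tendsto_const_nhds
    (tendsto_nhdsWithin_iff.1 (tendsto_add_one_div s)).1 (fun m => (lt_gridTime m s).le)
    fun m => gridTime_le m s

variable {E : Type*}

/-- The time attached to an index of a skeleton. -/
def skeletonTime (i : ℕ × ℕ) : ℝ≥0 := ((i.2 : ℝ≥0) + 1) / (i.1 + 1)

/-- The restriction of a path to the positive rational times. -/
def skeleton (w : ℝ≥0 → E) (i : ℕ × ℕ) : E := w (skeletonTime i)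

/-- The path with a given skeleton. -/
def extendSkeleton [TopologicalSpace E] [Nonempty E] (p : ℕ × ℕ → E) (s : ℝ≥0) : E :=
  limUnder atTop fun m : ℕ => p (m, ⌊s * (m + 1)⌋₊)

/-- The path `w` stopped at time `r`. -/
def stopPath (r : ℝ≥0) (w : ℝ≥0 → E) (s : ℝ≥0) : E := w (min s r)

/-- A path is right continuous. -/
def IsRightContinuousPath [TopologicalSpace E] (w : ℝ≥0 → E) : Prop :=
  ∀ t, ContinuousWithinAt w (Ici t) t

theorem IsRightContinuousPath.tendsto_gridTime [TopologicalSpace E] {w : ℝ≥0 → E}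
    (hw : IsRightContinuousPath w) (s : ℝ≥0) :
    Tendsto (fun m => w (gridTime m s)) atTop (𝓝 (w s)) :=
  (hw s).tendsto.comp (_root_.tendsto_gridTime s)

theorem extendSkeleton_skeleton [TopologicalSpace E] [Nonempty E] [T2Space E] {w : ℝ≥0 → E}
    (hw : IsRightContinuousPath w) : extendSkeleton (skeleton w) = w := by
  funext s
  exact (hw.tendsto_gridTime s).limUnder_eq

theorem IsRightContinuousPath.stopPath [TopologicalSpace E] {w : ℝ≥0 → E}
    (hw : IsRightContinuousPath w) (r : ℝ≥0) : IsRightContinuousPath (stopPath r w) := by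
  intro t
  have h : ContinuousWithinAt (fun s : ℝ≥0 => min s r) (Ici t) t :=
    (continuous_id.min continuous_const).continuousWithinAt
  exact ContinuousWithinAt.comp (g := w) (f := fun s => min s r) (hw (min t r)) h
    fun s hs => min_le_min_right r hs

theorem IsRightContinuousPath.shift [TopologicalSpace E] {w : ℝ≥0 → E}
    (hw : IsRightContinuousPath w) (r : ℝ≥0) : IsRightContinuousPath fun s => w (r + s) := by
  intro t
  have h : ContinuousWithinAt (fun s : ℝ≥0 => r + s) (Ici t) t :=
    (continuous_const.add continuous_id).continuousWithinAt
  exact ContinuousWithinAt.comp (g := w) (f := fun s => r + s) (hw (r + t)) h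
    fun s hs => by simpa using hs

theorem stopPath_of_le {r s : ℝ≥0} (w : ℝ≥0 → E) (h : s ≤ r) : stopPath r w s = w s := by
  rw [stopPath, min_eq_left h]

/-- A path stopped at time `r` is at time `⌈r⌉ + 1` in its terminal position. -/
theorem skeleton_stopPath_ceil (w : ℝ≥0 → E) (r : ℝ≥0) :
    skeleton (stopPath r w) (0, ⌈r⌉₊) = w r := by
  rw [skeleton, stopPath, min_eq_right]
  simp only [skeletonTime, CharP.cast_eq_zero, zero_add, div_one]
  exact (Nat.le_ceil r).trans le_self_add

variable [MeasurableSpace E]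

theorem measurable_skeleton {Ω : Type*} [MeasurableSpace Ω] {Z : ℝ≥0 → Ω → E}
    (hZ : ∀ t, Measurable (Z t)) : Measurable fun ω => skeleton fun s => Z s ω :=
  measurable_pi_lambda _ fun _ => hZ _

theorem measurable_skeleton_stopPath {Ω : Type*} [MeasurableSpace Ω] {Z : ℝ≥0 → Ω → E}
    (hZ : ∀ t, Measurable (Z t)) (r : ℝ≥0) :
    Measurable fun ω => skeleton (stopPath r fun s => Z s ω) :=
  measurable_pi_lambda _ fun _ => hZ _

variable [TopologicalSpace E] [PolishSpace E] [BorelSpace E] [Nonempty E]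

/-- For each mesh the index of the next grid point takes countably many values, so the
approximations are jointly measurable in time and skeleton; `limUnder` preserves this in a Polish
space. -/
theorem measurable_extendSkeleton :
    Measurable fun q : ℝ≥0 × (ℕ × ℕ → E) => extendSkeleton q.2 q.1 := by
  have h : ∀ m : ℕ, StronglyMeasurable
      fun q : ℝ≥0 × (ℕ × ℕ → E) => q.2 (m, ⌊q.1 * (m + 1)⌋₊) := by
    intro m
    refine Measurable.stronglyMeasurable ?_
    have h1 : Measurable fun q : ℝ≥0 × (ℕ × ℕ → E) => ⌊q.1 * (m + 1)⌋₊ :=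
      Nat.measurable_floor.comp (measurable_fst.mul_const _)
    have h2 : Measurable fun z : ℕ × (ℕ × ℕ → E) => z.2 (m, z.1) :=
      measurable_from_prod_countable_right fun k => measurable_pi_apply (m, k)
    exact h2.comp (h1.prodMk measurable_snd)
  exact (StronglyMeasurable.limUnder h).measurable

theorem Measurable.extendSkeleton {Ω : Type*} [MeasurableSpace Ω] {T : Ω → ℝ≥0}
    {p : Ω → ℕ × ℕ → E} (hT : Measurable T) (hp : Measurable p) :
    Measurable fun ω => extendSkeleton (p ω) (T ω) :=
  measurable_extendSkeleton.comp (hT.prodMk hp)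

theorem measurable_uncurry_of_isRightContinuousPath {Ω : Type*} [MeasurableSpace Ω]
    {Z : ℝ≥0 → Ω → E} (hZ : ∀ t, Measurable (Z t))
    (hr : ∀ ω, IsRightContinuousPath fun s => Z s ω) {T : Ω → ℝ≥0} (hT : Measurable T) :
    Measurable fun ω => Z (T ω) ω := by
  have h := hT.extendSkeleton (measurable_skeleton hZ)
  simpa only [extendSkeleton_skeleton (hr _)] using h

/-- The complement is the projection of a Borel set of pairs (time, skeleton), hence analytic. -/
theorem universallyMeasurable_forall_mem {J : Set ℝ≥0} (hJ : MeasurableSet J) {V : Set E}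
    (hV : MeasurableSet V) :
    UniversallyMeasurable {p : ℕ × ℕ → E | ∀ s ∈ J, extendSkeleton p s ∈ V} := by
  have hm : MeasurableSet {q : ℝ≥0 × (ℕ × ℕ → E) | q.1 ∈ J ∧ extendSkeleton q.2 q.1 ∉ V} :=
    (measurable_fst hJ).inter (measurable_extendSkeleton hV.compl)
  have h := (hm.analyticSet_image measurable_snd).universallyMeasurable.compl
  convert h using 1
  ext p
  simp only [mem_ofPred_eq, mem_compl_iff, mem_image, Prod.exists, exists_eq_right, not_exists,
    not_and, not_not]

end Skeleton

/-! ### Exit times -/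

section ExitTime

variable {E Ω : Type*}

/-- Being alive at t includes a margin beyond t. The event therefore looks infinitesimally into the
future, which is why right continuity of the filtration is needed later. -/
theorem lt_exitTime_iff {X : ℝ≥0 → Ω → E} {D : Set E} {ω : Ω} {t : ℝ≥0} :
    (t : ℝ≥0∞) < exitTime X D ω ↔ ∃ u > t, ∀ s, 0 < s → s < u → X s ω ∈ D := by
  constructor
  · intro h
    obtain ⟨u, htu, hu⟩ := ENNReal.lt_iff_exists_nnreal_btwn.1 h
    refine ⟨u, by exact_mod_cast htu, fun s hs hsu => ?_⟩
    by_contra hD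
    have h1 : exitTime X D ω ≤ s := sInf_le ⟨s, hs, hD, rfl⟩
    exact absurd (hu.trans_le h1) (not_lt.2 (by exact_mod_cast hsu.le))
  · rintro ⟨u, htu, hu⟩
    refine lt_of_lt_of_le (b := (u : ℝ≥0∞)) (by exact_mod_cast htu) (le_sInf ?_)
    rintro _ ⟨s, hs, hsD, rfl⟩
    by_contra hlt
    exact hsD (hu s hs (by exact_mod_cast not_le.1 hlt))

theorem mem_of_lt_exitTime {X : ℝ≥0 → Ω → E} {D : Set E} {ω : Ω} {t s : ℝ≥0}
    (h : (t : ℝ≥0∞) < exitTime X D ω) (hs : 0 < s) (hst : s ≤ t) : X s ω ∈ D := by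
  obtain ⟨u, htu, hu⟩ := lt_exitTime_iff.1 h
  exact hu s hs (hst.trans_lt htu)

theorem exitTime_mono {X : ℝ≥0 → Ω → E} {D D' : Set E} (hD : D ⊆ D') (ω : Ω) :
    exitTime X D ω ≤ exitTime X D' ω :=
  sInf_le_sInf fun _ ⟨s, hs, hX, h⟩ => ⟨s, hs, fun h' => hX (hD h'), h⟩

/-- The exit time splits at a time `s` before it. -/
theorem add_lt_exitTime_iff {X : ℝ≥0 → Ω → E} {D : Set E} {ω : Ω} {s t : ℝ≥0}
    (hs : (s : ℝ≥0∞) < exitTime X D ω) :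
    ((s + t : ℝ≥0) : ℝ≥0∞) < exitTime X D ω ↔
      (t : ℝ≥0∞) < exitTime (fun u => X (s + u)) D ω := by
  obtain ⟨a, hsa, ha⟩ := lt_exitTime_iff.1 hs
  rw [lt_exitTime_iff, lt_exitTime_iff]
  constructor
  · rintro ⟨u, hu, h⟩
    refine ⟨u - s, lt_tsub_iff_left.2 hu, fun r hr hru => h _ (by positivity) ?_⟩
    exact lt_tsub_iff_left.1 hru
  · rintro ⟨u, hu, h⟩
    refine ⟨s + u, by gcongr, fun r hr hru => ?_⟩
    rcases lt_or_ge r a with hra | hra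
    · exact ha r hr hra
    · have hsr : s < r := hsa.trans_le hra
      have := h (r - s) (tsub_pos_of_lt hsr) ((tsub_lt_iff_left hsr.le).2 hru)
      rwa [add_tsub_cancel_of_le hsr.le] at this

/-- The coordinate process on the space of all paths. -/
def coordinateProcess (s : ℝ≥0) (w : ℝ≥0 → E) : E := w s

variable [MeasurableSpace E] [MeasurableSpace Ω] [TopologicalSpace E] [PolishSpace E] [BorelSpace E]
  [Nonempty E]

theorem universallyMeasurable_lt_exitTime {D : Set E} (hD : MeasurableSet D) (t : ℝ≥0) :
    UniversallyMeasurable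
      {p : ℕ × ℕ → E | (t : ℝ≥0∞) < exitTime coordinateProcess D (extendSkeleton p)} := by
  have h : ∀ m : ℕ, UniversallyMeasurable
      {p : ℕ × ℕ → E | ∀ s ∈ Ioo 0 (t + 1 / ((m : ℝ≥0) + 1)), extendSkeleton p s ∈ D} :=
    fun m => universallyMeasurable_forall_mem measurableSet_Ioo hD
  convert UniversallyMeasurable.iUnion h using 1
  ext p
  simp only [mem_ofPred_eq, lt_exitTime_iff, mem_iUnion, coordinateProcess, mem_Ioo, and_imp]
  constructor
  · rintro ⟨u, hu, h⟩
    have : ∀ᶠ m : ℕ in atTop, t + 1 / ((m : ℝ≥0) + 1) < u :=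
      (tendsto_nhdsWithin_iff.1 (tendsto_add_one_div t)).1.eventually_lt_const hu
    obtain ⟨m, hm⟩ := this.exists
    exact ⟨m, fun s hs hsm => h s hs (hsm.trans hm)⟩
  · rintro ⟨m, h⟩
    exact ⟨_, lt_add_of_pos_right _ (by positivity), h⟩

theorem nullMeasurableSet_lt_exitTime {Z : ℝ≥0 → Ω → E} (hZ : ∀ t, Measurable (Z t))
    (hr : ∀ ω, IsRightContinuousPath fun s => Z s ω) {D : Set E} (hD : MeasurableSet D)
    (t : ℝ≥0) (Q : Measure Ω) [IsFiniteMeasure Q] :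
    NullMeasurableSet {ω | (t : ℝ≥0∞) < exitTime Z D ω} Q := by
  have h := ((universallyMeasurable_lt_exitTime hD t).preimage (measurable_skeleton hZ)) Q
    inferInstance
  convert h using 1
  ext ω
  simp only [mem_ofPred_eq, mem_preimage, extendSkeleton_skeleton (hr ω)]
  rfl

end ExitTime

/-! ### Cylinder events -/

section Cylinders

variable {E Ω Ω' : Type*}

/-- The last time of a cylinder event. -/
def totalTime (l : List (ℝ≥0 × Set E)) : ℝ≥0 := (l.map Prod.fst).sum

theorem totalTime_cons (b : ℝ≥0 × Set E) (l : List (ℝ≥0 × Set E)) :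
    totalTime (b :: l) = b.1 + totalTime l := by
  simp [totalTime]

theorem mem_cylinderEvent_cons {W : ℝ≥0 → Ω → Option E} {a s : ℝ≥0} {B : Set E}
    {l : List (ℝ≥0 × Set E)} {ω : Ω} :
    ω ∈ cylinderEvent W a ((s, B) :: l) ↔
      (∃ y ∈ B, W (a + s) ω = some y) ∧ ω ∈ cylinderEvent W (a + s) l := Iff.rfl

theorem mem_cylinderEvent_congr {W : ℝ≥0 → Ω → Option E} {W' : ℝ≥0 → Ω' → Option E} {ω : Ω}
    {ω' : Ω'} (l : List (ℝ≥0 × Set E)) {a b : ℝ≥0}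
    (h : ∀ u ≤ totalTime l, W (a + u) ω = W' (b + u) ω') :
    ω ∈ cylinderEvent W a l ↔ ω' ∈ cylinderEvent W' b l := by
  induction l generalizing a b with
  | nil => exact iff_of_true trivial trivial
  | cons c l ih =>
    obtain ⟨s, B⟩ := c
    rw [totalTime_cons] at h
    rw [mem_cylinderEvent_cons, mem_cylinderEvent_cons, h s le_self_add]
    refine and_congr_right fun _ => ih fun u hu => ?_
    rw [add_assoc, add_assoc]
    exact h (s + u) (by gcongr)

/-- Constraints at finitely many times form a cylinder event. -/
theorem exists_list_cylinderEvent [MeasurableSpace E] {ι : Type*} (F : Finset ι) (τ : ι → ℝ≥0)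
    {B : ι → Set E} (hB : ∀ i, MeasurableSet (B i)) {t r : ℝ≥0}
    (hF : ∀ i ∈ F, t ≤ τ i ∧ τ i ≤ r) (htr : t ≤ r) :
    ∃ l : List (ℝ≥0 × Set E), (∀ b ∈ l, MeasurableSet b.2) ∧ t + totalTime l = r ∧
      ∀ w : ℝ≥0 → Option E, w ∈ cylinderEvent (fun s w => w s) t l ↔
        (∀ i ∈ F, ∃ y ∈ B i, w (τ i) = some y) ∧ ∃ y, w r = some y := by
  classical
  -- Cylinder events are written with increments, so the constraints must be inserted in order of
  -- time, the earliest in front.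
  induction F using Finset.induction_on_min_value τ generalizing t with
  | empty =>
    -- The closing constraint `univ` at time r only records that the process is still alive there.
    refine ⟨[(r - t, univ)], by simp, by simp [totalTime, htr], fun w => ?_⟩
    simp [cylinderEvent, htr]
  | insert a s _ hmin ih =>
    obtain ⟨hta, har⟩ := hF a (Finset.mem_insert_self a s)
    obtain ⟨l, hl, hlr, h⟩ := ih (t := τ a)
      (fun i hi => ⟨hmin i hi, (hF i (Finset.mem_insert_of_mem hi)).2⟩) har
    refine ⟨(τ a - t, B a) :: l, ?_, ?_, fun w => ?_⟩
    · simpa [hB a] using hl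
    · rw [totalTime_cons, ← add_assoc, add_tsub_cancel_of_le hta, hlr]
    · rw [mem_cylinderEvent_cons, add_tsub_cancel_of_le hta, h, Finset.forall_mem_insert, and_assoc]

end Cylinders

theorem MeasureTheory.Measure.ext_of_forall_box {ι E : Type*} [MeasurableSpace E]
    {μ ν : Measure (ι → E)} [IsFiniteMeasure μ]
    (h : ∀ (F : Finset ι) (B : ι → Set E), (∀ i, MeasurableSet (B i)) →
      μ {p | ∀ i ∈ F, p i ∈ B i} = ν {p | ∀ i ∈ F, p i ∈ B i}) : μ = ν := by
  refine ext_of_generate_finite _ generateFrom_squareCylinders.symm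
    (isPiSystem_squareCylinders (fun _ => MeasurableSpace.isPiSystem_measurableSet)
      fun _ => MeasurableSet.univ) ?_ (by simpa using h ∅ (fun _ => univ) fun _ => .univ)
  rintro _ ⟨F, B, hB, rfl⟩
  exact h F B fun i => hB i trivial

theorem exists_list_skeleton_mem_box {E Ω : Type*} [MeasurableSpace E] {X : ℝ≥0 → Ω → E}
    {F : Finset (ℕ × ℕ)} {B : ℕ × ℕ → Set E}
    (hB : ∀ i, MeasurableSet (B i)) : ∃ l : List (ℝ≥0 × Set E), (∀ b ∈ l, MeasurableSet b.2) ∧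
      ∀ s, {ω | ∀ i ∈ F, skeleton (fun u => X (s + u) ω) i ∈ B i} =
        cylinderEvent (fun t ω => some (X t ω)) s l := by
  obtain ⟨l, hl, -, h⟩ := exists_list_cylinderEvent F skeletonTime hB (t := 0)
    (r := F.sup skeletonTime) (fun i hi => ⟨zero_le, Finset.le_sup hi⟩) zero_le
  refine ⟨l, hl, fun s => ?_⟩
  ext ω
  rw [mem_cylinderEvent_congr (W' := fun s w => w s) (b := 0) (ω' := fun u => some (X (s + u) ω))
    l fun u _ => by simp, h]
  simp [skeleton]

/-! ### The Markov property -/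

section Markov

variable {E Ω : Type*} [MeasurableSpace E] [MeasurableSpace Ω] [TopologicalSpace E]
  {P : E → Measure Ω} {X : ℝ≥0 → Ω → E} {ℱ : Filtration ℝ≥0 ‹MeasurableSpace Ω›} {U : Set E}

namespace IsStandardProcess

theorem measurable (hX : IsStandardProcess P X ℱ U) (t : ℝ≥0) : Measurable (X t) :=
  (hX.adapted t).mono (ℱ.le t) le_rfl

theorem markov (hX : IsStandardProcess P X ℱ U) (x : E) {s : ℝ≥0} {A : Set Ω}
    (hA : MeasurableSet[ℱ s] A) (t : ℝ≥0) {B : Set E} (hB : MeasurableSet B) :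
    P x (A ∩ {ω | X (s + t) ω ∈ B}) = ∫⁻ ω in A, P (X s ω) {ω' | X t ω' ∈ B} ∂P x := by
  have h := hX.strong_markov x (fun _ => WithTop.some s) (isStoppingTime_const ℱ s) t A B
    (by rwa [IsStoppingTime.measurableSpace_const]) hB
  have hs : ∀ ω, (ω ∈ A ∧ (WithTop.some s : WithTop ℝ≥0) ≠ ⊤) ↔ ω ∈ A :=
    fun ω => and_iff_left WithTop.coe_ne_top
  simp only [← and_assoc, hs, WithTop.untopA, WithTop.untopD_coe, ofPred_mem_eq] at h
  exact h

theorem measurable_map (hX : IsStandardProcess P X ℱ U) (t : ℝ≥0) :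
    Measurable fun y => (P y).map (X t) := by
  refine Measure.measurable_of_measurable_coe _ fun B hB => ?_
  simp only [Measure.map_apply (hX.measurable t) hB]
  exact hX.measurable_transition t B hB

theorem lintegral_markov (hX : IsStandardProcess P X ℱ U) (x : E) {s : ℝ≥0} {A : Set Ω}
    (hA : MeasurableSet[ℱ s] A) (t : ℝ≥0) {f : E → ℝ≥0∞} (hf : Measurable f) :
    ∫⁻ ω in A, f (X (s + t) ω) ∂P x = ∫⁻ ω in A, ∫⁻ ω', f (X t ω') ∂P (X s ω) ∂P x := by
  have key : ((P x).restrict A).map (X (s + t)) =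
      (((P x).restrict A).map (X s)).bind fun y => (P y).map (X t) := by
    ext B hB
    rw [Measure.map_apply (hX.measurable _) hB, Measure.bind_apply hB
      (hX.measurable_map t).aemeasurable, lintegral_map
      (f := fun y => (P y).map (X t) B) ((Measure.measurable_coe hB).comp (hX.measurable_map t)) (hX.measurable s),
      Measure.restrict_apply (hX.measurable _ hB), inter_comm]
    simp only [Measure.map_apply (hX.measurable t) hB]
    exact hX.markov x hA t hB
  rw [← lintegral_map hf (hX.measurable _), key, Measure.lintegral_bind
    (hX.measurable_map t).aemeasurable hf.aemeasurable,
    lintegral_map (f := fun y => ∫⁻ z, f z ∂(P y).map (X t))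
      ((Measure.measurable_lintegral hf).comp (hX.measurable_map t)) (hX.measurable s)]
  simp only [lintegral_map hf (hX.measurable t)]

/-- Measurability in the starting point and the Markov property go through one induction: the step
integrates the probability of the remaining cylinder against the one-step law, which requires its
measurability. -/
theorem cylinderEvent_markov (hX : IsStandardProcess P X ℱ U) {l : List (ℝ≥0 × Set E)}
    (hl : ∀ b ∈ l, MeasurableSet b.2) :
    (Measurable fun y => P y (cylinderEvent (fun t ω => some (X t ω)) 0 l)) ∧
    ∀ (x : E) (s : ℝ≥0) (A : Set Ω), MeasurableSet[ℱ s] A →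
      P x (A ∩ cylinderEvent (fun t ω => some (X t ω)) s l) =
        ∫⁻ ω in A, P (X s ω) (cylinderEvent (fun t ω => some (X t ω)) 0 l) ∂P x := by
  have := hX.isProbabilityMeasure
  induction l with
  | nil => simp [cylinderEvent]
  | cons b l ih =>
    obtain ⟨t, B⟩ := b
    obtain ⟨hm, hM⟩ := ih fun b hb => hl b (List.mem_cons_of_mem _ hb)
    have hB : MeasurableSet B := hl (t, B) List.mem_cons_self
    set f : E → ℝ≥0∞ := fun y => P y (cylinderEvent (fun t ω => some (X t ω)) 0 l) with hf
    have hcyl : ∀ a, cylinderEvent (fun t ω => some (X t ω)) a ((t, B) :: l) =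
        {ω | X (a + t) ω ∈ B} ∩ cylinderEvent (fun t ω => some (X t ω)) (a + t) l := by
      intro a
      simp [cylinderEvent]
    have hmB : ∀ a, MeasurableSet[ℱ a] {ω | X a ω ∈ B} := fun a => hX.adapted a hB
    have hstep : ∀ (x : E) (s : ℝ≥0) (A : Set Ω), MeasurableSet[ℱ s] A →
        P x (A ∩ cylinderEvent (fun t ω => some (X t ω)) s ((t, B) :: l)) =
          ∫⁻ ω in A, B.indicator f (X (s + t) ω) ∂P x := by
      intro x s A hA
      rw [hcyl, ← inter_assoc, hM x (s + t) _ ((ℱ.mono le_self_add A hA).inter (hmB _)),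
        inter_comm]
      exact (setLIntegral_indicator (hX.measurable _ hB) _).symm
    have h0 : ∀ y, P y (cylinderEvent (fun t ω => some (X t ω)) 0 ((t, B) :: l)) =
        ∫⁻ ω, B.indicator f (X t ω) ∂P y := by
      intro y
      have := hstep y 0 univ MeasurableSet.univ
      simpa using this
    have hBf : Measurable (B.indicator f) := hm.indicator hB
    constructor
    · simp only [h0, ← lintegral_map hBf (hX.measurable t)]
      exact (Measure.measurable_lintegral hBf).comp (hX.measurable_map t)
    · intro x s A hA
      simp only [hstep x s A hA, h0]
      exact hX.lintegral_markov x hA t hBf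

/-- The law of the skeleton of the process started from `y`. -/
def _root_.skeletonLaw (P : E → Measure Ω) (X : ℝ≥0 → Ω → E) (y : E) : Measure (ℕ × ℕ → E) :=
  (P y).map fun ω => skeleton fun s => X s ω

theorem isProbabilityMeasure_skeletonLaw (hX : IsStandardProcess P X ℱ U) (y : E) :
    IsProbabilityMeasure (skeletonLaw P X y) := by
  have := hX.isProbabilityMeasure
  exact Measure.isProbabilityMeasure_map (measurable_skeleton hX.measurable).aemeasurable

theorem measurable_skeletonLaw (hX : IsStandardProcess P X ℱ U) :
    Measurable (skeletonLaw P X) := by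
  have := hX.isProbabilityMeasure_skeletonLaw
  refine Measurable.measure_of_isPiSystem_of_isProbabilityMeasure
    generateFrom_squareCylinders.symm
    (isPiSystem_squareCylinders (fun _ => MeasurableSpace.isPiSystem_measurableSet)
      fun _ => MeasurableSet.univ) ?_
  rintro _ ⟨F, B, hB, rfl⟩
  obtain ⟨l, hl, h⟩ := exists_list_skeleton_mem_box (X := X) (F := F) (B := B)
    fun i => hB i trivial
  have hbox : MeasurableSet ((F : Set (ℕ × ℕ)).pi B) :=
    MeasurableSet.pi F.countable_toSet fun i _ => hB i trivial
  simp only [skeletonLaw, Measure.map_apply (measurable_skeleton hX.measurable) hbox]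
  convert (hX.cylinderEvent_markov hl).1 using 2 with y
  rw [← h 0]
  simp [Set.pi, Set.preimage]

/-- The Markov property for functionals of the whole path. -/
theorem map_skeleton_shift (hX : IsStandardProcess P X ℱ U) (x : E) {s : ℝ≥0} {A : Set Ω}
    (hA : MeasurableSet[ℱ s] A) :
    ((P x).restrict A).map (fun ω => skeleton fun u => X (s + u) ω) =
      (((P x).restrict A).map (X s)).bind (skeletonLaw P X) := by
  have := hX.isProbabilityMeasure
  refine Measure.ext_of_forall_box fun F B hB => ?_
  obtain ⟨l, hl, h⟩ := exists_list_skeleton_mem_box (X := X) (F := F) (B := B) hB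
  have hbox : MeasurableSet {p : ℕ × ℕ → E | ∀ i ∈ F, p i ∈ B i} :=
    MeasurableSet.pi F.countable_toSet fun i _ => hB i
  have hsm := measurable_skeleton (Z := fun u => X (s + u)) fun t => hX.measurable (s + t)
  rw [Measure.map_apply hsm hbox, Measure.bind_apply hbox hX.measurable_skeletonLaw.aemeasurable,
    lintegral_map (f := fun y => skeletonLaw P X y {p | ∀ i ∈ F, p i ∈ B i})
      ((Measure.measurable_coe hbox).comp hX.measurable_skeletonLaw)
      (hX.measurable s), Measure.restrict_apply (hsm hbox), inter_comm]
  have h1 := h s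
  have h2 := h 0
  simp only [zero_add] at h2
  simp only [skeletonLaw, Measure.map_apply (measurable_skeleton hX.measurable) hbox]
  change P x (A ∩ {ω | ∀ i ∈ F, skeleton (fun u => X (s + u) ω) i ∈ B i}) =
    ∫⁻ ω in A, P (X s ω) {ω' | ∀ i ∈ F, skeleton (fun u => X u ω') i ∈ B i} ∂P x
  rw [h1, h2]
  exact (hX.cylinderEvent_markov hl).2 x s A hA

end IsStandardProcess

end Markov

/-! ### Killed processes -/

section Killed

variable {E Ω : Type*}

theorem exists_killedProcess_eq_some_iff {X : ℝ≥0 → Ω → E} {D B : Set E} {t : ℝ≥0} {ω : Ω} :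
    (∃ y ∈ B, killedProcess X D t ω = some y) ↔
      (t : ℝ≥0∞) < exitTime X D ω ∧ X t ω ∈ B := by
  unfold killedProcess
  split_ifs with h <;> simp [h]

theorem killedProcess_add {X : ℝ≥0 → Ω → E} {D : Set E} {s : ℝ≥0} {ω : Ω}
    (hs : (s : ℝ≥0∞) < exitTime X D ω) (t : ℝ≥0) :
    killedProcess X D (s + t) ω = killedProcess coordinateProcess D t fun u => X (s + u) ω := by
  simp only [killedProcess, add_lt_exitTime_iff hs]
  rfl

/-- `E_x (g(X_t); X_{t₁} ∈ B₁, …, X_t ∈ Bₖ, t < τ_D)`, where `t` is the last of the times. -/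
def killedFdd [MeasurableSpace Ω] (P : E → Measure Ω) (X : ℝ≥0 → Ω → E) (D : Set E)
    (g : E → ℝ≥0∞) (l : List (ℝ≥0 × Set E)) (x : E) : ℝ≥0∞ :=
  ∫⁻ ω in cylinderEvent (killedProcess X D) 0 l, g (X (totalTime l) ω) ∂P x

/-- The functional of the path whose expectation is `killedFdd`. -/
def killedFunctional [TopologicalSpace E] [Nonempty E] (D : Set E) (g : E → ℝ≥0∞)
    (l : List (ℝ≥0 × Set E)) : (ℕ × ℕ → E) → ℝ≥0∞ :=
  {p | extendSkeleton p ∈ cylinderEvent (killedProcess coordinateProcess D) 0 l}.indicator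
    fun p => g (extendSkeleton p (totalTime l))

theorem killedFunctional_skeleton [TopologicalSpace E] [Nonempty E] [T2Space E] {D : Set E}
    {g : E → ℝ≥0∞} {l : List (ℝ≥0 × Set E)} {w : ℝ≥0 → E} (hw : IsRightContinuousPath w) :
    killedFunctional D g l (skeleton w) =
      (cylinderEvent (killedProcess coordinateProcess D) 0 l).indicator
        (fun w => g (w (totalTime l))) w := by
  unfold killedFunctional
  by_cases h : w ∈ cylinderEvent (killedProcess coordinateProcess D) 0 l
  · rw [indicator_of_mem h, indicator_of_mem
      (by rwa [mem_ofPred_eq, extendSkeleton_skeleton hw]), extendSkeleton_skeleton hw]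
  · rw [indicator_of_notMem h, indicator_of_notMem
      (by rwa [mem_ofPred_eq, extendSkeleton_skeleton hw])]

end Killed

section StandardProcess

variable {E Ω : Type*} [MeasurableSpace E] [MeasurableSpace Ω] [TopologicalSpace E]
  {P : E → Measure Ω} {X : ℝ≥0 → Ω → E} {ℱ : Filtration ℝ≥0 ‹MeasurableSpace Ω›} {U : Set E}

namespace IsStandardProcess

theorem isRightContinuousPath (hX : IsStandardProcess P X ℱ U) (ω : Ω) :
    IsRightContinuousPath fun s => X s ω := hX.right_continuous ω

theorem isFiniteMeasure_bind_skeletonLaw (hX : IsStandardProcess P X ℱ U) (μ : Measure E)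
    [IsFiniteMeasure μ] : IsFiniteMeasure (μ.bind (skeletonLaw P X)) := by
  have := hX.isProbabilityMeasure_skeletonLaw
  refine ⟨?_⟩
  rw [Measure.bind_apply MeasurableSet.univ hX.measurable_skeletonLaw.aemeasurable]
  simp

/-- Exit functionals are only universally measurable. A Borel version for the mixture of the laws
over μ is a version for μ-almost every starting point. -/
theorem aemeasurable_lintegral_skeletonLaw (hX : IsStandardProcess P X ℱ U)
    {Ψ : (ℕ × ℕ → E) → ℝ≥0∞} (hΨ : ∀ μ : Measure (ℕ × ℕ → E), IsFiniteMeasure μ → AEMeasurable Ψ μ)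
    (μ : Measure E) [IsFiniteMeasure μ] :
    AEMeasurable (fun y => ∫⁻ p, Ψ p ∂skeletonLaw P X y) μ := by
  have h := hΨ _ (hX.isFiniteMeasure_bind_skeletonLaw μ)
  refine ⟨fun y => ∫⁻ p, h.mk Ψ p ∂skeletonLaw P X y,
    (Measure.measurable_lintegral h.measurable_mk).comp hX.measurable_skeletonLaw, ?_⟩
  filter_upwards [Measure.ae_ae_of_ae_bind hX.measurable_skeletonLaw.aemeasurable h.ae_eq_mk]
    with y hy
  exact lintegral_congr_ae hy

theorem killedFdd_nil (hX : IsStandardProcess P X ℱ U) (D : Set E) {g : E → ℝ≥0∞} (x : E) :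
    killedFdd P X D g [] x = g x := by
  have := hX.isProbabilityMeasure x
  rw [killedFdd, cylinderEvent, Measure.restrict_univ]
  have : ∀ᵐ ω ∂P x, g (X (totalTime ([] : List (ℝ≥0 × Set E))) ω) = g x := by
    filter_upwards [hX.normal x] with ω hω
    simp [totalTime, hω]
  rw [lintegral_congr_ae this]
  simp

/-- Exit times ignore time 0, so membership there must come from normality. -/
theorem ae_mem_of_lt_exitTime (hX : IsStandardProcess P X ℱ U) {D : Set E} {x : E} (hx : x ∈ D) :
    ∀ᵐ ω ∂P x, ∀ t : ℝ≥0, (t : ℝ≥0∞) < exitTime X D ω → X t ω ∈ D := by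
  filter_upwards [hX.normal x] with ω hω t ht
  rcases eq_or_ne t 0 with rfl | h0
  · rwa [hω]
  · exact mem_of_lt_exitTime ht (pos_iff_ne_zero.2 h0) le_rfl

end IsStandardProcess

end StandardProcess

/-! ### Markov property of the killed process, Doob transforms, zero-one law -/

section KilledMarkov

variable {E Ω : Type*} [MeasurableSpace E] [MeasurableSpace Ω] [TopologicalSpace E]
  [PolishSpace E] [BorelSpace E] [Nonempty E]
  {P : E → Measure Ω} {X : ℝ≥0 → Ω → E} {ℱ : Filtration ℝ≥0 ‹MeasurableSpace Ω›} {U : Set E}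

theorem universallyMeasurable_cylinderEvent_killedProcess {D : Set E} (hD : MeasurableSet D)
    {l : List (ℝ≥0 × Set E)} (hl : ∀ b ∈ l, MeasurableSet b.2) (a : ℝ≥0) :
    UniversallyMeasurable {p : ℕ × ℕ → E |
      extendSkeleton p ∈ cylinderEvent (killedProcess coordinateProcess D) a l} := by
  induction l generalizing a with
  | nil => exact MeasurableSet.univ.universallyMeasurable
  | cons b l ih =>
    obtain ⟨s, B⟩ := b
    have hB : MeasurableSet B := hl (s, B) List.mem_cons_self
    have h1 : MeasurableSet {p : ℕ × ℕ → E | extendSkeleton p (a + s) ∈ B} :=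
      (measurable_const.extendSkeleton measurable_id) hB
    have h2 := ih (fun b hb => hl b (List.mem_cons_of_mem _ hb)) (a + s)
    convert ((universallyMeasurable_lt_exitTime hD (a + s)).inter
      h1.universallyMeasurable).inter h2 using 1
    ext p
    simp only [mem_ofPred_eq, mem_cylinderEvent_cons, exists_killedProcess_eq_some_iff, mem_inter_iff]
    rfl

theorem aemeasurable_killedFunctional {D : Set E} (hD : MeasurableSet D) {g : E → ℝ≥0∞}
    (hg : Measurable g) {l : List (ℝ≥0 × Set E)} (hl : ∀ b ∈ l, MeasurableSet b.2)
    (μ : Measure (ℕ × ℕ → E)) [IsFiniteMeasure μ] : AEMeasurable (killedFunctional D g l) μ :=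
  (hg.comp (measurable_const.extendSkeleton measurable_id)).aemeasurable.indicator₀
    (universallyMeasurable_cylinderEvent_killedProcess hD hl 0 μ inferInstance)

namespace IsStandardProcess

/-- Up to null sets, the event that `X` has not left `D` until shortly after `s` belongs to the
past of `s`. -/
theorem exists_measurableSet_ae_eq_lt_exitTime (hX : IsStandardProcess P X ℱ U) {D : Set E}
    (hD : MeasurableSet D) (x : E) (s : ℝ≥0) :
    ∃ A, MeasurableSet[ℱ s] A ∧ A =ᵐ[P x] {ω | (s : ℝ≥0∞) < exitTime X D ω} := by
  have := hX.isProbabilityMeasure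
  let r : ℕ → ℝ≥0 := fun m => s + 1 / ((m : ℝ≥0) + 1)
  have hr : Tendsto r atTop (𝓝 s) := (tendsto_nhdsWithin_iff.1 (tendsto_add_one_div s)).1
  have hra : Antitone r := fun m k hmk => by
    have : (m : ℝ≥0) ≤ k := by exact_mod_cast hmk
    simp only [r]
    gcongr
  have hsr : ∀ m, s < r m := fun m => lt_add_of_pos_right _ (by positivity)
  -- Stopping at `r m` makes the whole skeleton measurable for the past of `r m`, while still
  -- deciding whether the path stays in D on (0, `r m`).
  let φ : ℕ → Ω → ℕ × ℕ → E := fun m ω => skeleton (stopPath (r m) fun u => X u ω)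
  have hφ : ∀ m, Measurable[ℱ (r m)] (φ m) := fun m =>
    @measurable_pi_lambda Ω (ℕ × ℕ) (fun _ => E) (ℱ (r m)) _ (φ m) fun i =>
      (hX.adapted (min (skeletonTime i) (r m))).mono (ℱ.mono (min_le_right _ _)) le_rfl
  let C : ℕ → Set (ℕ × ℕ → E) := fun m => {p | ∀ u ∈ Ioo 0 (r m), extendSkeleton p u ∈ D}
  have hC : ∀ m, UniversallyMeasurable (C m) := fun m =>
    universallyMeasurable_forall_mem measurableSet_Ioo hD
  have hmem : ∀ m ω, φ m ω ∈ C m ↔ ∀ u, 0 < u → u < r m → X u ω ∈ D := by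
    intro m ω
    simp only [C, φ, mem_ofPred_eq, extendSkeleton_skeleton ((hX.isRightContinuousPath ω).stopPath _),
      mem_Ioo, and_imp]
    refine forall_congr' fun u => forall_congr' fun _ => forall_congr' fun hu => ?_
    rw [stopPath_of_le _ hu.le]
  have hφ' : ∀ m, Measurable (φ m) := fun m => (hφ m).mono (ℱ.le _) le_rfl
  -- The path event is replaced by a Borel set agreeing with it almost surely, so that the preimage
  -- lies in the filtration, which is not assumed complete.
  have hex : ∀ m, ∃ C', MeasurableSet C' ∧ C' =ᵐ[(P x).map (φ m)] C m := fun m => by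
    obtain ⟨C', -, h1, h2⟩ :=
      (hC m ((P x).map (φ m)) inferInstance).exists_measurable_superset_ae_eq
    exact ⟨C', h1, h2⟩
  choose C' hC'm hC' using hex
  have hae : ∀ᵐ ω ∂P x, ∀ m, φ m ω ∈ C' m ↔ φ m ω ∈ C m := by
    rw [ae_all_iff]
    intro m
    filter_upwards [ae_of_ae_map (hφ' m).aemeasurable (hC' m)] with ω hω
    exact iff_of_eq hω
  -- A lower limit depends only on the tail of the sequence, hence lies in the past of every j > s,
  -- and so in that of s by right continuity of the filtration.
  refine ⟨⋃ M, ⋂ m ≥ M, φ m ⁻¹' C' m, ?_, ?_⟩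
  · have := hX.rightContinuous_filtration
    refine Filtration.IsRightContinuous.measurableSet ?_
    rw [Filtration.rightCont_eq]
    simp only [MeasurableSpace.measurableSet_iInf]
    intro j hj
    obtain ⟨M₀, hM₀⟩ := (hr.eventually_lt_const hj).exists
    have heq : (⋃ M, ⋂ m ≥ M, φ m ⁻¹' C' m) = ⋃ M, ⋂ m ≥ max M M₀, φ m ⁻¹' C' m := by
      apply Subset.antisymm
      · exact iUnion_mono fun M => biInter_mono (fun m (hm : m ≥ max M M₀) =>
          show M ≤ m from (le_max_left M M₀).trans hm) fun _ _ => Subset.rfl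
      · exact iUnion_subset fun M => subset_iUnion_of_subset (max M M₀) Subset.rfl
    rw [heq]
    refine MeasurableSet.iUnion fun M => MeasurableSet.iInter fun m => MeasurableSet.iInter fun hm => ?_
    have hle : r m ≤ j := (hra ((le_max_right _ _).trans hm)).trans hM₀.le
    exact ℱ.mono hle _ (hφ m (hC'm m))
  · filter_upwards [hae] with ω hω
    apply propext
    change ω ∈ (⋃ M, ⋂ m ≥ M, φ m ⁻¹' C' m) ↔ (s : ℝ≥0∞) < exitTime X D ω
    simp only [mem_iUnion, mem_iInter, mem_preimage, hω, hmem, lt_exitTime_iff]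
    constructor
    · rintro ⟨M, hM⟩
      exact ⟨r M, hsr M, hM M le_rfl⟩
    · rintro ⟨u, hu, h⟩
      obtain ⟨M, hM⟩ := (hr.eventually_lt_const hu).exists
      exact ⟨M, fun m hm v hv hvm => h v hv (hvm.trans_le ((hra hm).trans hM.le))⟩

/-- The Markov property of the process killed on exiting `D`. -/
theorem lintegral_killed_markov (hX : IsStandardProcess P X ℱ U) {D : Set E}
    (hD : MeasurableSet D) (x : E) (s : ℝ≥0) {B : Set E} (hB : MeasurableSet B)
    {Ψ : (ℕ × ℕ → E) → ℝ≥0∞} (hΨ : ∀ μ : Measure (ℕ × ℕ → E), IsFiniteMeasure μ → AEMeasurable Ψ μ) :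
    ∫⁻ ω in {ω | (s : ℝ≥0∞) < exitTime X D ω ∧ X s ω ∈ B}, Ψ (skeleton fun u => X (s + u) ω) ∂P x =
      ∫⁻ ω in {ω | (s : ℝ≥0∞) < exitTime X D ω ∧ X s ω ∈ B},
        ∫⁻ p, Ψ p ∂skeletonLaw P X (X s ω) ∂P x := by
  have := hX.isProbabilityMeasure
  obtain ⟨A₀, hA₀, hae⟩ := hX.exists_measurableSet_ae_eq_lt_exitTime hD x s
  have hA : MeasurableSet[ℱ s] (A₀ ∩ {ω | X s ω ∈ B}) := hA₀.inter (hX.adapted s hB)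
  have hset : (A₀ ∩ {ω | X s ω ∈ B} : Set Ω) =ᵐ[P x]
      {ω | (s : ℝ≥0∞) < exitTime X D ω ∧ X s ω ∈ B} := hae.inter (ae_eq_refl _)
  have hsm := measurable_skeleton (Z := fun u => X (s + u)) fun t => hX.measurable (s + t)
  have hmap := hX.map_skeleton_shift x hA
  rw [← Measure.restrict_congr_set hset]
  rw [← lintegral_map' (f := Ψ) (hΨ _ inferInstance) hsm.aemeasurable, hmap,
    Measure.lintegral_bind hX.measurable_skeletonLaw.aemeasurable
      (hΨ _ (hX.isFiniteMeasure_bind_skeletonLaw _)),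
    lintegral_map' (f := fun y => ∫⁻ p, Ψ p ∂skeletonLaw P X y)
      (hX.aemeasurable_lintegral_skeletonLaw hΨ _) (hX.measurable s).aemeasurable]

theorem nullMeasurableSet_cylinderEvent (hX : IsStandardProcess P X ℱ U) {D : Set E}
    (hD : MeasurableSet D) {l : List (ℝ≥0 × Set E)} (hl : ∀ b ∈ l, MeasurableSet b.2) (s : ℝ≥0)
    (Q : Measure Ω) [IsFiniteMeasure Q] : NullMeasurableSet {ω | (fun u => X (s + u) ω) ∈
      cylinderEvent (killedProcess coordinateProcess D) 0 l} Q := by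
  have h := (universallyMeasurable_cylinderEvent_killedProcess hD hl 0).preimage
    (measurable_skeleton (Z := fun u => X (s + u)) fun t => hX.measurable (s + t)) Q inferInstance
  simpa only [preimage, mem_ofPred_eq,
    extendSkeleton_skeleton ((hX.isRightContinuousPath _).shift s)] using h

theorem killedFdd_eq_lintegral_skeletonLaw (hX : IsStandardProcess P X ℱ U) {D : Set E}
    (hD : MeasurableSet D) {g : E → ℝ≥0∞} (hg : Measurable g) {l : List (ℝ≥0 × Set E)}
    (hl : ∀ b ∈ l, MeasurableSet b.2) (x : E) :
    killedFdd P X D g l x = ∫⁻ p, killedFunctional D g l p ∂skeletonLaw P X x := by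
  have := hX.isProbabilityMeasure
  have := hX.isProbabilityMeasure_skeletonLaw x
  rw [skeletonLaw, lintegral_map' (aemeasurable_killedFunctional hD hg hl _)
    (measurable_skeleton hX.measurable).aemeasurable, killedFdd]
  have hn := hX.nullMeasurableSet_cylinderEvent hD hl 0 (P x)
  simp only [zero_add] at hn
  have hset : cylinderEvent (killedProcess X D) 0 l = {ω | (fun u => X u ω) ∈
      cylinderEvent (killedProcess coordinateProcess D) 0 l} := by
    ext ω
    exact mem_cylinderEvent_congr l fun u _ => rfl
  rw [hset, ← lintegral_indicator₀ hn]
  refine lintegral_congr fun ω => ?_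
  exact (killedFunctional_skeleton (hX.isRightContinuousPath ω)).symm

theorem aemeasurable_killedFdd (hX : IsStandardProcess P X ℱ U) {D : Set E}
    (hD : MeasurableSet D) {g : E → ℝ≥0∞} (hg : Measurable g) {l : List (ℝ≥0 × Set E)}
    (hl : ∀ b ∈ l, MeasurableSet b.2) (μ : Measure E) [IsFiniteMeasure μ] :
    AEMeasurable (killedFdd P X D g l) μ := by
  simp only [funext (hX.killedFdd_eq_lintegral_skeletonLaw hD hg hl)]
  exact hX.aemeasurable_lintegral_skeletonLaw
    (fun μ _ => aemeasurable_killedFunctional hD hg hl μ) μ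

theorem killedFdd_cons (hX : IsStandardProcess P X ℱ U) {D : Set E}
    (hD : MeasurableSet D) {g : E → ℝ≥0∞} (hg : Measurable g) {l : List (ℝ≥0 × Set E)}
    (hl : ∀ b ∈ l, MeasurableSet b.2) (s : ℝ≥0) {B : Set E} (hB : MeasurableSet B) (x : E) :
    killedFdd P X D g ((s, B) :: l) x =
      ∫⁻ ω in {ω | (s : ℝ≥0∞) < exitTime X D ω ∧ X s ω ∈ B}, killedFdd P X D g l (X s ω) ∂P x := by
  have := hX.isProbabilityMeasure
  simp only [hX.killedFdd_eq_lintegral_skeletonLaw hD hg hl]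
  rw [← hX.lintegral_killed_markov hD x s hB
    (fun μ _ => aemeasurable_killedFunctional hD hg hl μ), killedFdd]
  have hn := hX.nullMeasurableSet_cylinderEvent hD hl s
    ((P x).restrict {ω | (s : ℝ≥0∞) < exitTime X D ω ∧ X s ω ∈ B})
  have hset : cylinderEvent (killedProcess X D) 0 ((s, B) :: l) =
      {ω | (fun u => X (s + u) ω) ∈ cylinderEvent (killedProcess coordinateProcess D) 0 l} ∩
        {ω | (s : ℝ≥0∞) < exitTime X D ω ∧ X s ω ∈ B} := by
    ext ω
    rw [mem_cylinderEvent_cons, zero_add, exists_killedProcess_eq_some_iff, and_comm]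
    refine and_congr_left fun h => ?_
    exact mem_cylinderEvent_congr l fun u _ => by rw [killedProcess_add h.1, zero_add]
  rw [hset, ← Measure.restrict_restrict₀ hn, ← lintegral_indicator₀ hn]
  refine lintegral_congr fun ω => ?_
  rw [killedFunctional_skeleton ((hX.isRightContinuousPath ω).shift s), totalTime_cons]
  rfl

/-- The finite-dimensional distributions of a Doob transform. -/
theorem semigroupFdd_doobSemigroup (hX : IsStandardProcess P X ℱ U) {D : Set E} {g : E → ℝ≥0∞}
    (hV : MeasurableSet (doobSet D g)) (hg : Measurable ((doobSet D g).indicator g))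
    {l : List (ℝ≥0 × Set E)} (hl : ∀ b ∈ l, MeasurableSet b.2) {x : E} (hx : x ∈ doobSet D g) :
    semigroupFdd (doobSemigroup P X D g) l x =
      (g x)⁻¹ * killedFdd P X (doobSet D g) ((doobSet D g).indicator g) l x := by
  have := hX.isProbabilityMeasure
  induction l generalizing x with
  | nil =>
    rw [hX.killedFdd_nil, semigroupFdd, indicator_of_mem hx,
      ENNReal.inv_mul_cancel hx.2.1.ne' hx.2.2.ne]
  | cons b l ih =>
    obtain ⟨s, B⟩ := b
    have hB : MeasurableSet B := hl (s, B) List.mem_cons_self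
    have hl' : ∀ b ∈ l, MeasurableSet b.2 := fun b hb => hl b (List.mem_cons_of_mem _ hb)
    set V := doobSet D g with hVdef
    set ν : Measure E := ((P x).restrict {ω | (s : ℝ≥0∞) < exitTime X V ω}).map (X s) with hν
    have hn := nullMeasurableSet_lt_exitTime hX.measurable hX.isRightContinuousPath hV s (P x)
    have hνV : ∀ᵐ y ∂ν, y ∈ V := by
      refine (ae_map_iff (hX.measurable s).aemeasurable hV).2 ((ae_restrict_iff'₀ hn).2 ?_)
      filter_upwards [hX.ae_mem_of_lt_exitTime hx] with ω hω using hω s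
    have hgν : g =ᵐ[ν] V.indicator g := by
      filter_upwards [hνV] with y hy
      rw [indicator_of_mem hy]
    have hK := hX.aemeasurable_killedFdd hV hg hl' ν
    have hf : semigroupFdd (doobSemigroup P X D g) l =ᵐ[ν]
        fun y => (V.indicator g y)⁻¹ * killedFdd P X V (V.indicator g) l y := by
      filter_upwards [hνV] with y hy
      rw [ih hl' hy, indicator_of_mem hy]
    have hfm : AEMeasurable (semigroupFdd (doobSemigroup P X D g) l) ν :=
      (hg.inv.aemeasurable.mul hK).congr hf.symm
    have hp : doobSemigroup P X D g s x = (g x)⁻¹ • ν.withDensity (V.indicator g) := by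
      rw [doobSemigroup, if_pos hx, withDensity_congr_ae hgν]
    rw [semigroupFdd, hp, Measure.restrict_smul, lintegral_smul_measure, smul_eq_mul,
      restrict_withDensity hB, lintegral_withDensity_eq_lintegral_mul₀ hg.aemeasurable
        hfm.restrict, hX.killedFdd_cons hV hg hl' s hB]
    congr 1
    -- The weight g(y) of the first step cancels the factor 1/g(y) of the remaining steps, so only
    -- the terminal weight and 1/g(x) survive.
    have h1 : ∫⁻ y in B, (V.indicator g * semigroupFdd (doobSemigroup P X D g) l) y ∂ν =
        ∫⁻ y in B, killedFdd P X V (V.indicator g) l y ∂ν := by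
      refine lintegral_congr_ae (ae_restrict_of_ae ?_)
      filter_upwards [hf, hνV] with y hy hyV
      rw [Pi.mul_apply, hy, ← mul_assoc, indicator_of_mem hyV,
        ENNReal.mul_inv_cancel hyV.2.1.ne' hyV.2.2.ne, one_mul]
    rw [h1, hν, Measure.restrict_map (hX.measurable s) hB, lintegral_map' _
      (hX.measurable s).aemeasurable, Measure.restrict_restrict (hX.measurable s hB)]
    · congr 2
      ext ω
      exact and_comm
    · rw [← Measure.restrict_map (hX.measurable s) hB]
      exact hK.restrict

/-- Blumenthal's zero-one law for exit times. -/
theorem measure_lt_exitTime_eq_zero_or_one (hX : IsStandardProcess P X ℱ U) {D : Set E}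
    (hD : MeasurableSet D) (x : E) :
    P x {ω | (0 : ℝ≥0∞) < exitTime X D ω} = 0 ∨ P x {ω | (0 : ℝ≥0∞) < exitTime X D ω} = 1 := by
  have := hX.isProbabilityMeasure
  have h0 : ∀ y, killedFdd P X D 1 [(0, univ)] y = P y {ω | (0 : ℝ≥0∞) < exitTime X D ω} := by
    intro y
    have h : cylinderEvent (killedProcess X D) 0 [(0, univ)] =
        {ω | (0 : ℝ≥0∞) < exitTime X D ω} := by
      ext ω
      rw [mem_cylinderEvent_cons, exists_killedProcess_eq_some_iff]
      simp [cylinderEvent]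
    simp [killedFdd, h]
  -- Requiring time 0 twice does not change the event, while the Markov property at time 0 squares
  -- its probability p; thus p = p².
  have h1 : killedFdd P X D 1 [(0, univ), (0, univ)] x =
      P x {ω | (0 : ℝ≥0∞) < exitTime X D ω} := by
    have h : cylinderEvent (killedProcess X D) 0 [(0, univ), (0, univ)] =
        {ω | (0 : ℝ≥0∞) < exitTime X D ω} := by
      ext ω
      rw [mem_cylinderEvent_cons, mem_cylinderEvent_cons, exists_killedProcess_eq_some_iff,
        exists_killedProcess_eq_some_iff]
      simp [cylinderEvent]
    simp [killedFdd, h]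
  have h2 := hX.killedFdd_cons hD (g := 1) measurable_const (l := [(0, univ)]) (by simp) 0
    MeasurableSet.univ x
  have h3 : ∀ᵐ ω ∂P x, P (X 0 ω) {ω | (0 : ℝ≥0∞) < exitTime X D ω} =
      P x {ω | (0 : ℝ≥0∞) < exitTime X D ω} := by
    filter_upwards [hX.normal x] with ω hω
    rw [hω]
  simp only [h1, h0, mem_univ, and_true, ENNReal.coe_zero] at h2
  rw [lintegral_congr_ae (ae_restrict_of_ae h3), lintegral_const,
    Measure.restrict_apply_univ] at h2
  by_cases hz : P x {ω | (0 : ℝ≥0∞) < exitTime X D ω} = 0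
  · exact Or.inl hz
  · right
    have h4 : P x {ω | (0 : ℝ≥0∞) < exitTime X D ω} * 1 =
        P x {ω | (0 : ℝ≥0∞) < exitTime X D ω} * P x {ω | (0 : ℝ≥0∞) < exitTime X D ω} := by
      rw [mul_one]; exact h2
    exact ((ENNReal.mul_right_inj hz (measure_ne_top _ _)).1 h4).symm

/-- While the path remains in D, continuity of g along it keeps g positive for a short time. -/
theorem _root_.lt_exitTime_doobSet {E Ω : Type*} [TopologicalSpace E] {X : ℝ≥0 → Ω → E} {ω : Ω}
    (hr : IsRightContinuousPath fun s => X s ω)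
    {D : Set E} {g : E → ℝ≥0∞} (hg : ContinuousOn g D) (htop : ∀ y ∈ D, g y < ⊤)
    (h0 : X 0 ω ∈ doobSet D g) (hD : (0 : ℝ≥0∞) < exitTime X D ω) :
    (0 : ℝ≥0∞) < exitTime X (doobSet D g) ω := by
  obtain ⟨u, hu, h⟩ := lt_exitTime_iff (t := 0) |>.1 hD
  have h1 : Tendsto (fun s => X s ω) (𝓝[>] 0) (𝓝[D] (X 0 ω)) := by
    refine tendsto_nhdsWithin_iff.2 ⟨(hr 0).mono_left (nhdsWithin_mono _ Ioi_subset_Ici_self), ?_⟩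
    filter_upwards [Ioo_mem_nhdsGT hu] with s hs using h s hs.1 hs.2
  have h2 : ∀ᶠ s in 𝓝[>] (0 : ℝ≥0), 0 < g (X s ω) :=
    ((hg _ h0.1).tendsto.comp h1).eventually_const_lt h0.2.1
  obtain ⟨u', hu', h'⟩ := mem_nhdsGT_iff_exists_Ioo_subset.1 h2
  refine (lt_exitTime_iff (t := 0)).2 ⟨min u u', lt_min hu hu', fun s hs hsu => ?_⟩
  have hsD := h s hs (hsu.trans_le (min_le_left _ _))
  exact ⟨hsD, h' ⟨hs, hsu.trans_le (min_le_right _ _)⟩, htop _ hsD⟩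

/-- If the probability were 0, exit from D would also be immediate, so the killed semigroup would
vanish on g at x, and excessivity would force g(x) = 0. -/
theorem measure_lt_exitTime_doobSet_eq_one (hX : IsStandardProcess P X ℱ U) {D : Set E}
    {g : E → ℝ≥0∞} (hV : MeasurableSet (doobSet D g)) (hexc : IsExcessiveOn P X D g)
    (hg : ContinuousOn g D) (htop : ∀ y ∈ D, g y < ⊤) {x : E} (hx : x ∈ doobSet D g) :
    P x {ω | (0 : ℝ≥0∞) < exitTime X (doobSet D g) ω} = 1 := by
  refine (hX.measure_lt_exitTime_eq_zero_or_one hV x).resolve_left fun h => ?_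
  have h1 : P x {ω | (0 : ℝ≥0∞) < exitTime X D ω} = 0 := by
    rw [measure_eq_zero_iff_ae_notMem] at h ⊢
    filter_upwards [h, hX.normal x] with ω hω h0 hD
    exact hω (lt_exitTime_doobSet (hX.isRightContinuousPath ω) hg htop (h0 ▸ hx) hD)
  have h2 : ∀ t, killedSemigroup P X D t g x = 0 := by
    intro t
    rw [killedSemigroup, Measure.restrict_eq_zero.2, lintegral_zero_measure]
    exact measure_mono_null (t := {ω | (0 : ℝ≥0∞) < exitTime X D ω})
      (fun ω (hω : (t : ℝ≥0∞) < exitTime X D ω) =>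
        show (0 : ℝ≥0∞) < exitTime X D ω from lt_of_le_of_lt zero_le hω) h1
  have h3 := hexc.tendsto x hx.1
  simp only [h2] at h3
  exact hx.2.1.ne (tendsto_nhds_unique tendsto_const_nhds h3)

end IsStandardProcess

end KilledMarkov

theorem mem_cylinderEvent_iff_path {E Ω : Type*} {W : ℝ≥0 → Ω → Option E} {ω : Ω}
    (l : List (ℝ≥0 × Set E)) (a : ℝ≥0) : ω ∈ cylinderEvent W a l ↔
      (fun u => W u ω) ∈ cylinderEvent (fun (s : ℝ≥0) (w : ℝ≥0 → Option E) => w s) a l :=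
  mem_cylinderEvent_congr l fun _ _ => rfl

/-! ### Comparison of processes with the law of a Doob transform -/

section Comparison

variable {E Ω Ω' : Type*} [MeasurableSpace E] [MeasurableSpace Ω] [MeasurableSpace Ω']

theorem HasMarkovLaw.isProbabilityMeasure {Q : Measure Ω'} {W : ℝ≥0 → Ω' → Option E}
    {p : ℝ≥0 → E → Measure E} {x : E} (hW : HasMarkovLaw Q W p x) : IsProbabilityMeasure Q :=
  ⟨hW [] (by simp)⟩

variable [TopologicalSpace E] [PolishSpace E] [BorelSpace E] [Nonempty E]
  {P : E → Measure Ω} {X : ℝ≥0 → Ω → E} {ℱ : Filtration ℝ≥0 ‹MeasurableSpace Ω›} {U : Set E}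
  {D : Set E} {g : E → ℝ≥0∞}

/-- The law of a Doob transform up to time `r`, on the event that it is alive at time `r`. -/
theorem HasMarkovLaw.map_skeleton_stopPath (hX : IsStandardProcess P X ℱ U)
    (hV : MeasurableSet (doobSet D g)) (hg : Measurable ((doobSet D g).indicator g)) {x : E}
    (hx : x ∈ doobSet D g) {Q : Measure Ω'} {W : ℝ≥0 → Ω' → Option E}
    (hW : HasMarkovLaw Q W (doobSemigroup P X D g) x) {r : ℝ≥0} {Z : ℝ≥0 → Ω' → E}
    (hZ : ∀ t, Measurable (Z t))
    (hZW : ∀ ω, (∃ y, W r ω = some y) → ∀ s ≤ r, W s ω = some (Z s ω)) :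
    (Q.restrict {ω | ∃ y, W r ω = some y}).map (fun ω => skeleton (stopPath r fun s => Z s ω)) =
      (g x)⁻¹ • (((P x).restrict {ω | (r : ℝ≥0∞) < exitTime X (doobSet D g) ω}).withDensity
        fun ω => (doobSet D g).indicator g (X r ω)).map
          fun ω => skeleton (stopPath r fun s => X s ω) := by
  have := hW.isProbabilityMeasure
  have := hX.isProbabilityMeasure
  refine Measure.ext_of_forall_box fun F B hB => ?_
  obtain ⟨l, hl, hlr, h⟩ := exists_list_cylinderEvent F (fun i => min (skeletonTime i) r) hB
    (t := 0) (r := r) (fun i _ => ⟨zero_le, min_le_right _ _⟩) zero_le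
  rw [zero_add] at hlr
  have hbox : MeasurableSet {p : ℕ × ℕ → E | ∀ i ∈ F, p i ∈ B i} :=
    MeasurableSet.pi F.countable_toSet fun i _ => hB i
  have hZm := measurable_skeleton_stopPath hZ r
  have hXm := measurable_skeleton_stopPath hX.measurable r
  rw [Measure.smul_apply, Measure.map_apply hZm hbox, Measure.map_apply hXm hbox,
    Measure.restrict_apply (hZm hbox), withDensity_apply _ (hXm hbox),
    Measure.restrict_restrict (hXm hbox), smul_eq_mul]
  have h1 := hW l hl
  rw [hX.semigroupFdd_doobSemigroup hV hg hl hx, killedFdd, hlr] at h1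
  have hWset : cylinderEvent W 0 l = (fun ω => skeleton (stopPath r fun s => Z s ω)) ⁻¹'
      {p | ∀ i ∈ F, p i ∈ B i} ∩ {ω | ∃ y, W r ω = some y} := by
    ext ω
    rw [mem_cylinderEvent_iff_path, h]
    refine and_congr_left fun hr => forall₂_congr fun i _ => ?_
    simp [hZW ω hr _ (min_le_right _ _), skeleton, stopPath]
  have hXset : cylinderEvent (killedProcess X (doobSet D g)) 0 l =
      (fun ω => skeleton (stopPath r fun s => X s ω)) ⁻¹' {p | ∀ i ∈ F, p i ∈ B i} ∩
        {ω | (r : ℝ≥0∞) < exitTime X (doobSet D g) ω} := by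
    ext ω
    rw [mem_cylinderEvent_iff_path, h]
    have hr : (∃ y, killedProcess X (doobSet D g) r ω = some y) ↔
        (r : ℝ≥0∞) < exitTime X (doobSet D g) ω := by
      simpa using exists_killedProcess_eq_some_iff (X := X) (D := doobSet D g) (B := univ)
        (t := r) (ω := ω)
    rw [hr]
    refine and_congr_left fun hr => forall₂_congr fun i _ => ?_
    rw [exists_killedProcess_eq_some_iff]
    refine and_iff_right (lt_of_le_of_lt ?_ hr)
    exact_mod_cast min_le_right _ _
  rw [hWset, hXset] at h1
  exact h1

/-- Since the path is stopped at r, its terminal value is a coordinate of the skeleton, so `f (Z r)`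
is a functional of the law just compared. -/
theorem HasMarkovLaw.setLIntegral_eq (hX : IsStandardProcess P X ℱ U)
    (hV : MeasurableSet (doobSet D g)) (hg : Measurable ((doobSet D g).indicator g)) {x : E}
    (hx : x ∈ doobSet D g) {Q : Measure Ω'} {W : ℝ≥0 → Ω' → Option E}
    (hW : HasMarkovLaw Q W (doobSemigroup P X D g) x) {r : ℝ≥0} {Z : ℝ≥0 → Ω' → E}
    (hZ : ∀ t, Measurable (Z t))
    (hZW : ∀ ω, (∃ y, W r ω = some y) → ∀ s ≤ r, W s ω = some (Z s ω))
    {C : Set (ℕ × ℕ → E)} (hC : UniversallyMeasurable C) {f : E → ℝ≥0∞} (hf : Measurable f) :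
    ∫⁻ ω in {ω | skeleton (stopPath r fun s => Z s ω) ∈ C} ∩ {ω | ∃ y, W r ω = some y},
        f (Z r ω) ∂Q =
      (g x)⁻¹ * ∫⁻ ω in {ω | skeleton (stopPath r fun s => X s ω) ∈ C} ∩
        {ω | (r : ℝ≥0∞) < exitTime X (doobSet D g) ω},
          (doobSet D g).indicator g (X r ω) * f (X r ω) ∂P x := by
  have := hW.isProbabilityMeasure
  have := hX.isProbabilityMeasure
  have hZm := measurable_skeleton_stopPath hZ r
  have hXm := measurable_skeleton_stopPath hX.measurable r
  have hgX : Measurable fun ω => (doobSet D g).indicator g (X r ω) := hg.comp (hX.measurable r)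
  have hmap := hW.map_skeleton_stopPath hX hV hg hx hZ hZW
  set Φ : (ℕ × ℕ → E) → ℝ≥0∞ := C.indicator fun p => f (p (0, ⌈r⌉₊)) with hΦ
  set ν := (Q.restrict {ω | ∃ y, W r ω = some y}).map
    (fun ω => skeleton (stopPath r fun s => Z s ω)) with hν
  have hΦν : AEMeasurable Φ ν :=
    (hf.comp (measurable_pi_apply _)).aemeasurable.indicator₀ (hC ν inferInstance)
  have hC1 : NullMeasurableSet {ω | skeleton (stopPath r fun s => Z s ω) ∈ C}
      (Q.restrict {ω | ∃ y, W r ω = some y}) := hC.preimage hZm _ inferInstance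
  have hC2 : NullMeasurableSet {ω | skeleton (stopPath r fun s => X s ω) ∈ C}
      ((P x).restrict {ω | (r : ℝ≥0∞) < exitTime X (doobSet D g) ω}) :=
    hC.preimage hXm _ inferInstance
  have h1 : ∫⁻ p, Φ p ∂ν = ∫⁻ ω in {ω | skeleton (stopPath r fun s => Z s ω) ∈ C} ∩
      {ω | ∃ y, W r ω = some y}, f (Z r ω) ∂Q := by
    rw [hν, lintegral_map' hΦν hZm.aemeasurable, ← Measure.restrict_restrict₀ hC1,
      ← lintegral_indicator₀ hC1]
    refine lintegral_congr fun ω => ?_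
    by_cases hω : skeleton (stopPath r fun s => Z s ω) ∈ C <;>
      simp [hΦ, hω, skeleton_stopPath_ceil]
  rw [← h1, hmap, lintegral_smul_measure, smul_eq_mul]
  rcases eq_or_ne (g x)⁻¹ 0 with h0 | h0
  · simp [h0]
  rw [hmap] at hΦν
  have hΦ' := hΦν.mono_ac
    (Measure.absolutelyContinuous_smul (c := (g x)⁻¹) (μ := (((P x).restrict
      {ω | (r : ℝ≥0∞) < exitTime X (doobSet D g) ω}).withDensity
        fun ω => (doobSet D g).indicator g (X r ω)).map
          fun ω => skeleton (stopPath r fun s => X s ω)) h0)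
  congr 1
  rw [lintegral_map' hΦ' hXm.aemeasurable, lintegral_withDensity_eq_lintegral_mul₀
    hgX.aemeasurable, ← Measure.restrict_restrict₀ hC2, ← lintegral_indicator₀ hC2]
  · refine lintegral_congr fun ω => ?_
    by_cases hω : skeleton (stopPath r fun s => X s ω) ∈ C <;>
      simp [hΦ, hω, skeleton_stopPath_ceil]
  · refine AEMeasurable.congr (f := {ω | skeleton (stopPath r fun s => X s ω) ∈ C}.indicator
      fun ω => f (X r ω)) ?_ (Eventually.of_forall fun ω => ?_)
    · exact (hf.comp (hX.measurable r)).aemeasurable.indicator₀ hC2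
    · by_cases hω : skeleton (stopPath r fun s => X s ω) ∈ C <;>
        simp [hΦ, hω, skeleton_stopPath_ceil]

end Comparison

/-! ### Truncated densities and their limits -/

theorem ENNReal.mul_min_one_div {a c : ℝ≥0∞} (ha : a ≠ ⊤) : a * min 1 (c / a) = min a c := by
  rcases eq_or_ne a 0 with rfl | h0
  · simp
  · rw [mul_min, mul_one, ENNReal.mul_div_cancel h0 ha]

/-- The indicators of the `S m` converge almost surely to that of G, and the integrands are bounded,
so dominated convergence applies. Measurability of G and γ is a conclusion: they are almost sure
limits of measurable objects. -/
theorem tendsto_setLIntegral_of_eventually_mem {Ω : Type*} [MeasurableSpace Ω] {μ : Measure Ω}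
    [IsFiniteMeasure μ] {G : Set Ω} {S : ℕ → Set Ω} {c : ℕ → Ω → ℝ≥0∞} {γ : Ω → ℝ≥0∞}
    {ψ : ℝ≥0∞ → ℝ≥0∞} (N : ℕ) (hψ : Continuous ψ) (hψN : ∀ a, ψ a ≤ N)
    (hS : ∀ m, NullMeasurableSet (S m) μ) (hc : ∀ m, Measurable (c m))
    (hG : ∀ᵐ ω ∂μ, ω ∈ G → (∀ᶠ m in atTop, ω ∈ S m) ∧
      Tendsto (fun m => c m ω) atTop (𝓝 (γ ω)))
    (hSG : ∀ᵐ ω ∂μ, ∀ m, ω ∈ S m → ω ∈ G) :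
    NullMeasurableSet G μ ∧ AEMeasurable γ (μ.restrict G) ∧
      Tendsto (fun m => ∫⁻ ω in S m, ψ (c m ω) ∂μ) atTop (𝓝 (∫⁻ ω in G, ψ (γ ω) ∂μ)) := by
  have hGm : NullMeasurableSet G μ := by
    refine (NullMeasurableSet.iUnion fun m => hS m).congr ?_
    filter_upwards [hG, hSG] with ω h1 h2
    refine propext (?_ : ω ∈ ⋃ m, S m ↔ ω ∈ G)
    rw [mem_iUnion]
    exact ⟨fun ⟨m, hm⟩ => h2 m hm, fun hω => (h1 hω).1.exists⟩
  refine ⟨hGm, ?_, ?_⟩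
  · refine aemeasurable_of_tendsto_metrizable_ae atTop (fun m => (hc m).aemeasurable) ?_
    rw [ae_restrict_iff'₀ hGm]
    filter_upwards [hG] with ω hω hωG using (hω hωG).2
  · simp only [← lintegral_indicator₀ hGm, ← lintegral_indicator₀ (hS _)]
    refine tendsto_lintegral_of_dominated_convergence' (fun _ => N) (fun m => ?_) (fun m => ?_)
      (by simpa using ENNReal.mul_ne_top (ENNReal.natCast_ne_top N) (measure_ne_top _ _)) ?_
    · exact (hψ.measurable.comp (hc m)).aemeasurable.indicator₀ (hS m)
    · exact Eventually.of_forall fun ω => indicator_le' (fun _ _ => hψN _) (fun _ _ => zero_le) ω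
    · filter_upwards [hG, hSG] with ω h1 h2
      by_cases hω : ω ∈ G
      · obtain ⟨h3, h4⟩ := h1 hω
        rw [indicator_of_mem hω]
        refine ((hψ.tendsto _).comp h4).congr' ?_
        filter_upwards [h3] with m hm
        rw [indicator_of_mem hm, Function.comp]
      · rw [indicator_of_notMem hω]
        refine tendsto_const_nhds.congr fun m => ?_
        rw [indicator_of_notMem fun hm => hω (h2 m hm)]

/-- Passage to the limit in identities between truncated densities. -/
theorem measure_eq_lintegral_of_truncated {Ω Ω' : Type*} [MeasurableSpace Ω] [MeasurableSpace Ω']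
    {Q : Measure Ω'} {P : Measure Ω} [IsFiniteMeasure Q] [IsFiniteMeasure P]
    {G' : Set Ω'} {G : Set Ω} {S' : ℕ → Set Ω'} {S : ℕ → Set Ω} {b : ℕ → Ω' → ℝ≥0∞}
    {β : Ω' → ℝ≥0∞} {c : ℕ → Ω → ℝ≥0∞} {γ : Ω → ℝ≥0∞} {k : ℝ≥0∞} (hk : k ≠ ⊤)
    (hS' : ∀ m, NullMeasurableSet (S' m) Q) (hS : ∀ m, NullMeasurableSet (S m) P)
    (hb : ∀ m, Measurable (b m)) (hc : ∀ m, Measurable (c m))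
    (hβ : ∀ ω, β ω ≠ ⊤)
    (hG' : ∀ᵐ ω ∂Q, ω ∈ G' → (∀ᶠ m in atTop, ω ∈ S' m) ∧
      Tendsto (fun m => b m ω) atTop (𝓝 (β ω)))
    (hSG' : ∀ᵐ ω ∂Q, ∀ m, ω ∈ S' m → ω ∈ G')
    (hG : ∀ᵐ ω ∂P, ω ∈ G → (∀ᶠ m in atTop, ω ∈ S m) ∧
      Tendsto (fun m => c m ω) atTop (𝓝 (γ ω)))
    (hSG : ∀ᵐ ω ∂P, ∀ m, ω ∈ S m → ω ∈ G)
    (h : ∀ N m : ℕ, ∫⁻ ω in S' m, min 1 (N / b m ω) ∂Q = k * ∫⁻ ω in S m, min (c m ω) N ∂P) :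
    Q G' = k * ∫⁻ ω in G, γ ω ∂P := by
  have hψ1 : ∀ N : ℕ, Continuous fun a : ℝ≥0∞ => min 1 ((N : ℝ≥0∞) / a) := fun N => by
    simp only [div_eq_mul_inv]
    exact continuous_const.min
      ((ENNReal.continuous_const_mul (ENNReal.natCast_ne_top N)).comp continuous_inv)
  have hψ2 : ∀ N : ℕ, Continuous fun a : ℝ≥0∞ => min a (N : ℝ≥0∞) := fun N =>
    continuous_id.min continuous_const
  have key : ∀ N : ℕ, ∫⁻ ω in G', min 1 (N / β ω) ∂Q = k * ∫⁻ ω in G, min (γ ω) N ∂P := by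
    intro N
    have h1 := (tendsto_setLIntegral_of_eventually_mem (G := G') (S := S') (c := b) (γ := β) 1 (hψ1 N) (fun a => by simp) hS' hb hG' hSG').2.2
    have h2 := (tendsto_setLIntegral_of_eventually_mem (G := G) (S := S) (c := c) (γ := γ) N (hψ2 N) (fun a => min_le_right _ _) hS hc hG hSG).2.2
    refine tendsto_nhds_unique (h1.congr fun m => h N m) ?_
    exact ENNReal.Tendsto.const_mul h2 (Or.inr hk)
  -- Only the measurability conclusions are extracted here; the truncation level is immaterial.
  obtain ⟨hG'm, hβm, -⟩ := tendsto_setLIntegral_of_eventually_mem (G := G') (S := S') (c := b) (γ := β) 1 (hψ1 0) (fun a => by simp) hS' hb hG' hSG'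
  obtain ⟨hGm, hγm, -⟩ := tendsto_setLIntegral_of_eventually_mem (G := G) (S := S) (c := c) (γ := γ) 0 (hψ2 0) (fun a => by simp) hS hc hG hSG
  -- Finiteness of β makes the truncation equal to 1 for all large N.
  have e1 : Tendsto (fun N : ℕ => ∫⁻ ω in G', min 1 (N / β ω) ∂Q) atTop (𝓝 (∫⁻ _ω in G', 1 ∂Q)) := by
    refine lintegral_tendsto_of_tendsto_of_monotone
      (fun N => (hψ1 N).measurable.comp_aemeasurable hβm) ?_ ?_
    · refine Eventually.of_forall fun ω N M hNM => ?_
      have : (N : ℝ≥0∞) ≤ M := by exact_mod_cast hNM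
      dsimp only
      gcongr
    · refine Eventually.of_forall fun ω => ?_
      obtain ⟨n, hn⟩ := ENNReal.exists_nat_gt (hβ ω)
      refine tendsto_const_nhds.congr' ?_
      filter_upwards [eventually_ge_atTop n] with N hN
      rw [min_eq_left]
      have : β ω ≤ N := hn.le.trans (by exact_mod_cast hN)
      rcases eq_or_ne (β ω) 0 with h0 | h0
      · rcases eq_or_ne (N : ℝ≥0∞) 0 with hN0 | hN0
        · have : n = 0 := by
            have : N = 0 := by exact_mod_cast hN0
            omega
          simp [this] at hn
        · rw [h0, ENNReal.div_zero hN0]; exact le_top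
      · rwa [ENNReal.le_div_iff_mul_le (Or.inl h0) (Or.inl (hβ ω)), one_mul]
  have e2 : Tendsto (fun N : ℕ => ∫⁻ ω in G, min (γ ω) N ∂P) atTop (𝓝 (∫⁻ ω in G, γ ω ∂P)) := by
    refine lintegral_tendsto_of_tendsto_of_monotone
      (fun N => (hψ2 N).measurable.comp_aemeasurable hγm) ?_ ?_
    · refine Eventually.of_forall fun ω N M hNM => ?_
      have : (N : ℝ≥0∞) ≤ M := by exact_mod_cast hNM
      dsimp only
      gcongr
    · refine Eventually.of_forall fun ω => ?_
      have := (tendsto_const_nhds (x := γ ω)).min ENNReal.tendsto_nat_nhds_top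
      rwa [min_eq_left le_top] at this
  have e3 := tendsto_nhds_unique (e1.congr fun N => key N) (ENNReal.Tendsto.const_mul e2 (Or.inr hk))
  rwa [setLIntegral_one] at e3

/-! ### Time changes of paths -/

section TimeChange

/-- The rate of the clock of a process killed on exiting `D`. -/
def clockRate {E : Type*} (D : Set E) (v : E → ℝ) : E → ℝ≥0∞ :=
  D.indicator fun y => ENNReal.ofReal (v y)⁻¹

/-- The clock with rate `k` along a path. -/
def pathClock {E : Type*} (k : E → ℝ≥0∞) (w : ℝ≥0 → E) (s : ℝ≥0) : ℝ≥0∞ :=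
  ∫⁻ u in {u : ℝ | 0 ≤ u ∧ u ≤ s}, k (w u.toNNReal)

/-- The right inverse of the clock with rate `k` along a path. -/
def pathInverse {E : Type*} (k : E → ℝ≥0∞) (w : ℝ≥0 → E) (t : ℝ≥0) : ℝ≥0 :=
  sInf {s : ℝ≥0 | (t : ℝ≥0∞) < pathClock k w s}

variable {E Ω : Type*}

theorem pathClock_mono (k : E → ℝ≥0∞) (w : ℝ≥0 → E) : Monotone (pathClock k w) := fun a b hab =>
  lintegral_mono_set fun _ hu => ⟨hu.1, hu.2.trans (by exact_mod_cast hab)⟩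

theorem pathClock_stopPath (k : E → ℝ≥0∞) (w : ℝ≥0 → E) {r s : ℝ≥0} (hs : s ≤ r) :
    pathClock k (stopPath r w) s = pathClock k w s := by
  have hm : MeasurableSet {u : ℝ | 0 ≤ u ∧ u ≤ s} := measurableSet_Icc
  refine setLIntegral_congr_fun hm fun u hu => ?_
  rw [stopPath_of_le]
  exact (Real.toNNReal_le_iff_le_coe.2 hu.2).trans hs

/-- The right inverse of a monotone function depends only on its values below the inverse. -/
theorem sInf_lt_congr {A A' : ℝ≥0 → ℝ≥0∞} (hA : Monotone A) (hA' : Monotone A') {s₀ : ℝ≥0}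
    (h : ∀ s ≤ s₀, A s = A' s) {t : ℝ≥0∞} (ht : t < A s₀) :
    sInf {s | t < A s} = sInf {s | t < A' s} := by
  have key : ∀ {A A' : ℝ≥0 → ℝ≥0∞}, Monotone A → (∀ s ≤ s₀, A s = A' s) → t < A s₀ →
      sInf {s | t < A s} ≤ sInf {s | t < A' s} := by
    intro A A' hA h ht
    refine le_csInf ⟨s₀, by rw [mem_ofPred_eq, ← h s₀ le_rfl]; exact ht⟩ fun s hs => ?_
    rcases le_total s s₀ with hss | hss
    · exact csInf_le (OrderBot.bddBelow _) (by rw [mem_ofPred_eq, h s hss]; exact hs)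
    · exact (csInf_le (OrderBot.bddBelow _) (show s₀ ∈ {s | t < A s} from ht)).trans hss
  exact le_antisymm (key hA h ht) (key hA' (fun s hs => (h s hs).symm) (by rwa [← h s₀ le_rfl]))

theorem pathInverse_stopPath (k : E → ℝ≥0∞) (w : ℝ≥0 → E) {r t : ℝ≥0} (ht : t < pathClock k w r) :
    pathInverse k (stopPath r w) t = pathInverse k w t :=
  (sInf_lt_congr (pathClock_mono _ _) (pathClock_mono _ _)
    (fun _ hs => (pathClock_stopPath k w hs).symm) ht).symm

variable {X : ℝ≥0 → Ω → E} {D : Set E} {v : E → ℝ} {ω : Ω} {s t : ℝ≥0}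

theorem clock_mono (X : ℝ≥0 → Ω → E) (D : Set E) (v : E → ℝ) (ω : Ω) :
    Monotone fun s => clock X D v s ω := fun a b hab =>
  lintegral_mono_set fun _ hu => ⟨hu.1, hu.2.1.trans (by exact_mod_cast hab), hu.2.2⟩

/-- `pathClock` does not mention exit times and is therefore a Borel functional of the path; its
rate vanishes off D instead. The two agree before the exit, time 0 being a null set where the path
may lie outside D. -/
theorem clock_eq_pathClock (hs : (s : ℝ≥0∞) < exitTime X D ω) :
    clock X D v s ω = pathClock (clockRate D v) (fun u => X u ω) s := by
  have hset : {u : ℝ | 0 ≤ u ∧ u ≤ s ∧ (u.toNNReal : ℝ≥0∞) < exitTime X D ω} =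
      {u : ℝ | 0 ≤ u ∧ u ≤ s} := by
    ext u
    simp only [mem_ofPred_eq]
    refine and_congr_right fun _ => and_iff_left_of_imp fun h => lt_of_le_of_lt ?_ hs
    exact_mod_cast Real.toNNReal_le_iff_le_coe.2 h
  have hm : MeasurableSet {u : ℝ | 0 ≤ u ∧ u ≤ s} := measurableSet_Icc
  rw [clock, hset, pathClock]
  refine lintegral_congr_ae ((ae_restrict_iff' hm).2 ?_)
  filter_upwards [Measure.ae_ne volume (0 : ℝ)] with u hu0 hu
  have : 0 < u.toNNReal := Real.toNNReal_pos.2 (lt_of_le_of_ne hu.1 hu0.symm)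
  rw [clockRate, indicator_of_mem (mem_of_lt_exitTime hs this (Real.toNNReal_le_iff_le_coe.2 hu.2))]

/-- The integral up to min(s, τ) is the supremum of those over shorter closed intervals, even when
infinite. A level that is strictly passed is thus already passed strictly before s and before the
exit. -/
theorem exists_lt_of_lt_clock {t : ℝ≥0∞} (h : t < clock X D v s ω) :
    ∃ s' < s, (s' : ℝ≥0∞) < exitTime X D ω ∧ t < clock X D v s' ω := by
  set τ := exitTime X D ω with hτ
  obtain ⟨σ, hσ⟩ : ∃ σ : ℝ≥0, (σ : ℝ≥0∞) = min (s : ℝ≥0∞) τ :=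
    ⟨_, ENNReal.coe_toNNReal (ne_top_of_le_ne_top ENNReal.coe_ne_top (min_le_left _ _))⟩
  let f : ℝ → ℝ≥0∞ := fun u => ENNReal.ofReal (v (X u.toNNReal ω))⁻¹
  -- Any sequence increasing to σ from strictly below would do.
  let a : ℕ → ℝ≥0 := fun n => σ * (n / (n + 1))
  have hclock : clock X D v s ω ≤ ∫⁻ u in Ico 0 (σ : ℝ), f u := by
    have hsub : {u : ℝ | 0 ≤ u ∧ u ≤ s ∧ (u.toNNReal : ℝ≥0∞) < τ} ⊆ Icc 0 (σ : ℝ) := by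
      rintro u ⟨h0, h1, h2⟩
      refine ⟨h0, ?_⟩
      have h3 : (u.toNNReal : ℝ≥0∞) ≤ σ := by
        rw [hσ]
        exact le_min (by exact_mod_cast Real.toNNReal_le_iff_le_coe.2 h1) h2.le
      exact Real.toNNReal_le_iff_le_coe.1 (by exact_mod_cast h3)
    refine (lintegral_mono_set hsub).trans_eq ?_
    exact setLIntegral_congr Ico_ae_eq_Icc.symm
  have hσ0 : 0 < σ := by
    rw [pos_iff_ne_zero]
    rintro rfl
    rw [NNReal.coe_zero, Ico_self, Measure.restrict_empty, lintegral_zero_measure] at hclock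
    exact absurd (h.trans_le hclock) not_lt_zero
  have haσ : ∀ n, a n < σ := fun n => by
    have : (n : ℝ≥0) / (n + 1) < 1 := (div_lt_one (by positivity)).2 (lt_add_one _)
    calc a n = σ * (n / (n + 1)) := rfl
      _ < σ * 1 := by gcongr
      _ = σ := mul_one _
  have hmono : Monotone a := by
    refine monotone_nat_of_le_succ fun n => ?_
    refine mul_le_mul_of_nonneg_left ?_ zero_le
    rw [div_le_div_iff₀ (by positivity) (by positivity), ← NNReal.coe_le_coe]
    push_cast
    nlinarith
  have hlim : Tendsto a atTop (𝓝 σ) := by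
    have h1 : Tendsto (fun n : ℕ => (n : ℝ≥0) / (n + 1)) atTop (𝓝 1) := by
      rw [← NNReal.tendsto_coe]
      push_cast
      exact tendsto_natCast_div_add_atTop 1
    simpa using h1.const_mul σ
  have hU : Ico 0 (σ : ℝ) = ⋃ n, Icc 0 (a n : ℝ) := by
    ext u
    simp only [mem_Ico, mem_iUnion, mem_Icc]
    constructor
    · rintro ⟨h0, h1⟩
      have h2 : u.toNNReal < σ := (Real.toNNReal_lt_iff_lt_coe h0).2 h1
      obtain ⟨n, hn⟩ := (hlim.eventually_const_lt h2).exists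
      exact ⟨n, h0, Real.toNNReal_le_iff_le_coe.1 hn.le⟩
    · rintro ⟨n, h0, h1⟩
      exact ⟨h0, h1.trans_lt (by exact_mod_cast haσ n)⟩
  have hsup : ∫⁻ u in Ico 0 (σ : ℝ), f u = ⨆ n, ∫⁻ u in Icc 0 (a n : ℝ), f u := by
    rw [hU, ← withDensity_apply _ (MeasurableSet.iUnion fun n => measurableSet_Icc),
      Monotone.measure_iUnion]
    · simp only [withDensity_apply _ measurableSet_Icc]
    · exact fun n m hnm => Icc_subset_Icc_right (by exact_mod_cast hmono hnm)
  obtain ⟨n, hn⟩ := lt_iSup_iff.1 (h.trans_le (hclock.trans_eq hsup))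
  have h1 : (a n : ℝ≥0∞) < min (s : ℝ≥0∞) τ := by rw [← hσ]; exact_mod_cast haσ n
  refine ⟨a n, by exact_mod_cast h1.trans_le (min_le_left _ _), h1.trans_le (min_le_right _ _),
    hn.trans_le ?_⟩
  refine lintegral_mono_set fun u hu => ⟨hu.1, hu.2, lt_of_le_of_lt ?_ (h1.trans_le (min_le_right _ _))⟩
  exact_mod_cast Real.toNNReal_le_iff_le_coe.2 hu.2

theorem inverseClock_lt (h : (t : ℝ≥0∞) < clock X D v s ω) :
    inverseClock X D v t ω < s ∧ (inverseClock X D v t ω : ℝ≥0∞) < exitTime X D ω := by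
  obtain ⟨s', hs', hτ, h'⟩ := exists_lt_of_lt_clock h
  have h1 : inverseClock X D v t ω ≤ s' := csInf_le (OrderBot.bddBelow _) h'
  exact ⟨h1.trans_lt hs', lt_of_le_of_lt (by exact_mod_cast h1) hτ⟩

theorem lt_clock_of_inverseClock_lt (h : ∃ a, (t : ℝ≥0∞) < clock X D v a ω)
    (hs : inverseClock X D v t ω < s) : (t : ℝ≥0∞) < clock X D v s ω := by
  obtain ⟨b, hb, hbs⟩ := exists_lt_of_csInf_lt (s := {s | (t : ℝ≥0∞) < clock X D v s ω}) h hs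
  exact hb.trans_le (clock_mono X D v ω hbs.le)

theorem clock_inverseClock_le : clock X D v (inverseClock X D v t ω) ω ≤ t :=
  not_lt.1 fun h => (inverseClock_lt h).1.false

theorem inverseClock_mono (h : ∃ a, (t : ℝ≥0∞) < clock X D v a ω) (hst : s ≤ t) :
    inverseClock X D v s ω ≤ inverseClock X D v t ω :=
  csInf_le_csInf (OrderBot.bddBelow _) h fun _ ha =>
    show (s : ℝ≥0∞) < _ from lt_of_le_of_lt (by exact_mod_cast hst) ha

theorem inverseClock_eq_pathInverse {r : ℝ≥0} (hr : (r : ℝ≥0∞) < exitTime X D ω)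
    (ht : t < pathClock (clockRate D v) (fun u => X u ω) r) :
    inverseClock X D v t ω = pathInverse (clockRate D v) (fun u => X u ω) t := by
  rw [← clock_eq_pathClock hr] at ht
  exact sInf_lt_congr (clock_mono X D v ω) (pathClock_mono _ _)
    (fun s hs => clock_eq_pathClock (lt_of_le_of_lt (by exact_mod_cast hs) hr)) ht

/-- The right inverse of the clock is right continuous. -/
theorem continuousWithinAt_inverseClock (h : ∃ a, (t : ℝ≥0∞) < clock X D v a ω) :
    Tendsto (fun s => inverseClock X D v s ω) (𝓝[≥] t) (𝓝[≥] (inverseClock X D v t ω)) := by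
  have hlt : ∀ b, inverseClock X D v t ω < b →
      ∀ᶠ s in 𝓝[≥] t, t ≤ s ∧ (s : ℝ≥0∞) < clock X D v b ω := by
    intro b hb
    have h1 := lt_clock_of_inverseClock_lt h hb
    have h2 : Tendsto (fun s : ℝ≥0 => (s : ℝ≥0∞)) (𝓝[≥] t) (𝓝 t) :=
      (ENNReal.continuous_coe.tendsto t).mono_left nhdsWithin_le_nhds
    filter_upwards [h2.eventually_lt_const h1, self_mem_nhdsWithin] with s hs hts using ⟨hts, hs⟩
  have hge : ∀ᶠ s in 𝓝[≥] t, inverseClock X D v t ω ≤ inverseClock X D v s ω := by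
    filter_upwards [hlt _ (lt_add_one _)] with s hs
    exact inverseClock_mono ⟨_, hs.2⟩ hs.1
  refine tendsto_nhdsWithin_iff.2 ⟨?_, hge⟩
  refine tendsto_order.2 ⟨fun a ha => ?_, fun b hb => ?_⟩
  · filter_upwards [hge] with s hs using ha.trans_le hs
  · filter_upwards [hlt b hb] with s hs using (inverseClock_lt hs.2).1

/-- The clock does not jump at times before the exit. -/
theorem exists_clock_le [TopologicalSpace E] (hr : IsRightContinuousPath fun s => X s ω)
    (hv : ContinuousOn v D) (hv0 : ∀ y ∈ D, 0 < v y) (hD : X s ω ∈ D)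
    (hs : (s : ℝ≥0∞) < exitTime X D ω) {a : ℝ≥0∞} (ha : clock X D v s ω < a) :
    ∃ u > s, clock X D v u ω ≤ a := by
  have hsfin : clock X D v s ω ≠ ⊤ := ne_top_of_lt ha
  obtain ⟨e, he, hea⟩ : ∃ e : ℝ≥0, 0 < e ∧ clock X D v s ω + e ≤ a := by
    obtain ⟨e, he, hea⟩ := ENNReal.lt_iff_exists_add_pos_lt.1 ha
    exact ⟨e, he, hea.le⟩
  obtain ⟨u₀, hu₀, hmem⟩ := lt_exitTime_iff.1 hs
  have hX : Tendsto (fun u => X u ω) (𝓝[>] s) (𝓝[D] (X s ω)) := by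
    refine tendsto_nhdsWithin_iff.2 ⟨(hr s).mono_left (nhdsWithin_mono _ Ioi_subset_Ici_self), ?_⟩
    filter_upwards [Ioo_mem_nhdsGT hu₀] with u hu using hmem u (lt_of_le_of_lt zero_le hu.1) hu.2
  -- Just after s the speed v exceeds c, so the clock grows at rate at most 1/c, and u is taken
  -- within c · e of s to keep the increment below e.
  set c := v (X s ω) / 2 with hc
  have hc0 : 0 < c := half_pos (hv0 _ hD)
  have hev : ∀ᶠ u in 𝓝[>] s, c < v (X u ω) :=
    ((hv _ hD).tendsto.comp hX).eventually_const_lt (half_lt_self (hv0 _ hD))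
  obtain ⟨u₁, hu₁, hsub⟩ := mem_nhdsGT_iff_exists_Ioo_subset.1 hev
  obtain ⟨u, hsu, hu⟩ : ∃ u, s < u ∧ u < u₁ ∧ (u : ℝ) < s + c * e := by
    have h1 : ∀ᶠ u in 𝓝[>] s, u < u₁ := by
      filter_upwards [Ioo_mem_nhdsGT hu₁] with u hu using hu.2
    have h2 : ∀ᶠ u : ℝ≥0 in 𝓝[>] s, (u : ℝ) < s + c * e := by
      have : Tendsto (fun u : ℝ≥0 => (u : ℝ)) (𝓝[>] s) (𝓝 s) :=
        (NNReal.continuous_coe.tendsto s).mono_left nhdsWithin_le_nhds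
      exact this.eventually_lt_const (by have : (0 : ℝ) < e := he; nlinarith [mul_pos hc0 this])
    have h0 : ∀ᶠ u in 𝓝[>] s, s < u := self_mem_nhdsWithin
    obtain ⟨u, h3, h4, h5⟩ := (h0.and (h1.and h2)).exists
    exact ⟨u, h3, h4, h5⟩
  refine ⟨u, hsu, le_trans ?_ hea⟩
  have hsplit : {r : ℝ | 0 ≤ r ∧ r ≤ u ∧ (r.toNNReal : ℝ≥0∞) < exitTime X D ω} ⊆
      {r : ℝ | 0 ≤ r ∧ r ≤ s ∧ (r.toNNReal : ℝ≥0∞) < exitTime X D ω} ∪ Ioc (s : ℝ) u := by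
    rintro r ⟨h0, h1, h2⟩
    rcases le_or_gt r s with h | h
    · exact Or.inl ⟨h0, h, h2⟩
    · exact Or.inr ⟨h, h1⟩
  refine (lintegral_mono_set hsplit).trans ((lintegral_union_le _ _ _).trans ?_)
  refine add_le_add (le_of_eq rfl) ?_
  have hbound : ∀ r ∈ Ioc (s : ℝ) u, ENNReal.ofReal (v (X r.toNNReal ω))⁻¹ ≤ ENNReal.ofReal c⁻¹ := by
    intro r hr
    have h0 : (0 : ℝ) ≤ r := s.2.trans hr.1.le
    have h1 : c < v (X r.toNNReal ω) := hsub ⟨by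
      rw [← NNReal.coe_lt_coe, Real.coe_toNNReal r h0]; exact hr.1, by
      rw [← NNReal.coe_lt_coe, Real.coe_toNNReal r h0]
      exact lt_of_le_of_lt hr.2 (by exact_mod_cast hu.1)⟩
    gcongr
  refine (setLIntegral_mono measurable_const hbound).trans ?_
  rw [setLIntegral_const, Real.volume_Ioc, ← ENNReal.ofReal_mul (by positivity),
    ← ENNReal.ofReal_coe_nnreal]
  refine ENNReal.ofReal_le_ofReal ?_
  rw [inv_mul_le_iff₀ hc0]
  linarith [hu.2]

variable [MeasurableSpace E]

theorem measurable_clockRate [TopologicalSpace E] [BorelSpace E] (hD : MeasurableSet D)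
    (hv : ContinuousOn v D) : Measurable (clockRate D v) := by
  classical
  have h : Measurable (D.piecewise v 0) := hv.measurable_piecewise continuousOn_const hD
  have heq : clockRate D v = D.indicator fun y => ENNReal.ofReal (D.piecewise v 0 y)⁻¹ := by
    refine indicator_congr fun y hy => ?_
    rw [piecewise_eq_of_mem _ _ _ hy]
  rw [heq]
  exact (ENNReal.measurable_ofReal.comp h.inv).indicator hD

variable [TopologicalSpace E] [PolishSpace E] [BorelSpace E] [Nonempty E]

theorem IsRightContinuousPath.measurable {w : ℝ≥0 → E} (hw : IsRightContinuousPath w) :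
    Measurable w := by
  have h := measurable_id.extendSkeleton (measurable_const (a := skeleton w))
  simpa only [extendSkeleton_skeleton hw, id] using h

/-- Before the exit, the clock is strictly increasing. -/
theorem clock_lt_clock (hr : IsRightContinuousPath fun s => X s ω) (hD : MeasurableSet D)
    (hv : ContinuousOn v D) (hv0 : ∀ y ∈ D, 0 < v y) (hs : (s : ℝ≥0∞) < exitTime X D ω)
    (hfin : clock X D v s ω ≠ ⊤) {u : ℝ≥0} (hsu : s < u) :
    clock X D v s ω < clock X D v u ω := by
  obtain ⟨b, hb, hmem⟩ := lt_exitTime_iff.1 hs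
  have hbu : s < min b u := lt_min hb hsu
  have hsub : {r : ℝ | 0 ≤ r ∧ r ≤ s ∧ (r.toNNReal : ℝ≥0∞) < exitTime X D ω} ∪
      Ioo (s : ℝ) (min b u : ℝ≥0) ⊆
      {r : ℝ | 0 ≤ r ∧ r ≤ u ∧ (r.toNNReal : ℝ≥0∞) < exitTime X D ω} := by
    rintro r (⟨h0, h1, h2⟩ | ⟨h1, h2⟩)
    · exact ⟨h0, h1.trans (by exact_mod_cast hsu.le), h2⟩
    · have h0 : (0 : ℝ) ≤ r := s.2.trans h1.le
      have h3 : r.toNNReal < min b u := (Real.toNNReal_lt_iff_lt_coe h0).2 h2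
      exact ⟨h0, h2.le.trans (by exact_mod_cast min_le_right _ _),
        lt_exitTime_iff.2 ⟨b, h3.trans_le (min_le_left _ _), hmem⟩⟩
  have hdisj : Disjoint {r : ℝ | 0 ≤ r ∧ r ≤ s ∧ (r.toNNReal : ℝ≥0∞) < exitTime X D ω}
      (Ioo (s : ℝ) (min b u : ℝ≥0)) :=
    disjoint_left.2 fun r h1 h2 => absurd h1.2.1 (not_le.2 h2.1)
  have hpos : 0 < ∫⁻ r in Ioo (s : ℝ) (min b u : ℝ≥0), ENNReal.ofReal (v (X r.toNNReal ω))⁻¹ := by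
    have hmem' : ∀ r ∈ Ioo (s : ℝ) (min b u : ℝ≥0), X r.toNNReal ω ∈ D := by
      intro r hr
      have h0 : (0 : ℝ) ≤ r := s.2.trans hr.1.le
      have h3 : r.toNNReal < min b u := (Real.toNNReal_lt_iff_lt_coe h0).2 hr.2
      exact hmem _ (Real.toNNReal_pos.2 (lt_of_le_of_lt s.2 hr.1)) (h3.trans_le (min_le_left _ _))
    have heq : ∫⁻ r in Ioo (s : ℝ) (min b u : ℝ≥0), ENNReal.ofReal (v (X r.toNNReal ω))⁻¹ =
        ∫⁻ r in Ioo (s : ℝ) (min b u : ℝ≥0), clockRate D v (X r.toNNReal ω) :=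
      setLIntegral_congr_fun measurableSet_Ioo fun r hr => by
        rw [clockRate, indicator_of_mem (hmem' r hr)]
    have hm : Measurable fun r : ℝ => clockRate D v (X r.toNNReal ω) :=
      (measurable_clockRate hD hv).comp (hr.measurable.comp measurable_real_toNNReal)
    rw [heq, setLIntegral_pos_iff hm]
    have hsupp : Ioo (s : ℝ) (min b u : ℝ≥0) ⊆ Function.support
        fun r : ℝ => clockRate D v (X r.toNNReal ω) := by
      intro r hr
      rw [Function.mem_support, clockRate, indicator_of_mem (hmem' r hr)]
      exact (ENNReal.ofReal_pos.2 (inv_pos.2 (hv0 _ (hmem' r hr)))).ne'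
    rw [inter_eq_self_of_subset_right hsupp, Real.volume_Ioo, ENNReal.ofReal_pos]
    exact sub_pos.2 (by exact_mod_cast hbu)
  calc clock X D v s ω < clock X D v s ω +
        ∫⁻ r in Ioo (s : ℝ) (min b u : ℝ≥0), ENNReal.ofReal (v (X r.toNNReal ω))⁻¹ :=
        ENNReal.lt_add_right hfin hpos.ne'
    _ = _ := (lintegral_union measurableSet_Ioo hdisj).symm
    _ ≤ _ := lintegral_mono_set hsub

theorem measurable_pathClock {k : E → ℝ≥0∞} (hk : Measurable k) (s : ℝ≥0) :
    Measurable fun p : ℕ × ℕ → E => pathClock k (extendSkeleton p) s := by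
  refine Measurable.lintegral_prod_right' (f := fun q : (ℕ × ℕ → E) × ℝ =>
    k (extendSkeleton q.1 q.2.toNNReal)) ?_
  exact hk.comp ((measurable_real_toNNReal.comp measurable_snd).extendSkeleton measurable_fst)

theorem measurable_pathInverse {k : E → ℝ≥0∞} (hk : Measurable k) (t : ℝ≥0) :
    Measurable fun p : ℕ × ℕ → E => pathInverse k (extendSkeleton p) t := by
  refine measurable_of_Iio fun u => ?_
  have hm : ∀ s, MeasurableSet {p : ℕ × ℕ → E | (t : ℝ≥0∞) < pathClock k (extendSkeleton p) s} :=
    fun s => measurableSet_lt measurable_const (measurable_pathClock hk s)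
  -- Monotonicity allows testing at grid times only. The second piece accounts for the convention
  -- `sInf ∅ = 0`, when the clock never passes t.
  have hset : (fun p : ℕ × ℕ → E => pathInverse k (extendSkeleton p) t) ⁻¹' Iio u =
      (⋃ i : ℕ × ℕ, {p | (t : ℝ≥0∞) < pathClock k (extendSkeleton p) (skeletonTime i) ∧
        skeletonTime i < u}) ∪
      ((⋃ n : ℕ, {p | (t : ℝ≥0∞) < pathClock k (extendSkeleton p) n})ᶜ ∩ {_p | 0 < u}) := by
    ext p
    simp only [mem_preimage, mem_Iio, mem_union, mem_iUnion, mem_ofPred_eq, mem_inter_iff,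
      mem_compl_iff, not_exists]
    constructor
    · intro h
      by_cases hne : ∃ n : ℕ, (t : ℝ≥0∞) < pathClock k (extendSkeleton p) n
      · left
        obtain ⟨n, hn⟩ := hne
        obtain ⟨s, hs, hsu⟩ := exists_lt_of_csInf_lt (s := {s | (t : ℝ≥0∞) <
          pathClock k (extendSkeleton p) s}) ⟨n, hn⟩ h
        obtain ⟨m, hmu⟩ := ((tendsto_nhdsWithin_iff.1 (tendsto_gridTime s)).1.eventually_lt_const
          hsu).exists
        exact ⟨(m, ⌊s * (m + 1)⌋₊), lt_of_lt_of_le hs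
          (pathClock_mono k _ (lt_gridTime m s).le), hmu⟩
      · exact Or.inr ⟨not_exists.1 hne, lt_of_le_of_lt zero_le h⟩
    · rintro (⟨i, hi, hiu⟩ | ⟨hne, h0⟩)
      · exact lt_of_le_of_lt (csInf_le (OrderBot.bddBelow _) hi) hiu
      · have hempty : {s : ℝ≥0 | (t : ℝ≥0∞) < pathClock k (extendSkeleton p) s} = ∅ := by
          refine eq_empty_of_forall_notMem fun s hs => hne ⌈s⌉₊ ?_
          exact lt_of_lt_of_le hs (pathClock_mono k _ (Nat.le_ceil s))
        rw [pathInverse, hempty, NNReal.sInf_empty]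
        exact h0
  rw [hset]
  refine (MeasurableSet.iUnion fun i => ?_).union ((MeasurableSet.iUnion fun n => hm _).compl.inter ?_)
  · exact (hm _).inter (MeasurableSet.const _)
  · exact MeasurableSet.const _

end TimeChange

/-! ### Time changes of Doob transforms -/

section CylinderMaps

variable {E Ω Ω' : Type*}

theorem mem_cylinderEvent_map {W : ℝ≥0 → Ω → Option E} {W' : ℝ≥0 → Ω' → Option E} {ω : Ω}
    {ω' : Ω'} {φ : Set E → Set E} {y z : ℝ≥0 → E} (l : List (ℝ≥0 × Set E)) {a : ℝ≥0}
    (h : ∀ u ≤ totalTime l, W (a + u) ω = some (y (a + u)) ∧ W' (a + u) ω' = some (z (a + u)) ∧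
      ∀ B, y (a + u) ∈ B ↔ z (a + u) ∈ φ B) :
    ω ∈ cylinderEvent W a l ↔
      ω' ∈ cylinderEvent W' a (l.map fun b => (b.1, φ b.2)) := by
  induction l generalizing a with
  | nil => exact iff_of_true trivial trivial
  | cons c l ih =>
    obtain ⟨s, B⟩ := c
    rw [totalTime_cons] at h
    obtain ⟨h1, h2, h3⟩ := h s le_self_add
    rw [List.map_cons, mem_cylinderEvent_cons, mem_cylinderEvent_cons, h1, h2]
    refine and_congr ?_ (ih fun u hu => ?_)
    · simpa using h3 B
    · rw [add_assoc]
      exact h (s + u) (by gcongr)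

theorem mem_cylinderEvent_append_singleton {W : ℝ≥0 → Ω → Option E} {ω : Ω}
    (l : List (ℝ≥0 × Set E)) (B : Set E) (a : ℝ≥0) :
    ω ∈ cylinderEvent W a (l ++ [(0, B)]) ↔
      ω ∈ cylinderEvent W a l ∧ ∃ y ∈ B, W (a + totalTime l) ω = some y := by
  induction l generalizing a with
  | nil => simp [cylinderEvent, totalTime]
  | cons c l ih =>
    obtain ⟨s, B'⟩ := c
    rw [List.cons_append, mem_cylinderEvent_cons, mem_cylinderEvent_cons, ih, totalTime_cons,
      and_assoc, add_assoc]

theorem totalTime_append_singleton (l : List (ℝ≥0 × Set E)) (B : Set E) :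
    totalTime (l ++ [(0, B)]) = totalTime l := by
  simp [totalTime]

theorem measurableSet_cylinderEvent_some [MeasurableSpace E] [MeasurableSpace Ω]
    {Z : ℝ≥0 → Ω → E} (hZ : ∀ t, Measurable (Z t)) {l : List (ℝ≥0 × Set E)}
    (hl : ∀ b ∈ l, MeasurableSet b.2) (a : ℝ≥0) :
    MeasurableSet (cylinderEvent (fun t ω => some (Z t ω)) a l) := by
  induction l generalizing a with
  | nil => exact MeasurableSet.univ
  | cons c l ih =>
    obtain ⟨s, B⟩ := c
    have h1 : MeasurableSet {ω | Z (a + s) ω ∈ B} := hZ _ (hl (s, B) List.mem_cons_self)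
    convert h1.inter (ih (fun b hb => hl b (List.mem_cons_of_mem _ hb)) (a + s)) using 1
    ext ω
    simp [cylinderEvent]

/-- The event that the inverted process passes through the given sets and is alive at the last
of the given times. -/
def aliveCylinder (X : ℝ≥0 → Ω → E) (V : Set E) (I : E → E) (v : E → ℝ)
    (l : List (ℝ≥0 × Set E)) : Set Ω :=
  cylinderEvent (invertedProcess X V I v) 0 l ∩
    {ω | ∃ s, (totalTime l : ℝ≥0∞) < clock X V v s ω}

theorem invertedProcess_eq_some {X : ℝ≥0 → Ω → E} {V : Set E} {I : E → E} {v : E → ℝ} {t : ℝ≥0}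
    {ω : Ω} (h : ∃ s, (t : ℝ≥0∞) < clock X V v s ω) :
    invertedProcess X V I v t ω = some (I (X (inverseClock X V v t ω) ω)) := if_pos h

theorem invertedProcess_eq_some_iff {X : ℝ≥0 → Ω → E} {V : Set E} {I : E → E} {v : E → ℝ} {t : ℝ≥0}
    {ω : Ω} : (∃ y, invertedProcess X V I v t ω = some y) ↔
      ∃ s, (t : ℝ≥0∞) < clock X V v s ω := by
  unfold invertedProcess
  split_ifs with h <;> simp [h]

end CylinderMaps

section TimeChangedDoob

variable {E Ω Ω' : Type*} [TopologicalSpace E] [Nonempty E]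

/-- The skeletons of paths whose time change passes through the sets of `l`, with the last of the
times in the `j`-th interval of the grid of mesh `1 / (m + 1)`. -/
def timeChangeEvent (V : Set E) (I : E → E) (v : E → ℝ) (l : List (ℝ≥0 × Set E)) (m j : ℕ) :
    Set (ℕ × ℕ → E) :=
  {p | ⌊pathInverse (clockRate V v) (extendSkeleton p) (totalTime l) * (m + 1)⌋₊ = j} ∩
    ({p | (totalTime l : ℝ≥0∞) <
      pathClock (clockRate V v) (extendSkeleton p) (skeletonTime (m, j))} ∩
    cylinderEvent (fun s p => some
      (extendSkeleton p (pathInverse (clockRate V v) (extendSkeleton p) s))) 0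
      (l.map fun b => (b.1, V ∩ I ⁻¹' b.2)))

variable {Z : ℝ≥0 → Ω → E} {V : Set E} {I : E → E} {v : E → ℝ} {l : List (ℝ≥0 × Set E)} {m j : ℕ}
  {ω : Ω}

/-- No comparison with the exit time is made, so the pieces for different j are disjoint for every
ω. -/
theorem of_mem_timeChangeEvent [T2Space E] (hr : IsRightContinuousPath fun s => Z s ω)
    (h : skeleton (stopPath (skeletonTime (m, j)) fun s => Z s ω) ∈ timeChangeEvent V I v l m j) :
    (totalTime l : ℝ≥0∞) < pathClock (clockRate V v) (fun s => Z s ω) (skeletonTime (m, j)) ∧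
      ⌊pathInverse (clockRate V v) (fun s => Z s ω) (totalTime l) * (m + 1)⌋₊ = j := by
  obtain ⟨h1, h2, -⟩ := h
  rw [mem_ofPred_eq, extendSkeleton_skeleton (hr.stopPath _)] at h1 h2
  rw [pathClock_stopPath _ _ le_rfl] at h2
  rw [pathInverse_stopPath _ _ h2] at h1
  exact ⟨h2, h1⟩

/-- The grid time r is strictly later than γ_t and before the exit, so the path stopped at r
determines the clock up to passing t, and with it the time change on [0, t]. -/
theorem mem_timeChangeEvent_iff [T2Space E] (hr : IsRightContinuousPath fun s => Z s ω)
    (hτ : (skeletonTime (m, j) : ℝ≥0∞) < exitTime Z V ω) (h0 : Z 0 ω ∈ V) :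
    skeleton (stopPath (skeletonTime (m, j)) fun s => Z s ω) ∈ timeChangeEvent V I v l m j ↔
      ω ∈ aliveCylinder Z V I v l ∧ ⌊inverseClock Z V v (totalTime l) ω * (m + 1)⌋₊ = j := by
  set r := skeletonTime (m, j) with hrdef
  have key : ∀ u : ℝ≥0, (u : ℝ≥0∞) < clock Z V v r ω →
      pathInverse (clockRate V v) (stopPath r fun s => Z s ω) u = inverseClock Z V v u ω := by
    intro u hu
    rw [clock_eq_pathClock hτ] at hu
    rw [pathInverse_stopPath _ _ hu, inverseClock_eq_pathInverse hτ hu]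
  have hcyl : (totalTime l : ℝ≥0∞) < clock Z V v r ω →
      (skeleton (stopPath r fun s => Z s ω) ∈ cylinderEvent (fun s p => some
        (extendSkeleton p (pathInverse (clockRate V v) (extendSkeleton p) s))) 0
        (l.map fun b => (b.1, V ∩ I ⁻¹' b.2)) ↔
      ω ∈ cylinderEvent (invertedProcess Z V I v) 0 l) := by
    intro ht
    refine (mem_cylinderEvent_map (φ := fun B => V ∩ I ⁻¹' B)
      (y := fun u => I (Z (inverseClock Z V v u ω) ω))
      (z := fun u => Z (inverseClock Z V v u ω) ω) l fun u hu => ?_).symm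
    have hu' : ((0 + u : ℝ≥0) : ℝ≥0∞) < clock Z V v r ω :=
      lt_of_le_of_lt (by rw [zero_add]; exact_mod_cast hu) ht
    have hlt := inverseClock_lt hu'
    refine ⟨invertedProcess_eq_some ⟨r, hu'⟩, ?_, fun B => ?_⟩
    · rw [extendSkeleton_skeleton (hr.stopPath _), key _ hu', stopPath_of_le _ hlt.1.le]
    · have hZV : Z (inverseClock Z V v (0 + u) ω) ω ∈ V := by
        rcases eq_or_ne (inverseClock Z V v (0 + u) ω) 0 with hz | hz
        · rw [hz]; exact h0
        · exact mem_of_lt_exitTime hlt.2 (pos_iff_ne_zero.2 hz) le_rfl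
      exact (and_iff_right hZV).symm
  constructor
  · rintro ⟨h1, h2, h3⟩
    rw [mem_ofPred_eq, extendSkeleton_skeleton (hr.stopPath _)] at h1 h2
    rw [pathClock_stopPath _ _ le_rfl, ← clock_eq_pathClock hτ] at h2
    rw [key _ h2] at h1
    exact ⟨⟨(hcyl h2).1 h3, ⟨r, h2⟩⟩, h1⟩
  · rintro ⟨⟨h1, h2⟩, h3⟩
    have hlt : inverseClock Z V v (totalTime l) ω < r := by
      rw [hrdef, ← h3]
      exact lt_gridTime m _
    have ht := lt_clock_of_inverseClock_lt h2 hlt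
    refine ⟨?_, ?_, (hcyl ht).2 h1⟩
    · rw [mem_ofPred_eq, extendSkeleton_skeleton (hr.stopPath _), key _ ht, h3]
    · rwa [mem_ofPred_eq, extendSkeleton_skeleton (hr.stopPath _), pathClock_stopPath _ _ le_rfl,
        ← clock_eq_pathClock hτ]

/-- The events which discretize the last time of an event `aliveCylinder`. -/
def discretizedEvent (Z : ℝ≥0 → Ω → E) (V : Set E) (I : E → E) (v : E → ℝ)
    (l : List (ℝ≥0 × Set E)) (m j : ℕ) : Set Ω :=
  {ω | skeleton (stopPath (skeletonTime (m, j)) fun s => Z s ω) ∈ timeChangeEvent V I v l m j} ∩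
    {ω | (skeletonTime (m, j) : ℝ≥0∞) < exitTime Z V ω}

/-- On an alive cylinder γ_t is strictly before the exit, so the next grid point is too once the
mesh is small; right continuity of the path and continuity of g then give the limit. -/
theorem eventually_mem_discretizedEvent [T2Space E] {g : E → ℝ≥0∞}
    (hr : IsRightContinuousPath fun s => Z s ω)
    (hg : ContinuousOn g V) (h0 : (0 : ℝ≥0∞) < exitTime Z V ω → Z 0 ω ∈ V)
    (hω : ω ∈ aliveCylinder Z V I v l) :
    (∀ᶠ m in atTop, ω ∈ ⋃ j, discretizedEvent Z V I v l m j) ∧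
      Tendsto (fun m => V.indicator g
        (Z (gridTime m (pathInverse (clockRate V v) (fun s => Z s ω) (totalTime l))) ω)) atTop
        (𝓝 (V.indicator g
          (Z (pathInverse (clockRate V v) (fun s => Z s ω) (totalTime l)) ω))) := by
  obtain ⟨s₀, hs₀⟩ := hω.2
  obtain ⟨s₁, -, hs₁, hs₁'⟩ := exists_lt_of_lt_clock hs₀
  have hT : pathInverse (clockRate V v) (fun s => Z s ω) (totalTime l) =
      inverseClock Z V v (totalTime l) ω := by
    rw [clock_eq_pathClock hs₁] at hs₁'
    exact (inverseClock_eq_pathInverse hs₁ hs₁').symm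
  set T := inverseClock Z V v (totalTime l) ω with hTdef
  have hTτ : (T : ℝ≥0∞) < exitTime Z V ω := (inverseClock_lt hs₀).2
  have hV0 := h0 (lt_of_le_of_lt zero_le hTτ)
  have hgrid := tendsto_gridTime T
  have hev : ∀ᶠ m in atTop, (gridTime m T : ℝ≥0∞) < exitTime Z V ω :=
    ((ENNReal.continuous_coe.tendsto T).comp
      (tendsto_nhdsWithin_iff.1 hgrid).1).eventually_lt_const hTτ
  rw [hT]
  constructor
  · filter_upwards [hev] with m hm
    rw [mem_iUnion]
    exact ⟨_, (mem_timeChangeEvent_iff hr hm hV0).2 ⟨hω, rfl⟩, hm⟩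
  · have hTV : Z T ω ∈ V := by
      rcases eq_or_ne T 0 with hz | hz
      · rw [hz]; exact hV0
      · exact mem_of_lt_exitTime hTτ (pos_iff_ne_zero.2 hz) le_rfl
    have hmem : ∀ᶠ m in atTop, Z (gridTime m T) ω ∈ V := by
      filter_upwards [hev] with m hm
      exact mem_of_lt_exitTime hm (lt_of_le_of_lt zero_le (lt_gridTime m T)) le_rfl
    rw [indicator_of_mem hTV]
    refine ((hg _ hTV).tendsto.comp (tendsto_nhdsWithin_iff.2
      ⟨hr.tendsto_gridTime T, hmem⟩)).congr' ?_
    filter_upwards [hmem] with m hm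
    rw [indicator_of_mem hm, Function.comp]

theorem mem_aliveCylinder_of_mem_discretizedEvent [T2Space E]
    (hr : IsRightContinuousPath fun s => Z s ω)
    (h0 : (0 : ℝ≥0∞) < exitTime Z V ω → Z 0 ω ∈ V)
    (hω : ω ∈ ⋃ j, discretizedEvent Z V I v l m j) : ω ∈ aliveCylinder Z V I v l := by
  obtain ⟨j, hj, hτ⟩ := mem_iUnion.1 hω
  exact ((mem_timeChangeEvent_iff hr hτ (h0 (lt_of_le_of_lt zero_le hτ))).1 hj).1

variable [MeasurableSpace E] [MeasurableSpace Ω] [MeasurableSpace Ω'] [PolishSpace E]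
  [BorelSpace E]

theorem measurableSet_timeChangeEvent (hV : MeasurableSet V) (hv : ContinuousOn v V)
    (hI : ContinuousOn I V) (hl : ∀ b ∈ l, MeasurableSet b.2) (m j : ℕ) :
    MeasurableSet (timeChangeEvent V I v l m j) := by
  have hk := measurable_clockRate hV hv
  have hVI : ∀ B, MeasurableSet B → MeasurableSet (V ∩ I ⁻¹' B) := by
    classical
    intro B hB
    have h : Measurable (V.piecewise I fun _ => Classical.arbitrary E) :=
      hI.measurable_piecewise continuousOn_const hV
    convert hV.inter (h hB) using 1
    ext y
    refine and_congr_right fun hy => ?_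
    rw [mem_preimage, mem_preimage, piecewise_eq_of_mem _ _ _ hy]
  refine MeasurableSet.inter ?_ (MeasurableSet.inter ?_ ?_)
  · exact (Nat.measurable_floor.comp ((measurable_pathInverse hk _).mul_const _))
      (measurableSet_singleton j)
  · exact measurableSet_lt measurable_const (measurable_pathClock hk _)
  · refine measurableSet_cylinderEvent_some
      (fun t => (measurable_pathInverse hk t).extendSkeleton measurable_id) ?_ 0
    simp only [List.mem_map, forall_exists_index, and_imp]
    rintro _ b hb rfl
    exact hVI _ (hl b hb)

variable {P : E → Measure Ω} {X : ℝ≥0 → Ω → E} {ℱ : Filtration ℝ≥0 ‹MeasurableSpace Ω›} {U : Set E}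
  {D : Set E} {g : E → ℝ≥0∞}

theorem nullMeasurableSet_discretizedEvent (hZ : ∀ t, Measurable (Z t))
    (hr : ∀ ω, IsRightContinuousPath fun s => Z s ω) (hV : MeasurableSet V)
    (hv : ContinuousOn v V) (hI : ContinuousOn I V) (hl : ∀ b ∈ l, MeasurableSet b.2) (m j : ℕ)
    (μ : Measure Ω) [IsFiniteMeasure μ] : NullMeasurableSet (discretizedEvent Z V I v l m j) μ :=
  ((measurable_skeleton_stopPath hZ _) (measurableSet_timeChangeEvent hV hv hI hl m j)
    |>.nullMeasurableSet).inter (nullMeasurableSet_lt_exitTime hZ hr hV _ _)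

/-- On the j-th piece the random grid time is the constant `skeletonTime (m, j)`, where densities at
deterministic times apply. -/
theorem lintegral_iUnion_discretizedEvent (hZ : ∀ t, Measurable (Z t))
    (hr : ∀ ω, IsRightContinuousPath fun s => Z s ω) (hV : MeasurableSet V)
    (hv : ContinuousOn v V) (hI : ContinuousOn I V) (hl : ∀ b ∈ l, MeasurableSet b.2) (m : ℕ)
    (μ : Measure Ω) [IsFiniteMeasure μ] (f : E → ℝ≥0∞) :
    ∫⁻ ω in ⋃ j, discretizedEvent Z V I v l m j,
        f (Z (gridTime m (pathInverse (clockRate V v) (fun s => Z s ω) (totalTime l))) ω) ∂μ =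
      ∑' j, ∫⁻ ω in discretizedEvent Z V I v l m j, f (Z (skeletonTime (m, j)) ω) ∂μ := by
  have hn := fun j => nullMeasurableSet_discretizedEvent hZ hr hV hv hI hl m j μ
  have hdisj : Pairwise (Function.onFun Disjoint (discretizedEvent Z V I v l m)) := fun i j hij =>
    disjoint_left.2 fun ω hi hj => hij <|
      (of_mem_timeChangeEvent (hr ω) hi.1).2.symm.trans (of_mem_timeChangeEvent (hr ω) hj.1).2
  rw [lintegral_iUnion₀ hn (hdisj.mono fun i j h => h.aedisjoint)]
  refine tsum_congr fun j => lintegral_congr_ae ((ae_restrict_iff'₀ (hn j)).2 ?_)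
  refine Eventually.of_forall fun ω hω => ?_
  have : gridTime m (pathInverse (clockRate V v) (fun s => Z s ω) (totalTime l)) =
      skeletonTime (m, j) := by
    rw [gridTime, (of_mem_timeChangeEvent (hr ω) hω.1).2, skeletonTime]
  dsimp only
  rw [this]

theorem measurable_pathInverse_comp {k : E → ℝ≥0∞} (hk : Measurable k)
    (hZ : ∀ t, Measurable (Z t)) (hr : ∀ ω, IsRightContinuousPath fun s => Z s ω) (t : ℝ≥0) :
    Measurable fun ω => pathInverse k (fun s => Z s ω) t := by
  have h := (measurable_pathInverse hk t).comp (measurable_skeleton hZ)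
  simpa only [Function.comp_def, extendSkeleton_skeleton (hr _)] using h

theorem measurable_gridTime_pathInverse {k : E → ℝ≥0∞} (hk : Measurable k)
    (hZ : ∀ t, Measurable (Z t)) (hr : ∀ ω, IsRightContinuousPath fun s => Z s ω) (t : ℝ≥0)
    (m : ℕ) : Measurable fun ω => Z (gridTime m (pathInverse k (fun s => Z s ω) t)) ω := by
  refine measurable_uncurry_of_isRightContinuousPath hZ hr ?_
  have h := measurable_pathInverse_comp hk hZ hr t
  have h' : Measurable fun j : ℕ => ((j : ℝ≥0) + 1) / (m + 1) := measurable_from_nat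
  exact h'.comp (Nat.measurable_floor.comp (h.mul_const _))

/-- A realization is not assumed normal. Its law at time 0, tested on the complement of the Doob
set, vanishes because X starts inside. -/
theorem HasMarkovLaw.ae_mem_of_pos_exitTime (hX : IsStandardProcess P X ℱ U)
    (hV : MeasurableSet (doobSet D g)) (hg : Measurable ((doobSet D g).indicator g)) {x : E}
    (hx : x ∈ doobSet D g) {Q : Measure Ω'} {Y : ℝ≥0 → Ω' → E}
    (hW : HasMarkovLaw Q (killedProcess Y (doobSet D g)) (doobSemigroup P X D g) x) :
    ∀ᵐ ω ∂Q, (0 : ℝ≥0∞) < exitTime Y (doobSet D g) ω → Y 0 ω ∈ doobSet D g := by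
  have h := hW [(0, (doobSet D g)ᶜ)] (by simpa using hV.compl)
  rw [hX.semigroupFdd_doobSemigroup hV hg (by simpa using hV.compl) hx, killedFdd,
    Measure.restrict_eq_zero.2, lintegral_zero_measure, mul_zero,
    measure_eq_zero_iff_ae_notMem] at h
  · filter_upwards [h] with ω hω h0
    by_contra hY
    rw [mem_cylinderEvent_cons, exists_killedProcess_eq_some_iff, zero_add] at hω
    exact hω ⟨⟨h0, hY⟩, trivial⟩
  · rw [measure_eq_zero_iff_ae_notMem]
    filter_upwards [hX.ae_mem_of_lt_exitTime hx] with ω hω hmem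
    have := (exists_killedProcess_eq_some_iff.1 hmem.1)
    exact this.2 (hω _ this.1)

/-- The finite-dimensional distributions of the time change of a Doob transform. -/
theorem HasMarkovLaw.measure_aliveCylinder (hX : IsStandardProcess P X ℱ U)
    (hV : MeasurableSet (doobSet D g)) (hg : ContinuousOn g (doobSet D g)) {x : E}
    (hx : x ∈ doobSet D g) {Q : Measure Ω'} {Y : ℝ≥0 → Ω' → E}
    (hW : HasMarkovLaw Q (killedProcess Y (doobSet D g)) (doobSemigroup P X D g) x)
    (hY : ∀ t, Measurable (Y t)) (hYr : ∀ ω, IsRightContinuousPath fun s => Y s ω)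
    (hv : ContinuousOn v (doobSet D g)) (hI : ContinuousOn I (doobSet D g))
    (hl : ∀ b ∈ l, MeasurableSet b.2) :
    Q (aliveCylinder Y (doobSet D g) I v l) =
      (g x)⁻¹ * ∫⁻ ω in aliveCylinder X (doobSet D g) I v l, (doobSet D g).indicator g
        (X (pathInverse (clockRate (doobSet D g) v) (fun s => X s ω) (totalTime l)) ω) ∂P x := by
  have := hW.isProbabilityMeasure
  have := hX.isProbabilityMeasure
  have hgm : Measurable ((doobSet D g).indicator g) := by
    classical
    rw [← piecewise_eq_indicator]
    exact hg.measurable_piecewise continuousOn_const hV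
  have hW0 := hW.ae_mem_of_pos_exitTime hX hV hgm hx
  set V := doobSet D g with hVdef
  have hgtop : ∀ y, V.indicator g y ≠ ⊤ := fun y => by
    by_cases hy : y ∈ V
    · rw [indicator_of_mem hy]; exact hy.2.2.ne
    · rw [indicator_of_notMem hy]; exact ENNReal.zero_ne_top
  have hk := measurable_clockRate hV hv
  have hXr := hX.isRightContinuousPath
  refine measure_eq_lintegral_of_truncated
    (S' := fun m => ⋃ j, discretizedEvent Y V I v l m j)
    (S := fun m => ⋃ j, discretizedEvent X V I v l m j)
    (b := fun m ω => V.indicator g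
      (Y (gridTime m (pathInverse (clockRate V v) (fun s => Y s ω) (totalTime l))) ω))
    (β := fun ω => V.indicator g
      (Y (pathInverse (clockRate V v) (fun s => Y s ω) (totalTime l)) ω))
    (c := fun m ω => V.indicator g
      (X (gridTime m (pathInverse (clockRate V v) (fun s => X s ω) (totalTime l))) ω))
    (ENNReal.inv_ne_top.2 hx.2.1.ne')
    (fun m => NullMeasurableSet.iUnion fun j =>
      nullMeasurableSet_discretizedEvent hY hYr hV hv hI hl m j Q)
    (fun m => NullMeasurableSet.iUnion fun j =>
      nullMeasurableSet_discretizedEvent hX.measurable hXr hV hv hI hl m j (P x))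
    (fun m => hgm.comp (measurable_gridTime_pathInverse hk hY hYr _ m))
    (fun m => hgm.comp (measurable_gridTime_pathInverse hk hX.measurable hXr _ m)) (fun ω => hgtop _)
    ?_ ?_ ?_ ?_ fun N m => ?_
  · filter_upwards [hW0] with ω hω using eventually_mem_discretizedEvent (hYr ω) hg hω
  · filter_upwards [hW0] with ω hω m using mem_aliveCylinder_of_mem_discretizedEvent (hYr ω) hω
  · filter_upwards [hX.ae_mem_of_lt_exitTime hx] with ω hω using
      eventually_mem_discretizedEvent (hXr ω) hg (hω 0)
  · filter_upwards [hX.ae_mem_of_lt_exitTime hx] with ω hω m using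
      mem_aliveCylinder_of_mem_discretizedEvent (hXr ω) (hω 0)
  -- Test function min(1, N/g) at each grid time: multiplied by the density g it becomes min(g, N).
  -- The pieces are then summed over j.
  · have hf : Measurable fun y => min 1 ((N : ℝ≥0∞) / V.indicator g y) :=
      measurable_const.min (measurable_const.div hgm)
    rw [lintegral_iUnion_discretizedEvent hY hYr hV hv hI hl m Q
        (fun y => min 1 ((N : ℝ≥0∞) / V.indicator g y)),
      lintegral_iUnion_discretizedEvent hX.measurable hXr hV hv hI hl m (P x)
        (fun y => min (V.indicator g y) N), ← ENNReal.tsum_mul_left]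
    refine tsum_congr fun j => ?_
    have halive : ∀ ω, (∃ y, killedProcess Y V (skeletonTime (m, j)) ω = some y) ↔
        (skeletonTime (m, j) : ℝ≥0∞) < exitTime Y V ω := fun ω => by
      simpa using exists_killedProcess_eq_some_iff (X := Y) (D := V) (B := univ)
        (t := skeletonTime (m, j)) (ω := ω)
    have h := hW.setLIntegral_eq hX hV hgm hx (r := skeletonTime (m, j)) hY (fun ω hω s hs => ?_)
      (measurableSet_timeChangeEvent (l := l) hV hv hI hl m j).universallyMeasurable hf
    · simp only [halive] at h
      have hmin : ∀ y, V.indicator g y * min 1 ((N : ℝ≥0∞) / V.indicator g y) =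
          min (V.indicator g y) N := fun y => ENNReal.mul_min_one_div (hgtop y)
      refine h.trans (congrArg _ (lintegral_congr fun ω => hmin _))
    · exact if_pos (lt_of_le_of_lt (by exact_mod_cast hs) ((halive ω).1 hω))

end TimeChangedDoob

/-! ### Time changes of processes killed on exiting a subset -/

section Subset

variable {E Ω : Type*} {X : ℝ≥0 → Ω → E} {U V : Set E} {v : E → ℝ} {ω : Ω} {r s t : ℝ≥0}

theorem clock_eq_of_subset (hVU : V ⊆ U) (hs : (s : ℝ≥0∞) < exitTime X V ω) :
    clock X V v s ω = clock X U v s ω := by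
  have h : ∀ {W : Set E}, (s : ℝ≥0∞) < exitTime X W ω →
      {u : ℝ | 0 ≤ u ∧ u ≤ s ∧ (u.toNNReal : ℝ≥0∞) < exitTime X W ω} = {u : ℝ | 0 ≤ u ∧ u ≤ s} := by
    intro W hW
    ext u
    simp only [mem_ofPred_eq]
    refine and_congr_right fun _ => and_iff_left_of_imp fun h => lt_of_le_of_lt ?_ hW
    exact_mod_cast Real.toNNReal_le_iff_le_coe.2 h
  rw [clock, clock, h hs, h (hs.trans_le (exitTime_mono hVU ω))]

theorem inverseClock_eq_of_subset (hVU : V ⊆ U) (hs : (s : ℝ≥0∞) < exitTime X V ω)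
    (ht : (t : ℝ≥0∞) < clock X V v s ω) : inverseClock X V v t ω = inverseClock X U v t ω :=
  sInf_lt_congr (clock_mono X V v ω) (clock_mono X U v ω)
    (fun _ ha => clock_eq_of_subset hVU (lt_of_le_of_lt (by exact_mod_cast ha) hs)) ht

theorem le_inverseClock_of_clock_le (h : ∃ a, (r : ℝ≥0∞) < clock X U v a ω)
    (hs : clock X U v s ω ≤ r) : s ≤ inverseClock X U v r ω :=
  le_csInf h fun a (ha : (r : ℝ≥0∞) < clock X U v a ω) =>
    le_of_lt (not_le.1 fun h' => (hs.trans_lt ha).not_ge (clock_mono X U v ω h'))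

/-- A clock without jumps has a strictly increasing inverse. -/
theorem inverseClock_lt_inverseClock [TopologicalSpace E]
    (hr : IsRightContinuousPath fun s => X s ω) (hv : ContinuousOn v U) (hv0 : ∀ y ∈ U, 0 < v y)
    (h : ∃ a, (r : ℝ≥0∞) < clock X U v a ω) (htr : t < r)
    (hU : X (inverseClock X U v t ω) ω ∈ U) :
    inverseClock X U v t ω < inverseClock X U v r ω := by
  obtain ⟨a, ha⟩ := h
  have ha' : (t : ℝ≥0∞) < clock X U v a ω := lt_trans (by exact_mod_cast htr) ha
  obtain ⟨u, hu, hur⟩ := exists_clock_le (a := r) hr hv hv0 hU (inverseClock_lt ha').2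
    (lt_of_le_of_lt clock_inverseClock_le (by exact_mod_cast htr))
  exact hu.trans_le (le_inverseClock_of_clock_le ⟨a, ha⟩ hur)

variable [TopologicalSpace E] [PolishSpace E] [MeasurableSpace E] [BorelSpace E] [Nonempty E]

/-- Every time below an inverse clock value is itself an inverse clock value. -/
theorem exists_inverseClock_eq (hr : IsRightContinuousPath fun s => X s ω) (hU : MeasurableSet U)
    (hv : ContinuousOn v U) (hv0 : ∀ y ∈ U, 0 < v y) (h : ∃ a, (r : ℝ≥0∞) < clock X U v a ω)
    (hs : s < inverseClock X U v r ω) : ∃ u ≤ r, inverseClock X U v u ω = s := by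
  obtain ⟨a, ha⟩ := h
  have hsr : clock X U v s ω ≤ r := not_lt.1 fun h' => (inverseClock_lt h').1.not_gt hs
  have hfin : clock X U v s ω ≠ ⊤ := ne_top_of_le_ne_top ENNReal.coe_ne_top hsr
  obtain ⟨u, hu⟩ := WithTop.ne_top_iff_exists.1 hfin
  change (u : ℝ≥0∞) = _ at hu
  have hur : u ≤ r := by exact_mod_cast hu.trans_le hsr
  have hτ : (s : ℝ≥0∞) < exitTime X U ω := lt_trans (by exact_mod_cast hs) (inverseClock_lt ha).2
  refine ⟨u, hur, le_antisymm (le_of_forall_gt_imp_ge_of_dense fun b hb => ?_) ?_⟩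
  · refine csInf_le (OrderBot.bddBelow _) ?_
    rw [mem_ofPred_eq, hu]
    exact clock_lt_clock hr hU hv hv0 hτ hfin hb
  · exact le_inverseClock_of_clock_le ⟨a, lt_of_le_of_lt (by exact_mod_cast hur) ha⟩ hu.ge

/-- If the time change stays in `V` on `[0, r]`, then the process has not left `V` before the
time-changed times below `r`. -/
theorem alive_of_forall_inverseClock_mem (hr : IsRightContinuousPath fun s => X s ω)
    (hU : MeasurableSet U) (hVU : V ⊆ U) (hv : ContinuousOn v U) (hv0 : ∀ y ∈ U, 0 < v y)
    (h : ∃ a, (r : ℝ≥0∞) < clock X U v a ω)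
    (hmem : ∀ s ≤ r, X (inverseClock X U v s ω) ω ∈ V) (htr : t < r) :
    ∃ a : ℝ≥0, (a : ℝ≥0∞) < exitTime X V ω ∧ (t : ℝ≥0∞) < clock X V v a ω := by
  have hlt := inverseClock_lt_inverseClock hr hv hv0 h htr (hVU (hmem t htr.le))
  obtain ⟨a, hta, har⟩ := exists_between hlt
  have haV : (a : ℝ≥0∞) < exitTime X V ω := by
    refine lt_exitTime_iff.2 ⟨_, har, fun s _ hs => ?_⟩
    obtain ⟨u, hur, rfl⟩ := exists_inverseClock_eq hr hU hv hv0 h hs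
    exact hmem u hur
  refine ⟨a, haV, ?_⟩
  rw [clock_eq_of_subset hVU haV]
  obtain ⟨b, hb⟩ := h
  exact lt_clock_of_inverseClock_lt ⟨b, lt_trans (by exact_mod_cast htr) hb⟩ hta

end Subset

section Absorbed

variable {E Ω : Type*} [TopologicalSpace E] {X : ℝ≥0 → Ω → E} {U : Set E} {v : E → ℝ} {ω : Ω}

/-- Absorption rules out an earlier exit; openness of U and right continuity provide the margin
after t. -/
theorem lt_exitTime_iff_mem_of_absorbed (hU : IsOpen U) (hr : IsRightContinuousPath fun s => X s ω)
    (habs : ∀ s t, s ≤ t → X s ω ∉ U → X t ω = X s ω) (t : ℝ≥0) :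
    (t : ℝ≥0∞) < exitTime X U ω ↔ X t ω ∈ U := by
  constructor
  · intro h
    by_contra ht
    obtain ⟨u, hu, hmem⟩ := lt_exitTime_iff.1 h
    obtain ⟨a, ha, hau⟩ := exists_between hu
    refine absurd (hmem a (lt_of_le_of_lt zero_le ha) hau) ?_
    rw [habs t a ha.le ht]
    exact ht
  · intro h
    have hev : ∀ᶠ s in 𝓝[≥] t, X s ω ∈ U := (hr t).eventually_mem (hU.mem_nhds h)
    obtain ⟨u, hu, hsub⟩ := mem_nhdsGE_iff_exists_Ico_subset.1 hev
    refine lt_exitTime_iff.2 ⟨u, hu, fun s _ hs => ?_⟩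
    rcases le_total t s with hts | hst
    · exact hsub ⟨hts, hs⟩
    · by_contra hsU
      rw [habs s t hst hsU] at h
      exact hsU h

/-- Once outside U the path stays outside, where the rate vanishes. The identity therefore holds at
all times, which makes the clock of X measurable. -/
theorem clock_eq_pathClock_of_absorbed (hU : IsOpen U) (hr : IsRightContinuousPath fun s => X s ω)
    (habs : ∀ s t, s ≤ t → X s ω ∉ U → X t ω = X s ω) (s : ℝ≥0) :
    clock X U v s ω = pathClock (clockRate U v) (fun u => X u ω) s := by
  have hset : {u : ℝ | 0 ≤ u ∧ u ≤ s ∧ (u.toNNReal : ℝ≥0∞) < exitTime X U ω} =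
      {u : ℝ | (u.toNNReal : ℝ≥0∞) < exitTime X U ω} ∩ {u : ℝ | 0 ≤ u ∧ u ≤ s} := by
    ext u; simp only [mem_inter_iff, mem_ofPred_eq]; tauto
  have hm : MeasurableSet {u : ℝ | (u.toNNReal : ℝ≥0∞) < exitTime X U ω} :=
    (measurable_coe_nnreal_ennreal.comp measurable_real_toNNReal) measurableSet_Iio
  rw [clock, pathClock, hset, ← Measure.restrict_restrict hm, ← lintegral_indicator hm]
  refine lintegral_congr fun u => ?_
  classical
  rw [clockRate, indicator_apply, indicator_apply]
  simp only [mem_ofPred_eq, lt_exitTime_iff_mem_of_absorbed hU hr habs]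

theorem inverseClock_eq_pathInverse_of_absorbed (hU : IsOpen U)
    (hr : IsRightContinuousPath fun s => X s ω)
    (habs : ∀ s t, s ≤ t → X s ω ∉ U → X t ω = X s ω) (t : ℝ≥0) :
    inverseClock X U v t ω = pathInverse (clockRate U v) (fun u => X u ω) t := by
  simp only [inverseClock, pathInverse, clock_eq_pathClock_of_absorbed hU hr habs]

end Absorbed

/-! ### Inversion on invariant subsets -/

section RestrictedInversion

/-- Meant for the inverted path, whose right continuity is known only while it is alive. -/
theorem isRightContinuousPath_stopPath_of_lt {E : Type*} [TopologicalSpace E] {r : ℝ≥0} {w : ℝ≥0 → E}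
    (hw : ∀ s < r, ContinuousWithinAt w (Ici s) s) : IsRightContinuousPath (stopPath r w) := by
  intro t
  rcases lt_or_ge t r with h | h
  · have hmin : ContinuousWithinAt (fun s : ℝ≥0 => min s r) (Ici t) t :=
      (continuous_id.min continuous_const).continuousWithinAt
    refine ContinuousWithinAt.comp (g := w) (f := fun s => min s r) (t := Ici t) ?_ hmin
      fun s hs => le_min hs h.le
    rw [min_eq_left h.le]
    exact hw t h
  · refine (continuousWithinAt_const (b := w r)).congr (fun s hs => ?_) ?_
    · rw [stopPath, min_eq_right (h.trans hs)]
    · rw [stopPath, min_eq_right h]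

variable {E Ω : Type*} [Nonempty E] {X : ℝ≥0 → Ω → E} {U V : Set E} {I : E → E} {v : E → ℝ}
  {l : List (ℝ≥0 × Set E)} {r t : ℝ≥0} {ω : Ω}

open Classical in
/-- The inverted process, with values in `E` also after its killing. -/
def invertedPath (X : ℝ≥0 → Ω → E) (U : Set E) (I : E → E) (v : E → ℝ) (s : ℝ≥0)
    (ω : Ω) : E :=
  U.piecewise I (fun _ => Classical.arbitrary E) (X (inverseClock X U v s ω) ω)

theorem invertedPath_of_mem (h : X (inverseClock X U v t ω) ω ∈ U) :
    invertedPath X U I v t ω = I (X (inverseClock X U v t ω) ω) :=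
  if_pos h

/-- Before its exit from V the process has the same clock as in U, so the inversion in U follows
that in V, and remains in V slightly beyond the last time. -/
theorem stays_of_mem_aliveCylinder (hVU : V ⊆ U) (hVI : MapsTo I V V)
    (h0 : X 0 ω ∈ V) (hω : ω ∈ aliveCylinder X V I v l) :
    ω ∈ cylinderEvent (fun s ω => some (invertedPath X U I v s ω)) 0 l ∧
      ∃ a, (totalTime l : ℝ≥0∞) < clock X U v a ω ∧ ∀ r : ℝ≥0, (r : ℝ≥0∞) < clock X U v a ω →
        ∀ s ≤ r, invertedPath X U I v s ω ∈ V := by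
  obtain ⟨hcyl, b, hb⟩ := hω
  obtain ⟨a, -, haV, ha⟩ := exists_lt_of_lt_clock hb
  have hmem : ∀ s : ℝ≥0, (s : ℝ≥0∞) < clock X V v a ω → X (inverseClock X U v s ω) ω ∈ V := by
    intro s hs
    rw [← inverseClock_eq_of_subset hVU haV hs]
    rcases eq_or_ne (inverseClock X V v s ω) 0 with hz | hz
    · rw [hz]; exact h0
    · exact mem_of_lt_exitTime (inverseClock_lt hs).2 (pos_iff_ne_zero.2 hz) le_rfl
  refine ⟨(mem_cylinderEvent_congr l fun u hu => ?_).1 hcyl, a, ?_, fun r hr s hs => ?_⟩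
  · rw [zero_add]
    have hua : (u : ℝ≥0∞) < clock X V v a ω := lt_of_le_of_lt (by exact_mod_cast hu) ha
    rw [invertedProcess_eq_some ⟨a, hua⟩, invertedPath_of_mem (hVU (hmem u hua)),
      inverseClock_eq_of_subset hVU haV hua]
  · rwa [← clock_eq_of_subset hVU haV]
  · rw [← clock_eq_of_subset hVU haV] at hr
    have hs' : (s : ℝ≥0∞) < clock X V v a ω := lt_of_le_of_lt (by exact_mod_cast hs) hr
    rw [invertedPath_of_mem (hVU (hmem s hs'))]
    exact hVI (hmem s hs')

variable [TopologicalSpace E]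

/-- Skeletons of paths in `V` up to time `r` which pass through the sets of `l`. -/
def stayingEvent (V : Set E) (l : List (ℝ≥0 × Set E)) (r : ℝ≥0) :
    Set (ℕ × ℕ → E) :=
  {p | ∀ s ∈ Icc 0 r, extendSkeleton p s ∈ V} ∩
    cylinderEvent (fun s p => some (extendSkeleton p s)) 0 l

theorem mem_stayingEvent_iff [T2Space E] {Z : ℝ≥0 → Ω → E}
    (hZ : IsRightContinuousPath (stopPath r fun s => Z s ω)) (hr : totalTime l ≤ r) :
    skeleton (stopPath r fun s => Z s ω) ∈ stayingEvent V l r ↔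
      (∀ s ≤ r, Z s ω ∈ V) ∧ ω ∈ cylinderEvent (fun s ω => some (Z s ω)) 0 l := by
  refine and_congr ?_ (mem_cylinderEvent_congr l fun u hu => ?_)
  · rw [mem_ofPred_eq, extendSkeleton_skeleton hZ]
    refine forall_congr' fun s => ?_
    simp only [mem_Icc, zero_le, true_and]
    refine forall_congr' fun hs => ?_
    rw [stopPath_of_le _ hs]
  · rw [extendSkeleton_skeleton hZ, stopPath_of_le _ (by rw [zero_add]; exact hu.trans hr)]

theorem continuousWithinAt_invertedPath (hU : IsOpen U) (hI : ContinuousOn I U)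
    (hr : IsRightContinuousPath fun s => X s ω)
    (habs : ∀ s t, s ≤ t → X s ω ∉ U → X t ω = X s ω)
    (h : ∃ a, (t : ℝ≥0∞) < clock X U v a ω) :
    ContinuousWithinAt (fun s => invertedPath X U I v s ω) (Ici t) t := by
  have hmem : ∀ {s}, (∃ a, ((s : ℝ≥0) : ℝ≥0∞) < clock X U v a ω) →
      X (inverseClock X U v s ω) ω ∈ U := fun ⟨a, ha⟩ =>
    (lt_exitTime_iff_mem_of_absorbed hU hr habs _).1 (inverseClock_lt ha).2
  have hlim : Tendsto (fun s => X (inverseClock X U v s ω) ω) (𝓝[≥] t)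
      (𝓝 (X (inverseClock X U v t ω) ω)) :=
    Tendsto.comp (hr _) (continuousWithinAt_inverseClock h)
  have h1 := (hI.continuousAt (hU.mem_nhds (hmem h))).tendsto.comp hlim
  have hev : ∀ᶠ s in 𝓝[≥] t, X (inverseClock X U v s ω) ω ∈ U :=
    hlim.eventually_mem (hU.mem_nhds (hmem h))
  rw [ContinuousWithinAt, invertedPath_of_mem (hmem h)]
  refine h1.congr' ?_
  filter_upwards [hev] with s hs
  rw [invertedPath_of_mem hs, Function.comp]

section

variable [MeasurableSpace E] [PolishSpace E] [BorelSpace E]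

/-- Applying the involution to the inverted path shows that the time-changed path stays in V up to
r. The values of the inverse clock fill all times before γ_r, so the path itself has not left V. The
margin beyond the last time is needed because aliveness at t requires a positive stretch after γ_t.
-/
theorem mem_aliveCylinder_of_stays (hU : IsOpen U) (hVU : V ⊆ U) (hVI : MapsTo I V V)
    (hII : Function.Involutive I) (hv : ContinuousOn v U) (hv0 : ∀ y ∈ U, 0 < v y)
    (hr : IsRightContinuousPath fun s => X s ω)
    (habs : ∀ s t, s ≤ t → X s ω ∉ U → X t ω = X s ω) (htr : totalTime l < r)
    (halive : ∃ a, (r : ℝ≥0∞) < clock X U v a ω)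
    (hmem : ∀ s ≤ r, invertedPath X U I v s ω ∈ V)
    (hcyl : ω ∈ cylinderEvent (fun s ω => some (invertedPath X U I v s ω)) 0 l) :
    ω ∈ aliveCylinder X V I v l := by
  obtain ⟨b, hb⟩ := halive
  have hU' : ∀ s ≤ r, X (inverseClock X U v s ω) ω ∈ U := fun s hs =>
    (lt_exitTime_iff_mem_of_absorbed hU hr habs _).1
      (inverseClock_lt (lt_of_le_of_lt (by exact_mod_cast hs) hb)).2
  have hV : ∀ s ≤ r, X (inverseClock X U v s ω) ω ∈ V := fun s hs => by
    have := hVI (hmem s hs)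
    rwa [invertedPath_of_mem (hU' s hs), hII] at this
  obtain ⟨a, haV, ha⟩ := alive_of_forall_inverseClock_mem hr hU.measurableSet hVU hv hv0 ⟨b, hb⟩
    hV htr
  refine ⟨(mem_cylinderEvent_congr l fun u hu => ?_).1 hcyl, a, ha⟩
  rw [zero_add]
  have hua : (u : ℝ≥0∞) < clock X V v a ω := lt_of_le_of_lt (by exact_mod_cast hu) ha
  rw [invertedProcess_eq_some ⟨a, hua⟩, invertedPath_of_mem (hU' u (hu.trans htr.le)),
    inverseClock_eq_of_subset hVU haV hua]

end

variable [MeasurableSpace E] [MeasurableSpace Ω] [PolishSpace E] [BorelSpace E]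
  {P : E → Measure Ω} {ℱ : Filtration ℝ≥0 ‹MeasurableSpace Ω›} {h : E → ℝ≥0∞}

theorem universallyMeasurable_stayingEvent (hV : MeasurableSet V)
    (hl : ∀ b ∈ l, MeasurableSet b.2) (r : ℝ≥0) :
    UniversallyMeasurable (stayingEvent V l r) :=
  (universallyMeasurable_forall_mem measurableSet_Icc hV).inter
    (measurableSet_cylinderEvent_some
      (fun t => (measurable_const (a := t)).extendSkeleton measurable_id) hl 0).universallyMeasurable

theorem measurable_invertedPath (hU : IsOpen U) (hI : ContinuousOn I U) (hv : ContinuousOn v U)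
    (hX : ∀ t, Measurable (X t)) (hr : ∀ ω, IsRightContinuousPath fun s => X s ω)
    (habs : ∀ ω s t, s ≤ t → X s ω ∉ U → X t ω = X s ω) (t : ℝ≥0) :
    Measurable (invertedPath X U I v t) := by
  classical
  have hT : Measurable fun ω => inverseClock X U v t ω := by
    simp only [fun ω => inverseClock_eq_pathInverse_of_absorbed (v := v) hU (hr ω) (habs ω) t]
    exact measurable_pathInverse_comp (measurable_clockRate hU.measurableSet hv) hX hr t
  exact (hI.measurable_piecewise continuousOn_const hU.measurableSet).comp
    (measurable_uncurry_of_isRightContinuousPath hX hr hT)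

theorem measurableSet_exists_lt_clock (hU : IsOpen U) (hv : ContinuousOn v U)
    (hX : ∀ t, Measurable (X t)) (hr : ∀ ω, IsRightContinuousPath fun s => X s ω)
    (habs : ∀ ω s t, s ≤ t → X s ω ∉ U → X t ω = X s ω) (t : ℝ≥0) :
    MeasurableSet {ω | ∃ a, (t : ℝ≥0∞) < clock X U v a ω} := by
  have hk := measurable_clockRate hU.measurableSet hv
  have hset : {ω | ∃ a, (t : ℝ≥0∞) < clock X U v a ω} =
      ⋃ n : ℕ, {ω | (t : ℝ≥0∞) < clock X U v n ω} := by
    ext ω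
    simp only [mem_ofPred_eq, mem_iUnion]
    exact ⟨fun ⟨a, ha⟩ => ⟨⌈a⌉₊, ha.trans_le (clock_mono X U v ω (Nat.le_ceil a))⟩,
      fun ⟨n, hn⟩ => ⟨n, hn⟩⟩
  rw [hset]
  refine MeasurableSet.iUnion fun n => measurableSet_lt measurable_const ?_
  have h := (measurable_pathClock hk (n : ℝ≥0)).comp (measurable_skeleton hX)
  rw [show clock X U v n = _ from
    funext fun ω => clock_eq_pathClock_of_absorbed hU (hr ω) (habs ω) n]
  simpa only [Function.comp_def, extendSkeleton_skeleton (hr _)] using h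

/-- The finite-dimensional distributions of the inversion of `X` killed on exiting an invariant
subset. -/
theorem HasInversionProperty.measure_aliveCylinder (hX : IsStandardProcess P X ℱ U)
    (hIP : HasInversionProperty P X U I h v) (hU : IsOpen U) (hI : ContinuousOn I U)
    (hh : ContinuousOn h U) (hV : MeasurableSet V) (hVU : V ⊆ U) (hVI : MapsTo I V V)
    (hl : ∀ b ∈ l, MeasurableSet b.2) {x : E} (hx : x ∈ V) :
    P x (aliveCylinder X V I v l) = (h (I x))⁻¹ *
      ∫⁻ ω in cylinderEvent (killedProcess X V) 0 l ∩
        {ω | (totalTime l : ℝ≥0∞) < exitTime X V ω},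
          U.indicator h (X (totalTime l) ω) ∂P (I x) := by
  have := hX.isProbabilityMeasure
  have hhm : Measurable (U.indicator h) := by
    classical
    rw [← piecewise_eq_indicator]
    exact hh.measurable_piecewise continuousOn_const hU.measurableSet
  have hhtop : ∀ y, U.indicator h y ≠ ⊤ := fun y => by
    by_cases hy : y ∈ U
    · rw [indicator_of_mem hy]; exact (hIP.pos_finite y hy).2.ne
    · rw [indicator_of_notMem hy]; exact ENNReal.zero_ne_top
  have hdoob : doobSet U h = U := by
    ext y; exact ⟨fun h => h.1, fun hy => ⟨hy, hIP.pos_finite y hy⟩⟩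
  have hXr := hX.isRightContinuousPath
  have hIx : I x ∈ V := hVI hx
  have hIxU := hVU hIx
  have hZ : ∀ t, Measurable (invertedPath X U I v t) :=
    measurable_invertedPath hU hI hIP.continuousOn_v hX.measurable hXr hX.absorbed
  have habs := hX.absorbed
  have hcont : ∀ {r : ℝ≥0} {ω}, (∃ a, (r : ℝ≥0∞) < clock X U v a ω) → ∀ s ≤ r,
      ContinuousWithinAt (fun s => invertedPath X U I v s ω) (Ici s) s :=
    fun {r ω} ⟨a, ha⟩ s hs => continuousWithinAt_invertedPath hU hI (hXr ω) (habs ω)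
      ⟨a, lt_of_le_of_lt (by exact_mod_cast hs) ha⟩
  -- Staying in V up to `r m` is a path event to which the inversion in U applies at the
  -- deterministic time `r m`; letting m grow recovers aliveness just after the last time.
  set r : ℕ → ℝ≥0 := fun m => totalTime l + 1 / ((m : ℝ≥0) + 1) with hrdef
  have hrlim : Tendsto r atTop (𝓝[≥] (totalTime l)) := tendsto_add_one_div _
  have hrlt : ∀ m, totalTime l < r m := fun m => lt_add_of_pos_right _ (by positivity)
  have hmemU : ∀ (w : ℝ≥0 → E),
      ContinuousWithinAt w (Ici (totalTime l)) (totalTime l) → w (totalTime l) ∈ U →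
      Tendsto (fun m => U.indicator h (w (r m))) atTop (𝓝 (U.indicator h (w (totalTime l)))) := by
    intro w hw hwU
    have hc : ContinuousAt (U.indicator h) (w (totalTime l)) :=
      (hh.continuousAt (hU.mem_nhds hwU)).congr (by
        filter_upwards [hU.mem_nhds hwU] with y hy using (indicator_of_mem hy h).symm)
    exact hc.tendsto.comp (hw.tendsto.comp hrlim)
  have hS'iff : ∀ m ω, ω ∈ {ω | skeleton (stopPath (r m) fun s => invertedPath X U I v s ω) ∈
      stayingEvent V l (r m)} ∩ {ω | ∃ y, invertedProcess X U I v (r m) ω = some y} ↔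
      ((∃ a, (r m : ℝ≥0∞) < clock X U v a ω) ∧ (∀ s ≤ r m, invertedPath X U I v s ω ∈ V) ∧
        ω ∈ cylinderEvent (fun s ω => some (invertedPath X U I v s ω)) 0 l) := by
    intro m ω
    rw [mem_inter_iff, and_comm, mem_ofPred_eq, invertedProcess_eq_some_iff]
    refine and_congr_right fun hω => ?_
    exact mem_stayingEvent_iff (isRightContinuousPath_stopPath_of_lt fun s hs => hcont hω s hs.le)
      (hrlt m).le
  have hSiff : ∀ m ω, ω ∈ {ω | skeleton (stopPath (r m) fun s => X s ω) ∈
      stayingEvent V l (r m)} ∩ {ω | (r m : ℝ≥0∞) < exitTime X U ω} ↔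
      ((∀ s ≤ r m, X s ω ∈ V) ∧ ω ∈ cylinderEvent (fun s ω => some (X s ω)) 0 l) := by
    intro m ω
    rw [mem_inter_iff, mem_ofPred_eq, mem_ofPred_eq,
      lt_exitTime_iff_mem_of_absorbed hU (hXr ω) (habs ω),
      mem_stayingEvent_iff ((hXr ω).stopPath _) (hrlt m).le]
    exact and_iff_left_of_imp fun h' => hVU (h'.1 _ le_rfl)
  have hcylX : ∀ ω, (totalTime l : ℝ≥0∞) < exitTime X V ω →
      (ω ∈ cylinderEvent (killedProcess X V) 0 l ↔
        ω ∈ cylinderEvent (fun s ω => some (X s ω)) 0 l) := fun ω hω =>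
    mem_cylinderEvent_congr l fun u hu => if_pos
      (lt_of_le_of_lt (by rw [zero_add]; exact_mod_cast hu) hω)
  have hUm := fun m => universallyMeasurable_stayingEvent hV hl (r m)
  have hVdoob : MeasurableSet (doobSet U h) := by rw [hdoob]; exact hU.measurableSet
  have hhm' : Measurable ((doobSet U h).indicator h) := by rwa [hdoob]
  have hlaw := hIP.law x (hVU hx)
  have hxdoob : I x ∈ doobSet U h := by rwa [hdoob]
  have halivem : ∀ m, MeasurableSet {ω | ∃ y, invertedProcess X U I v (r m) ω = some y} := by
    intro m
    simp only [invertedProcess_eq_some_iff]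
    exact measurableSet_exists_lt_clock hU hIP.continuousOn_v hX.measurable hXr habs _
  refine measure_eq_lintegral_of_truncated
    (S' := fun m => {ω | skeleton (stopPath (r m) fun s => invertedPath X U I v s ω) ∈
      stayingEvent V l (r m)} ∩ {ω | ∃ y, invertedProcess X U I v (r m) ω = some y})
    (S := fun m => {ω | skeleton (stopPath (r m) fun s => X s ω) ∈
      stayingEvent V l (r m)} ∩ {ω | (r m : ℝ≥0∞) < exitTime X U ω})
    (b := fun m ω => U.indicator h (invertedPath X U I v (r m) ω))
    (β := fun ω => U.indicator h (invertedPath X U I v (totalTime l) ω))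
    (c := fun m ω => U.indicator h (X (r m) ω))
    (ENNReal.inv_ne_top.2 (hIP.pos_finite _ hIxU).1.ne')
    (fun m => ((hUm m).preimage (measurable_skeleton_stopPath hZ (r m)) (P x) inferInstance).inter
      (halivem m).nullMeasurableSet)
    (fun m => ((hUm m).preimage (measurable_skeleton_stopPath hX.measurable (r m)) (P (I x))
      inferInstance).inter (nullMeasurableSet_lt_exitTime hX.measurable hXr hU.measurableSet _ _))
    (fun m => hhm.comp (hZ _)) (fun m => hhm.comp (hX.measurable _)) (fun ω => hhtop _)
    ?_ ?_ ?_ ?_ fun N m => ?_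
  · filter_upwards [hX.normal x] with ω h0 hω
    obtain ⟨hcyl, a, hta, hmem⟩ := stays_of_mem_aliveCylinder hVU hVI (by rwa [h0]) hω
    refine ⟨?_, hmemU (fun s => invertedPath X U I v s ω)
      (hcont ⟨a, hta⟩ _ le_rfl) (hVU (hmem _ hta _ le_rfl))⟩
    have hev : ∀ᶠ m in atTop, (r m : ℝ≥0∞) < clock X U v a ω :=
      ((ENNReal.continuous_coe.tendsto _).comp
        (tendsto_nhdsWithin_iff.1 hrlim).1).eventually_lt_const hta
    filter_upwards [hev] with m hm using (hS'iff m ω).2 ⟨⟨a, hm⟩, hmem _ hm, hcyl⟩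
  · refine Eventually.of_forall fun ω m hω => ?_
    obtain ⟨h1, h2, h3⟩ := (hS'iff m ω).1 hω
    exact mem_aliveCylinder_of_stays hU hVU hVI hIP.involutive hIP.continuousOn_v hIP.v_pos (hXr ω)
      (habs ω) (hrlt m) h1 h2 h3
  · filter_upwards [hX.ae_mem_of_lt_exitTime hIx] with ω hmem hω
    refine ⟨?_, hmemU (fun s => X s ω) (hXr ω _) (hVU (hmem _ hω.2))⟩
    have hev : ∀ᶠ m in atTop, (r m : ℝ≥0∞) < exitTime X V ω :=
      ((ENNReal.continuous_coe.tendsto _).comp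
        (tendsto_nhdsWithin_iff.1 hrlim).1).eventually_lt_const hω.2
    filter_upwards [hev] with m hm
    exact (hSiff m ω).2 ⟨fun s hs => hmem s (lt_of_le_of_lt (by exact_mod_cast hs) hm),
      (hcylX ω hω.2).1 hω.1⟩
  · refine Eventually.of_forall fun ω m hω => ?_
    obtain ⟨h1, h2⟩ := (hSiff m ω).1 hω
    have hτ : (totalTime l : ℝ≥0∞) < exitTime X V ω :=
      lt_exitTime_iff.2 ⟨r m, hrlt m, fun s _ hs => h1 s hs.le⟩
    exact ⟨(hcylX ω hτ).2 h2, hτ⟩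
  · have hf : Measurable fun y => min 1 ((N : ℝ≥0∞) / U.indicator h y) :=
      measurable_const.min (measurable_const.div hhm)
    -- The inversion property of X in U, tested on the staying event against min(1, N/h).
    have hmain := hlaw.setLIntegral_eq hX hVdoob hhm' hxdoob (r := r m) hZ (fun ω hω s hs => ?_)
      (hUm m) hf
    · have hmin : ∀ y, U.indicator h y * min 1 ((N : ℝ≥0∞) / U.indicator h y) =
          min (U.indicator h y) N := fun y => ENNReal.mul_min_one_div (hhtop y)
      rw [hdoob] at hmain
      exact hmain.trans (congrArg _ (lintegral_congr fun ω => hmin _))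
    · obtain ⟨a, ha⟩ := invertedProcess_eq_some_iff.1 hω
      have hsa : (s : ℝ≥0∞) < clock X U v a ω := lt_of_le_of_lt (by exact_mod_cast hs) ha
      rw [invertedProcess_eq_some ⟨a, hsa⟩, invertedPath_of_mem
        ((lt_exitTime_iff_mem_of_absorbed hU (hXr ω) (habs ω) _).1 (inverseClock_lt hsa).2)]

end RestrictedInversion

/-! ### Integrals of the localized inversion -/

section InvertedIntegrals

variable {E Ω : Type*} {X : ℝ≥0 → Ω → E} {U V : Set E} {I : E → E} {v : E → ℝ}
  {l : List (ℝ≥0 × Set E)} {t : ℝ≥0} {ω : Ω}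

theorem pathInverse_of_mem_aliveCylinder (h0 : X 0 ω ∈ V) (hω : ω ∈ aliveCylinder X V I v l) :
    pathInverse (clockRate V v) (fun s => X s ω) (totalTime l) =
        inverseClock X V v (totalTime l) ω ∧
      X (inverseClock X V v (totalTime l) ω) ω ∈ V := by
  obtain ⟨s₀, hs₀⟩ := hω.2
  obtain ⟨s₁, -, hs₁, hs₁'⟩ := exists_lt_of_lt_clock hs₀
  constructor
  · rw [clock_eq_pathClock hs₁] at hs₁'
    exact (inverseClock_eq_pathInverse hs₁ hs₁').symm
  · rcases eq_or_ne (inverseClock X V v (totalTime l) ω) 0 with hz | hz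
    · rw [hz]; exact h0
    · exact mem_of_lt_exitTime (inverseClock_lt hs₀).2 (pos_iff_ne_zero.2 hz) le_rfl

variable [TopologicalSpace E] [MeasurableSpace E] [MeasurableSpace Ω] [PolishSpace E]
  [BorelSpace E] [Nonempty E] {P : E → Measure Ω} {ℱ : Filtration ℝ≥0 ‹MeasurableSpace Ω›}
  {h : E → ℝ≥0∞}

/-- Integrals of the inversion of `X` killed on exiting an invariant subset. -/
theorem HasInversionProperty.setLIntegral_aliveCylinder (hX : IsStandardProcess P X ℱ U)
    (hIP : HasInversionProperty P X U I h v) (hU : IsOpen U) (hI : ContinuousOn I U)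
    (hh : ContinuousOn h U) (hV : MeasurableSet V) (hVU : V ⊆ U) (hVI : MapsTo I V V)
    (hl : ∀ b ∈ l, MeasurableSet b.2) {x : E} (hx : x ∈ V) {f : E → ℝ≥0∞} (hf : Measurable f) :
    ∫⁻ ω in aliveCylinder X V I v l,
        f (X (pathInverse (clockRate V v) (fun s => X s ω) (totalTime l)) ω) ∂P x =
      (h (I x))⁻¹ * ∫⁻ ω in cylinderEvent (killedProcess X V) 0 l ∩
        {ω | (totalTime l : ℝ≥0∞) < exitTime X V ω},
          V.indicator (fun y => h y * f (I y)) (X (totalTime l) ω) ∂P (I x) := by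
  classical
  set G := cylinderEvent (killedProcess X V) 0 l ∩
    {ω | (totalTime l : ℝ≥0∞) < exitTime X V ω} with hG
  have hXr := hX.isRightContinuousPath
  have hk := measurable_clockRate hV (hIP.continuousOn_v.mono hVU)
  set ψ : Ω → E := fun ω => X (pathInverse (clockRate V v) (fun s => X s ω) (totalTime l)) ω
    with hψdef
  have hψ : Measurable ψ := measurable_uncurry_of_isRightContinuousPath hX.measurable hXr
    (measurable_pathInverse_comp hk hX.measurable hXr _)
  -- Nothing is known about I off U, so it is made constant off V to be measurable.
  set ι : E → E := V.piecewise I fun _ => Classical.arbitrary E with hιdef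
  have hι : Measurable ι := (hI.mono hVU).measurable_piecewise continuousOn_const hV
  have hιψ : Measurable fun ω => ι (ψ ω) := hι.comp hψ
  have hfι : Measurable fun y => f (ι y) := hf.comp hι
  have hιV : ∀ y ∈ V, ι y = I y := fun y hy => piecewise_eq_of_mem _ _ _ hy
  have hhm : Measurable (U.indicator h) := by
    rw [← piecewise_eq_indicator]
    exact hh.measurable_piecewise continuousOn_const hU.measurableSet
  have hψV : ∀ᵐ ω ∂(P x).restrict (aliveCylinder X V I v l), ψ ω ∈ V := by
    rw [ae_restrict_iff (hψ hV)]
    filter_upwards [hX.normal x] with ω h0 hω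
    obtain ⟨h1, h2⟩ := pathInverse_of_mem_aliveCylinder (by rwa [h0]) hω
    rw [hψdef]
    dsimp only
    rwa [h1]
  have hmap : ((P x).restrict (aliveCylinder X V I v l)).map (fun ω => ι (ψ ω)) =
      (h (I x))⁻¹ • (((P (I x)).restrict G).map (X (totalTime l))).withDensity (U.indicator h) := by
    refine Measure.ext fun B hB => ?_
    have hXB : MeasurableSet (X (totalTime l) ⁻¹' B) := hX.measurable _ hB
    rw [Measure.map_apply hιψ hB, Measure.restrict_apply (hιψ hB),
      Measure.smul_apply, withDensity_apply _ hB, setLIntegral_map hB hhm (hX.measurable _),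
      Measure.restrict_restrict hXB, smul_eq_mul]
    -- The extra constraint (0, B) at the end of the list turns cylinder probabilities into the law
    -- of the last position on the cylinder.
    have hl' : ∀ b ∈ l ++ [(0, B)], MeasurableSet b.2 := by
      intro b hb
      rcases List.mem_append.1 hb with hb | hb
      · exact hl b hb
      · rw [List.mem_singleton.1 hb]; exact hB
    have hmain := hIP.measure_aliveCylinder hX hU hI hh hV hVU hVI hl' hx
    rw [totalTime_append_singleton] at hmain
    have hGB : cylinderEvent (killedProcess X V) 0 (l ++ [(0, B)]) ∩
        {ω | (totalTime l : ℝ≥0∞) < exitTime X V ω} = X (totalTime l) ⁻¹' B ∩ G := by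
      ext ω
      rw [mem_inter_iff, mem_cylinderEvent_append_singleton, exists_killedProcess_eq_some_iff,
        zero_add]
      simp only [hG, mem_inter_iff, mem_preimage, mem_ofPred_eq]
      tauto
    rw [hGB] at hmain
    rw [← hmain]
    refine measure_congr ?_
    filter_upwards [hX.normal x] with ω h0
    refine propext ?_
    change ι (ψ ω) ∈ B ∧ ω ∈ aliveCylinder X V I v l ↔ ω ∈ aliveCylinder X V I v (l ++ [(0, B)])
    have hiff : ω ∈ aliveCylinder X V I v (l ++ [(0, B)]) ↔ (ω ∈ aliveCylinder X V I v l ∧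
        ∃ y ∈ B, invertedProcess X V I v (totalTime l) ω = some y) := by
      simp only [aliveCylinder, mem_inter_iff, mem_cylinderEvent_append_singleton,
        totalTime_append_singleton, zero_add]
      tauto
    rw [hiff, and_comm]
    refine and_congr_right fun hω => ?_
    obtain ⟨h1, h2⟩ := pathInverse_of_mem_aliveCylinder (by rwa [h0]) hω
    rw [invertedProcess_eq_some hω.2, hψdef]
    dsimp only
    rw [h1, hιV _ h2]
    simp
  -- The position before inversion is recovered by applying I once more.
  have e1 : ∫⁻ ω in aliveCylinder X V I v l, f (ψ ω) ∂P x =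
      ∫⁻ y, f (ι y) ∂((P x).restrict (aliveCylinder X V I v l)).map (fun ω => ι (ψ ω)) := by
    rw [lintegral_map hfι hιψ]
    refine lintegral_congr_ae ?_
    filter_upwards [hψV] with ω hω
    rw [hιV _ hω, hιV _ (hVI hω), hIP.involutive]
  have hGV : ∀ᵐ ω ∂(P (I x)).restrict G, X (totalTime l) ω ∈ V := by
    rw [ae_restrict_iff (hX.measurable _ hV)]
    filter_upwards [hX.ae_mem_of_lt_exitTime (hVI hx)] with ω hω hωG using hω _ hωG.2
  rw [e1, hmap, lintegral_smul_measure, smul_eq_mul,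
    lintegral_withDensity_eq_lintegral_mul _ hhm hfι,
    lintegral_map (hhm.mul hfι) (hX.measurable _)]
  congr 1
  refine lintegral_congr_ae ?_
  filter_upwards [hGV] with ω hω
  rw [Pi.mul_apply, indicator_of_mem (hVU hω), indicator_of_mem hω, hιV _ hω]

end InvertedIntegrals

/-! ### Doob transforms of processes with the inversion property -/

section Concentrated

variable {E : Type*} [MeasurableSpace E]

theorem aemeasurable_of_measurable_indicator {V : Set E} {f : E → ℝ≥0∞}
    (hf : Measurable (V.indicator f)) {μ : Measure E} (hμ : ∀ᵐ y ∂μ, y ∈ V) : AEMeasurable f μ :=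
  ⟨V.indicator f, hf, by filter_upwards [hμ] with y hy using (indicator_of_mem hy f).symm⟩

theorem measurable_indicator_of_measurable_restrict {V : Set E} (hV : MeasurableSet V)
    {f : E → ℝ≥0∞} (hf : Measurable fun x : V => f x) : Measurable (V.indicator f) := by
  refine measurable_of_restrict_of_restrict_compl hV ?_ ?_
  · convert hf using 1
    funext y
    exact indicator_of_mem y.2 f
  · convert measurable_const (a := (0 : ℝ≥0∞)) using 1
    funext y
    exact indicator_of_notMem y.2 f

end Concentrated

section Conditioning

/-- A nonempty list already requires aliveness at its last time. For the empty list it would be an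
additional condition. -/
theorem cylinderEvent_inter_alive {E Ω : Type*} {l : List (ℝ≥0 × Set E)}
    {W : ℝ≥0 → Ω → Option E} (hl : l ≠ []) :
    cylinderEvent W 0 l ∩ {ω | ∃ y, W (totalTime l) ω = some y} = cylinderEvent W 0 l := by
  have key : ∀ (l : List (ℝ≥0 × Set E)) (a : ℝ≥0), l ≠ [] → ∀ ω ∈ cylinderEvent W a l,
      ∃ y, W (a + totalTime l) ω = some y := by
    intro l
    induction l with
    | nil => exact fun a h => absurd rfl h
    | cons b l ih =>
      obtain ⟨s, B⟩ := b
      intro a _ ω hω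
      obtain ⟨⟨y, -, hy⟩, hω'⟩ := mem_cylinderEvent_cons.1 hω
      rcases eq_or_ne l [] with rfl | hne
      · exact ⟨y, by simpa [totalTime] using hy⟩
      · rw [totalTime_cons, ← add_assoc]
        exact ih _ hne ω hω'
  refine inter_eq_left.2 fun ω hω => ?_
  have := key l 0 hl ω hω
  rwa [zero_add] at this

theorem IsDoobTransform.map_restrict {E Ω Ω' : Type*} [TopologicalSpace E]
    [MeasurableSpace E] [MeasurableSpace Ω] [MeasurableSpace Ω'] {P : E → Measure Ω}
    {X : ℝ≥0 → Ω → E} {D : Set E} {g : E → ℝ≥0∞} {P' : E → Measure Ω'} {Y : ℝ≥0 → Ω' → E}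
    (hY : IsDoobTransform P X D g P' Y) {x : E}
    (hx : x ∈ doobSet D g) (t : ℝ≥0) :
    ((P' x).restrict {ω | (t : ℝ≥0∞) < exitTime Y (doobSet D g) ω}).map (Y t) =
      doobSemigroup P X D g t x := by
  refine Measure.ext fun B hB => ?_
  have h := hY.law x hx [(t, B)] (by simpa using hB)
  rw [semigroupFdd] at h
  simp only [semigroupFdd, lintegral_const, one_mul, Measure.restrict_apply MeasurableSet.univ,
    univ_inter] at h
  rw [Measure.map_apply (hY.measurable t) hB, Measure.restrict_apply (hY.measurable t hB), ← h]
  congr 1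
  ext ω
  rw [mem_cylinderEvent_cons, exists_killedProcess_eq_some_iff, zero_add]
  simp [cylinderEvent, and_comm]

variable {E Ω Ω' : Type*} [TopologicalSpace E] [MeasurableSpace E] [MeasurableSpace Ω]
  [MeasurableSpace Ω'] [PolishSpace E] [BorelSpace E] [Nonempty E]
  {P : E → Measure Ω} {X : ℝ≥0 → Ω → E} {ℱ : Filtration ℝ≥0 ‹MeasurableSpace Ω›} {U D : Set E}
  {I : E → E} {h g : E → ℝ≥0∞} {v : E → ℝ} {P' : E → Measure Ω'} {Y : ℝ≥0 → Ω' → E}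
  {l : List (ℝ≥0 × Set E)}

/-- The heart of the matter: the time-changed density g(X_{γ_t})/g(x) of Y is fed into the inversion
of X on the Doob set. Both weights combine into h · (g ∘ I), normalized at I(x), since I(I(x)) = x.
-/
theorem IsDoobTransform.measure_aliveCylinder (hY : IsDoobTransform P X D g P' Y)
    (hX : IsStandardProcess P X ℱ U) (hIP : HasInversionProperty P X U I h v) (hU : IsOpen U)
    (hI : ContinuousOn I U) (hh : ContinuousOn h U) (hV : MeasurableSet (doobSet D g))
    (hVU : doobSet D g ⊆ U) (hVI : MapsTo I (doobSet D g) (doobSet D g))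
    (hg : ContinuousOn g (doobSet D g)) (hl : ∀ b ∈ l, MeasurableSet b.2) {x : E}
    (hx : x ∈ doobSet D g) :
    P' x (aliveCylinder Y (doobSet D g) I v l) = (h (I x) * g (I (I x)))⁻¹ *
      ∫⁻ ω in cylinderEvent (killedProcess X (doobSet D g)) 0 l ∩
        {ω | (totalTime l : ℝ≥0∞) < exitTime X (doobSet D g) ω},
          (doobSet D g).indicator (fun y => h y * g (I y)) (X (totalTime l) ω) ∂P (I x) := by
  have hgm : Measurable ((doobSet D g).indicator g) := by
    classical
    rw [← piecewise_eq_indicator]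
    exact hg.measurable_piecewise continuousOn_const hV
  have hIx := hIP.pos_finite _ (hVU (hVI hx))
  rw [(hY.law x hx).measure_aliveCylinder hX hV hg hx hY.measurable hY.right_continuous
    (hIP.continuousOn_v.mono hVU) (hI.mono hVU) hl,
    hIP.setLIntegral_aliveCylinder hX hU hI hh hV hVU hVI hl hx hgm, hIP.involutive x,
    ENNReal.mul_inv (Or.inl hIx.1.ne') (Or.inl hIx.2.ne), mul_comm (h (I x))⁻¹ (g x)⁻¹, mul_assoc]
  refine congrArg _ (congrArg _ (lintegral_congr fun ω => ?_))
  by_cases hω : X (totalTime l) ω ∈ doobSet D g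
  · rw [indicator_of_mem hω, indicator_of_mem hω, indicator_of_mem (hVI hω)]
  · rw [indicator_of_notMem hω, indicator_of_notMem hω]

end Conditioning

/-! ### Iterated Doob transforms and the excessivity of the new function -/

section Conditioning

theorem doobSet_eq_self {E : Type*} {V : Set E} {k : E → ℝ≥0∞}
    (hk : ∀ y ∈ V, 0 < k y ∧ k y < ⊤) : doobSet V k = V := by
  ext y
  exact ⟨fun h => h.1, fun hy => ⟨hy, hk y hy⟩⟩

theorem IsStandardProcess.ae_mem_map_restrict {E Ω : Type*} [TopologicalSpace E]
    [MeasurableSpace E] [MeasurableSpace Ω] {P : E → Measure Ω} {X : ℝ≥0 → Ω → E}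
    {ℱ : Filtration ℝ≥0 ‹MeasurableSpace Ω›} {U V : Set E} (hX : IsStandardProcess P X ℱ U)
    (hV : MeasurableSet V) {x : E} (hx : x ∈ V) (t : ℝ≥0) :
    ∀ᵐ y ∂((P x).restrict {ω | (t : ℝ≥0∞) < exitTime X V ω}).map (X t), y ∈ V := by
  refine (ae_map_iff (p := fun y => y ∈ V) (hX.measurable t).aemeasurable hV).2 ?_
  refine (ae_restrict_iff (p := fun ω => X t ω ∈ V) (hX.measurable t hV)).2 ?_
  filter_upwards [hX.ae_mem_of_lt_exitTime hx] with ω hω using hω t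

/-- The probability that the time change is alive is right continuous. -/
theorem tendsto_measure_exists_lt_clock {E Ω : Type*} [MeasurableSpace Ω] (Q : Measure Ω)
    (Y : ℝ≥0 → Ω → E) (V : Set E) (v : E → ℝ) :
    Tendsto (fun t : ℝ≥0 => Q {ω | ∃ s, (t : ℝ≥0∞) < clock Y V v s ω}) (𝓝[>] 0)
      (𝓝 (Q {ω | ∃ s, ((0 : ℝ≥0) : ℝ≥0∞) < clock Y V v s ω})) := by
  have hanti : Antitone fun t : ℝ≥0 => {ω | ∃ s, (t : ℝ≥0∞) < clock Y V v s ω} :=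
    fun a b hab ω ⟨s, hs⟩ => ⟨s, lt_of_le_of_lt (by exact_mod_cast hab) hs⟩
  let r : ℕ → ℝ≥0 := fun n => 1 / ((n : ℝ≥0) + 1)
  have hr0 : ∀ n, 0 < r n := fun n => by positivity
  have hra : Antitone r := fun m n hmn => by
    have : (m : ℝ≥0) ≤ n := by exact_mod_cast hmn
    simp only [r]
    gcongr
  have hU : {ω | ∃ s, ((0 : ℝ≥0) : ℝ≥0∞) < clock Y V v s ω} =
      ⋃ n, {ω | ∃ s, (r n : ℝ≥0∞) < clock Y V v s ω} := by
    ext ω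
    simp only [mem_iUnion, mem_ofPred_eq]
    constructor
    · rintro ⟨s, hs⟩
      have hlim : Tendsto (fun n => (r n : ℝ≥0∞)) atTop (𝓝 ((0 : ℝ≥0) : ℝ≥0∞)) :=
        (ENNReal.continuous_coe.tendsto 0).comp
          (tendsto_one_div_add_atTop_nhds_zero_nat (𝕜 := ℝ≥0))
      obtain ⟨n, hn⟩ := (hlim.eventually_lt_const hs).exists
      exact ⟨n, s, hn⟩
    · rintro ⟨n, s, hs⟩
      exact ⟨s, lt_of_le_of_lt (by simp) hs⟩
  refine tendsto_order.2 ⟨fun a ha => ?_, fun a ha => ?_⟩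
  · rw [hU, Monotone.measure_iUnion fun m n hmn => hanti (hra hmn)] at ha
    obtain ⟨n, hn⟩ := lt_iSup_iff.1 ha
    filter_upwards [Ioo_mem_nhdsGT (hr0 n)] with t ht
    exact hn.trans_le (measure_mono (hanti ht.2.le))
  · exact Eventually.of_forall fun t => (measure_mono (hanti zero_le)).trans_lt ha

variable {E Ω Ω' : Type*} [TopologicalSpace E] [MeasurableSpace E] [MeasurableSpace Ω]
  [MeasurableSpace Ω']
  {P : E → Measure Ω} {X : ℝ≥0 → Ω → E} {ℱ : Filtration ℝ≥0 ‹MeasurableSpace Ω›} {U D : Set E}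
  {I : E → E} {h g k : E → ℝ≥0∞} {v : E → ℝ} {P' : E → Measure Ω'} {Y : ℝ≥0 → Ω' → E}

/-- A Doob transform of a Doob transform is a Doob transform. -/
theorem IsDoobTransform.doobSemigroup_eq (hY : IsDoobTransform P X D g P' Y)
    (hX : IsStandardProcess P X ℱ U) (hV : MeasurableSet (doobSet D g))
    (hg : Measurable ((doobSet D g).indicator g)) (hk : Measurable ((doobSet D g).indicator k))
    (hk0 : ∀ y ∈ doobSet D g, 0 < k y ∧ k y < ⊤) {q : E → ℝ≥0∞}
    (hq : ∀ y ∈ doobSet D g, g y * k y = q y) :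
    doobSemigroup P' Y (doobSet D g) k = doobSemigroup P X (doobSet D g) q := by
  have hq0 : ∀ y ∈ doobSet D g, 0 < q y ∧ q y < ⊤ := fun y hy => by
    rw [← hq y hy]
    exact ⟨ENNReal.mul_pos hy.2.1.ne' (hk0 y hy).1.ne', ENNReal.mul_lt_top hy.2.2 (hk0 y hy).2⟩
  funext t x
  rw [doobSemigroup, doobSemigroup, doobSet_eq_self hk0, doobSet_eq_self hq0]
  by_cases hx : x ∈ doobSet D g
  · simp only [if_pos hx]
    rw [hY.map_restrict hx, doobSemigroup]
    simp only [if_pos hx]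
    set ν := ((P x).restrict {ω | (t : ℝ≥0∞) < exitTime X (doobSet D g) ω}).map (X t)
    have hν : ∀ᵐ y ∂ν, y ∈ doobSet D g := hX.ae_mem_map_restrict hV hx t
    rw [withDensity_smul_measure, ← withDensity_mul₀ (aemeasurable_of_measurable_indicator hg hν)
      (aemeasurable_of_measurable_indicator hk hν), smul_smul,
      ← hq x hx, ENNReal.mul_inv (Or.inl hx.2.1.ne') (Or.inl hx.2.2.ne), mul_comm]
    refine congrArg _ (withDensity_congr_ae ?_)
    filter_upwards [hν] with y hy using hq y hy
  · simp only [if_neg hx]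

variable [PolishSpace E] [BorelSpace E] [Nonempty E]

/-- The inversion property of a Doob transform of a process with the inversion property. -/
theorem IsDoobTransform.hasInversionProperty (hY : IsDoobTransform P X D g P' Y)
    (hX : IsStandardProcess P X ℱ U) (hIP : HasInversionProperty P X U I h v) (hU : IsOpen U)
    (hI : ContinuousOn I U) (hh : ContinuousOn h U) (hD : MeasurableSet D) (hDU : D ⊆ U)
    (hID : MapsTo I D D) (hg : ContinuousOn g D) (hgtop : ∀ y ∈ D, g y < ⊤)
    (hexc : IsExcessiveOn P X D g) (hpos : ∀ y ∈ D, 0 < g y → 0 < g (I y)) :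
    HasInversionProperty P' Y (doobSet D g) I (fun y => h y * g (I y) / g y) v := by
  have := hX.isProbabilityMeasure
  have hgm : ∀ {W : Set E} {f : E → ℝ≥0∞}, MeasurableSet W → ContinuousOn f W →
      Measurable (W.indicator f) := fun {W f} hW hf => by
    classical
    rw [← piecewise_eq_indicator]
    exact hf.measurable_piecewise continuousOn_const hW
  have hV : MeasurableSet (doobSet D g) := by
    have : doobSet D g = D ∩ D.indicator g ⁻¹' Ioo 0 ⊤ := by
      ext y
      refine and_congr_right fun hy => ?_
      rw [mem_preimage, indicator_of_mem hy]
      rfl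
    rw [this]
    exact hD.inter (hgm hD hg measurableSet_Ioo)
  set V := doobSet D g with hVdef
  have hVD : V ⊆ D := fun y hy => hy.1
  have hVU : V ⊆ U := hVD.trans hDU
  have hVI : MapsTo I V V := fun y hy =>
    ⟨hID hy.1, hpos y hy.1 hy.2.1, hgtop _ (hID hy.1)⟩
  have hgV : ContinuousOn g V := hg.mono hVD
  set K : E → ℝ≥0∞ := fun y => h y * g (I y) with hK
  set k : E → ℝ≥0∞ := fun y => h y * g (I y) / g y with hk
  have hK0 : ∀ y ∈ V, 0 < K y ∧ K y < ⊤ := fun y hy =>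
    ⟨ENNReal.mul_pos (hIP.pos_finite y (hVU hy)).1.ne' (hVI hy).2.1.ne',
      ENNReal.mul_lt_top (hIP.pos_finite y (hVU hy)).2 (hVI hy).2.2⟩
  have hk0 : ∀ y ∈ V, 0 < k y ∧ k y < ⊤ := fun y hy =>
    ⟨ENNReal.div_pos (hK0 y hy).1.ne' hy.2.2.ne, ENNReal.div_lt_top (hK0 y hy).2.ne hy.2.1.ne'⟩
  have hIV : Measurable fun y : V => I y :=
    ((hI.mono hVU).domRestrict).measurable
  have hKr : Measurable fun y : V => K y := by
    have h1 : Measurable fun y : V => h y := ((hh.mono hVU).domRestrict).measurable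
    have h2 : Measurable fun y : V => g (I y) :=
      ((hgV.comp (hI.mono hVU) hVI).domRestrict).measurable
    exact h1.mul h2
  have hkr : Measurable fun y : V => k y := hKr.div (hgV.domRestrict).measurable
  have hKm := measurable_indicator_of_measurable_restrict hV hKr
  have hkm := measurable_indicator_of_measurable_restrict hV hkr
  have hsemi : doobSemigroup P' Y V k = doobSemigroup P X V K :=
    hY.doobSemigroup_eq hX hV (hgm hV hgV) hkm hk0 fun y hy =>
      ENNReal.mul_div_cancel hy.2.1.ne' hy.2.2.ne
  have hKself : doobSet V K = V := doobSet_eq_self hK0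
  have hlawform : ∀ x ∈ V, ∀ l : List (ℝ≥0 × Set E), (∀ b ∈ l, MeasurableSet b.2) →
      P' x (aliveCylinder Y V I v l) = (K (I x))⁻¹ *
      ∫⁻ ω in cylinderEvent (killedProcess X V) 0 l ∩
        {ω | (totalTime l : ℝ≥0∞) < exitTime X V ω}, V.indicator K (X (totalTime l) ω) ∂P (I x) :=
    fun x hx l hl => hY.measure_aliveCylinder hX hIP hU hI hh hV hVU hVI hgV hl hx
  have hlaw : ∀ x ∈ V, HasMarkovLaw (P' x) (invertedProcess Y V I v) (doobSemigroup P' Y V k)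
      (I x) := by
    intro x hx l hl
    -- The empty cylinder has probability 1 with no aliveness demanded, whereas `aliveCylinder`
    -- requires the clock to become positive.
    rcases eq_or_ne l [] with rfl | hne
    · have := (hY.law x hx).isProbabilityMeasure
      rw [semigroupFdd, cylinderEvent, measure_univ]
    · have hX' : cylinderEvent (killedProcess X V) 0 l ∩
          {ω | (totalTime l : ℝ≥0∞) < exitTime X V ω} = cylinderEvent (killedProcess X V) 0 l := by
        rw [← cylinderEvent_inter_alive (W := killedProcess X V) hne]
        ext ω
        have := exists_killedProcess_eq_some_iff (X := X) (D := V) (B := univ)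
          (t := totalTime l) (ω := ω)
        simp only [mem_univ, true_and, and_true] at this
        simp only [mem_inter_iff, mem_ofPred_eq, this]
        tauto
      have hY' : aliveCylinder Y V I v l = cylinderEvent (invertedProcess Y V I v) 0 l := by
        rw [← cylinderEvent_inter_alive (W := invertedProcess Y V I v) hne, aliveCylinder]
        simp only [invertedProcess_eq_some_iff]
      rw [← hY', hlawform x hx l hl, hX', hsemi,
        hX.semigroupFdd_doobSemigroup (by rwa [hKself]) (by rwa [hKself]) hl
          (by rw [hKself]; exact hVI hx), hKself]
      rfl
  -- The inversion law from I(x), with the single constraint `univ` at time t, computes the mass at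
  -- t of the k-transform from x, which is the killed semigroup on k divided by k(x).
  have hkilled : ∀ x ∈ V, ∀ t, killedSemigroup P' Y V t k x =
      k x * P' (I x) {ω | ∃ s, (t : ℝ≥0∞) < clock Y V v s ω} := by
    intro x hx t
    have h1 := hlaw (I x) (hVI hx) [(t, univ)] (by simp)
    have h2 : cylinderEvent (invertedProcess Y V I v) 0 [(t, univ)] =
        {ω | ∃ s, (t : ℝ≥0∞) < clock Y V v s ω} := by
      ext ω
      rw [mem_cylinderEvent_cons, zero_add]
      simp only [mem_univ, true_and, invertedProcess_eq_some_iff, mem_ofPred_eq, cylinderEvent,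
        and_true]
    have hν : ∀ᵐ y ∂((P' x).restrict {ω | (t : ℝ≥0∞) < exitTime Y V ω}).map (Y t), y ∈ V := by
      rw [hY.map_restrict hx, doobSemigroup]
      simp only [if_pos (show x ∈ doobSet D g from hx)]
      exact ((withDensity_absolutelyContinuous _ _).smul_left _).ae_le
        (hX.ae_mem_map_restrict hV hx t)
    rw [h2, hIP.involutive, semigroupFdd] at h1
    simp only [semigroupFdd, lintegral_const, one_mul, Measure.restrict_apply MeasurableSet.univ,
      univ_inter] at h1
    rw [h1, doobSemigroup, doobSet_eq_self hk0]
    simp only [if_pos hx]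
    rw [Measure.smul_apply, withDensity_apply _ MeasurableSet.univ, Measure.restrict_univ,
      lintegral_map' (aemeasurable_of_measurable_indicator hkm hν) (hY.measurable t).aemeasurable,
      smul_eq_mul, ← mul_assoc, ENNReal.mul_inv_cancel (hk0 x hx).1.ne' (hk0 x hx).2.ne, one_mul]
    rfl
  refine ⟨hIP.involutive, hIP.ne_id, hVI, ⟨hkr, fun x hx t => ?_, fun x hx => ?_⟩, hk0,
    hIP.continuousOn_v.mono hVU, fun x hx => hIP.v_pos x (hVU hx), hlaw⟩
  · have := (hY.law _ (hVI hx)).isProbabilityMeasure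
    rw [hkilled x hx t]
    exact mul_le_of_le_one_right' prob_le_one
  · have hIx := hVI hx
    have := (hY.law _ hIx).isProbabilityMeasure
    -- For the empty list the law formula reduces the probability that the clock is ever positive to
    -- that of X from x not leaving V at once.
    have hone : P' (I x) {ω | ∃ s, ((0 : ℝ≥0) : ℝ≥0∞) < clock Y V v s ω} = 1 := by
      have h1 := hlawform (I x) hIx [] (by simp)
      rw [hIP.involutive, aliveCylinder, cylinderEvent, cylinderEvent, univ_inter, univ_inter] at h1
      have h2 : ∀ᵐ ω ∂P x, V.indicator K (X (totalTime ([] : List (ℝ≥0 × Set E))) ω) = K x := by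
        filter_upwards [hX.normal x] with ω hω
        rw [show totalTime ([] : List (ℝ≥0 × Set E)) = 0 from rfl, hω, indicator_of_mem hx]
      rw [lintegral_congr_ae (ae_restrict_of_ae h2), setLIntegral_const] at h1
      have h3 := hX.measure_lt_exitTime_doobSet_eq_one hV hexc hg hgtop hx
      refine h1.trans ?_
      rw [show ((totalTime ([] : List (ℝ≥0 × Set E)) : ℝ≥0) : ℝ≥0∞) = 0 from rfl, h3, mul_one,
        ENNReal.inv_mul_cancel (hK0 x hx).1.ne' (hK0 x hx).2.ne]
    have hlim : Tendsto (fun t : ℝ≥0 => P' (I x) {ω | ∃ s, (t : ℝ≥0∞) < clock Y V v s ω})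
        (𝓝[>] 0) (𝓝 1) := by
      rw [← hone]
      exact tendsto_measure_exists_lt_clock _ Y V v
    have := ENNReal.Tendsto.const_mul (a := k x) hlim (Or.inr (hk0 x hx).2.ne)
    rw [mul_one] at this
    exact this.congr fun t => (hkilled x hx t).symm

end Conditioning

/-! ### The state space of the theorem -/

section StateSpace

theorem isOpen_stateInterior {n : ℕ} (S : Set (EuclideanSpace ℝ (Fin n))) :
    IsOpen (stateInterior S) := by
  refine OnePoint.isOpenEmbedding_coe.isOpenMap _ ?_
  exact (isOpen_interior.inter isOpen_compl_singleton).preimage continuous_subtype_val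

end StateSpace

theorem proposition2p7 {n : ℕ} (S : Set (EuclideanSpace ℝ (Fin n))) [LocallyCompactSpace S]
    (hS : ¬ Bornology.IsBounded S) (hS0 : (0 : EuclideanSpace ℝ (Fin n)) ∈ S)
    {Ω : Type*} [MeasurableSpace Ω] (P : OnePoint S → Measure Ω) (X : ℝ≥0 → Ω → OnePoint S)
    (ℱ : Filtration ℝ≥0 ‹MeasurableSpace Ω›)
    (hX : IsStandardProcess P X ℱ (stateInterior S))
    (I : OnePoint S → OnePoint S) (h : OnePoint S → ℝ≥0∞) (v : OnePoint S → ℝ)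
    (hIP : HasInversionProperty P X (stateInterior S) I h v)
    (hI : ContinuousOn I (stateInterior S)) (hh : ContinuousOn h (stateInterior S))
    (F : Set (OnePoint S)) (hF : MeasurableSet F) (hIF : I '' F = F)
    (H : OnePoint S → ℝ≥0) (hHcont : ContinuousOn H (F ∩ stateInterior S))
    (hHexc : IsExcessiveOn P X (F ∩ stateInterior S) (fun x => (H x : ℝ≥0∞)))
    (hHpos : ∀ x ∈ F ∩ stateInterior S, 0 < H x → 0 < H (I x))
    {Ω' : Type*} [MeasurableSpace Ω'] (P' : OnePoint S → Measure Ω')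
    (Y : ℝ≥0 → Ω' → OnePoint S)
    (hY : IsDoobTransform P X (F ∩ stateInterior S) (fun x => (H x : ℝ≥0∞)) P' Y) :
    HasInversionProperty P' Y (doobSet (F ∩ stateInterior S) (fun x => (H x : ℝ≥0∞))) I
      (fun x => h x * (H (I x) : ℝ≥0∞) / (H x : ℝ≥0∞)) v := by
  have := OnePoint.polishSpace S
  have hU := isOpen_stateInterior S
  refine hY.hasInversionProperty hX hIP hU hI hh (hF.inter hU.measurableSet) inter_subset_right
    (fun y hy => ⟨hIF ▸ mem_image_of_mem I hy.1, hIP.mapsTo hy.2⟩)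
    (ENNReal.continuous_coe.comp_continuousOn hHcont) (fun y _ => ENNReal.coe_lt_top) hHexc
    fun y hy hy0 => ?_
  exact_mod_cast hHpos y hy (by exact_mod_cast hy0)

end
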